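/- **Setting.** Let $X$ be a connected simple graph of bounded valency (possibly infinite), with vertex set $VX$, edge set $EX$ and set of oriented edges $\mathrm{OE}$; the reverse of $e\in\mathrm{OE}$ is $e^{-1}$, its origin and target are $o(e)$ and $t(e)$. Let $w:\mathrm{OE}\to(0,\infty)$ be a weight function (not necessarily symmetric) with $\sum_{e\in\mathrm{OE}}w(e)<\infty$. For an edge with orientations $e_1,e_2$ put $W(e)=w(e_1)w(e_2)$; for a path $p=(x_0,\dots,x_n)$ put $w(p)=\prod_j w(x_j,x_{j+1})$ and $l(p)=n$. A path is reduced if $x_{j-1}\neq x_{j+1}$ for $1\le j\le n-1$. Call closed paths of positive length equivalent if they differ by a cyclic shift; a prime cycle is an equivalence class that consists of reduced closed paths none of which is a proper power of a shorter closed path. Fix $x_0\in VX$, let $\Gamma=\pi_1(X,x_0)$ be the group of closed paths at $x_0$ up to insertion and removal of backtrackings, and let $\tau:\Gamma\to U(V)$ be a unitary representation on a finite-dimensional complex inner product space $V$. Every closed path $p$ defines a conjugacy class $[\gamma_p]$ in $\Gamma$. The group law of $\Gamma$ is the one in which $[p][q]$ is the class of "first $q$, then $p$", so that parallel transport along closed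 paths is a representation. Put $$L(\tau,u)=\prod_{[p]}\det\bigl(1-w(p)u^{l(p)}\tau(\gamma_p)\bigr)^{-1},$$ the product over all prime cycles $[p]$. Let $(V_x)_{x\in VX}$, with unitary transports $T_{x,y}:V_x\to V_y$, $T_{y,x}=T_{x,y}^{-1}$, for adjacent $x,y$, be a hermitian local system given by $\tau$; that is, under some unitary identification $V_{x_0}\cong V$, the parallel transport along each closed path $p$ at $x_0$ is $\tau([p])$. For $e\in\mathrm{OE}$ let $V_e=V_{o(e)}$, identified with $V_{t(e)}$ and with $V_{e^{-1}}$ by $T_{o(e),t(e)}$; write $v_{e^{-1}}\in V_{e^{-1}}$ for the vector identified with $v_e\in V_e$. On the $\ell^2$-sums $C_0=\bigoplus_x V_x$ and $C_1=\bigoplus_e V_e$ define bounded operators $$\sigma:C_0\to C_1,\quad \sigma(v_x)=\sum_{o(e)=x}w(e)\,v_x;\qquad \mathsf t:C_1\to C_0,\quad \mathsf t(v_e)=T_{o(e),t(e)}v_e;\qquad J:C_1\to C_1,\quad J(v_e)=w(e^{-1})\,v_{e^{-1}} ,$$ where in $\sigma(v_x)$ the vector $v_x$ is placed in $V_e=V_x$.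 For a trace class operator $K$ let $\det(1-K)=\sum_{k\ge0}(-1)^k\operatorname{tr}\bigwedge^kK$ be the Fredholm determinant. **Theorem.** There is $r>0$ such that for $|u|<r$ all Euler factors are finite and the product $L(\tau,u)$ converges, to a non-zero limit; $L(\tau,u)$ extends to a meromorphic function on $\mathbb C$ whose reciprocal $L(\tau,u)^{-1}$ is entire. The product $\prod_{e\in EX}(1-u^2W(e))^{\dim V}$ converges for every $u\in\mathbb C$ to an entire function. For every hermitian local system given by $\tau$, and for every $u\in\mathbb C$ with $u^2W(e)\ne1$ for all $e\in EX$, the operator $1+uJ$ is invertible, $u\,\mathsf t(1+uJ)^{-1}\sigma$ is of trace class, and $$L(\tau,u)^{-1}=\det\bigl(1-u\,\mathsf t(1+uJ)^{-1}\sigma\bigr)\prod_{e\in EX}\bigl(1-u^2W(e)\bigr)^{\dim V}.$$ -/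

import Mathlib

open scoped InnerProductSpace

universe u v w

/-! ### Weighted graphs -/

/-- A connected simple graph of bounded valency, with a positive weight on each oriented edge
(`graph.Dart` is the type of oriented edges), of finite total weight.  The weights of the two
orientations of an edge may differ, and the graph may be infinite. -/
structure WeightedGraph (V : Type u) where
  graph : SimpleGraph V
  connected : graph.Connected
  bounded_valency : ∃ M : ℕ, ∀ x, (graph.neighborSet x).encard ≤ M
  weight : graph.Dart → ℝ
  weight_pos : ∀ e, 0 < weight e
  summable_weight : Summable weight

/-! ### Homotopy of paths and the fundamental group of a graph -/

/-- Homotopy of paths with fixed end points in a graph: the congruence generated by the removal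
of a backtracking `x → y → x`. -/
inductive SimpleGraph.WalkHomotopic {V : Type u} (G : SimpleGraph V) :
    ∀ {x y : V}, G.Walk x y → G.Walk x y → Prop
  | refl {x y : V} (p : G.Walk x y) : WalkHomotopic G p p
  | symm {x y : V} {p q : G.Walk x y} : WalkHomotopic G p q → WalkHomotopic G q p
  | trans {x y : V} {p q r : G.Walk x y} :
      WalkHomotopic G p q → WalkHomotopic G q r → WalkHomotopic G p r
  | cons {x y z : V} (h : G.Adj x y) {p q : G.Walk y z} :
      WalkHomotopic G p q → WalkHomotopic G (.cons h p) (.cons h q)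
  | backtrack {x y z : V} (h : G.Adj x y) (p : G.Walk x z) :
      WalkHomotopic G (.cons h (.cons h.symm p)) p

namespace SimpleGraph.WalkHomotopic

variable {V : Type u} {G : SimpleGraph V} {x y z : V}

theorem append_right {p p' : G.Walk x y} (h : WalkHomotopic G p p') (q : G.Walk y z) :
    WalkHomotopic G (p.append q) (p'.append q) := by
  induction h with
  | refl p => exact .refl _
  | symm _ ih => exact .symm (ih q)
  | trans _ _ ih₁ ih₂ => exact .trans (ih₁ q) (ih₂ q)
  | cons h _ ih => exact .cons h (ih q)
  | backtrack h p => exact .backtrack h _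

theorem append_left (q : G.Walk x y) {p p' : G.Walk y z} (h : WalkHomotopic G p p') :
    WalkHomotopic G (q.append p) (q.append p') := by
  induction q with
  | nil => exact h
  | cons a _ ih => exact .cons a (ih h)

theorem append {p p' : G.Walk x y} {q q' : G.Walk y z} (h : WalkHomotopic G p p')
    (h' : WalkHomotopic G q q') : WalkHomotopic G (p.append q) (p'.append q') :=
  (h.append_right q).trans (append_left p' h')

theorem reverse {p p' : G.Walk x y} (h : WalkHomotopic G p p') :
    WalkHomotopic G p.reverse p'.reverse := by
  induction h with
  | refl p => exact .refl _
  | symm _ ih => exact .symm ih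
  | trans _ _ ih₁ ih₂ => exact .trans ih₁ ih₂
  | cons h _ ih =>
    simp only [Walk.reverse_cons]
    exact ih.append_right _
  | backtrack h p =>
    simp only [Walk.reverse_cons, ← Walk.append_assoc]
    have := append_left p.reverse (backtrack h (Walk.nil : G.Walk _ _))
    simpa using this

theorem append_reverse (p : G.Walk x y) : WalkHomotopic G (p.append p.reverse) .nil := by
  induction p with
  | nil => exact .refl _
  | cons h p ih =>
    simp only [Walk.reverse_cons, Walk.cons_append, Walk.append_assoc]
    exact (cons h (ih.append_right _)).trans (backtrack h .nil)

theorem reverse_append (p : G.Walk x y) : WalkHomotopic G (p.reverse.append p) .nil := by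
  simpa using append_reverse p.reverse

end SimpleGraph.WalkHomotopic

/-- Homotopy as an equivalence relation on the closed paths at `x₀`. -/
def SimpleGraph.loopSetoid {V : Type u} (G : SimpleGraph V) (x₀ : V) : Setoid (G.Walk x₀ x₀) where
  r p q := G.WalkHomotopic p q
  iseqv := ⟨.refl, .symm, .trans⟩

/-- The fundamental group `π₁(G, x₀)`: homotopy classes of closed paths at `x₀`. -/
def SimpleGraph.FundGroup {V : Type u} (G : SimpleGraph V) (x₀ : V) : Type u :=
  Quotient (G.loopSetoid x₀)

namespace SimpleGraph.FundGroup

variable {V : Type u} {G : SimpleGraph V} {x₀ : V}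

/-- The homotopy class of a closed path at `x₀`. -/
def mk (p : G.Walk x₀ x₀) : G.FundGroup x₀ := Quotient.mk (G.loopSetoid x₀) p

theorem mk_eq {p q : G.Walk x₀ x₀} (h : G.WalkHomotopic p q) : mk p = mk q := Quotient.sound h

/-- The product `[p] * [q]` is the class of "first `q`, then `p`", the order in which parallel
transports compose (and the order of multiplication in `CategoryTheory.End`). -/
instance : Group (G.FundGroup x₀) where
  mul := Quotient.map₂ (fun p q => q.append p) fun _ _ h _ _ h' => .append h' h
  one := mk .nil
  inv := Quotient.map Walk.reverse fun _ _ h => .reverse h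
  mul_assoc := by
    rintro ⟨p⟩ ⟨q⟩ ⟨r⟩
    exact congrArg mk (Walk.append_assoc r q p)
  one_mul := by
    rintro ⟨p⟩
    exact congrArg mk (Walk.append_nil p)
  mul_one := by
    rintro ⟨p⟩
    exact congrArg mk (Walk.nil_append p)
  inv_mul_cancel := by
    rintro ⟨p⟩
    exact mk_eq (.append_reverse p)

theorem mk_mul_mk (p q : G.Walk x₀ x₀) : mk p * mk q = mk (q.append p) := rfl

theorem mk_inv (p : G.Walk x₀ x₀) : (mk p)⁻¹ = mk p.reverse := rfl

theorem mk_nil : mk (.nil : G.Walk x₀ x₀) = 1 := rfl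

end SimpleGraph.FundGroup

/-! ### Closed paths, cycles, prime cycles -/

/-- A closed path `(x₀, x₁, …, xₙ = x₀)`, with arbitrary starting vertex. -/
abbrev SimpleGraph.ClosedPath {V : Type u} (G : SimpleGraph V) : Type u := Σ x : V, G.Walk x x

namespace SimpleGraph.ClosedPath

variable {V : Type u} {G : SimpleGraph V}

/-- The shifted path: `(x₀, x₁, …, xₙ = x₀)` becomes `(x₁, …, xₙ = x₀, x₁)`. -/
def shift : G.ClosedPath → G.ClosedPath
  | ⟨x, .nil⟩ => ⟨x, .nil⟩
  | ⟨_, .cons h q⟩ => ⟨_, q.concat h⟩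

/-- No backtracking: `x_{j-1} ≠ x_{j+1}` for `1 ≤ j ≤ n - 1`. -/
def IsReduced (p : G.ClosedPath) : Prop :=
  ∀ i, i + 2 ≤ p.2.length → p.2.getVert i ≠ p.2.getVert (i + 2)

/-- The path that runs `k` times through a path from `x` to `x`. -/
def walkPower {x : V} (p : G.Walk x x) : ℕ → G.Walk x x
  | 0 => .nil
  | k + 1 => p.append (walkPower p k)

/-- The `k`-th power of a closed path. -/
def power (p : G.ClosedPath) (k : ℕ) : G.ClosedPath := ⟨p.1, walkPower p.2 k⟩

/-- The equivalence relation on closed paths generated by `p ∼ shift p`. -/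
def shiftSetoid (G : SimpleGraph V) : Setoid G.ClosedPath :=
  Relation.EqvGen.setoid fun p q => q = shift p

end SimpleGraph.ClosedPath

/-- The prime cycles of `G`: shift-equivalence classes of closed paths of positive length that
consist of reduced paths only, and no member of which is a proper power of a closed path. -/
def SimpleGraph.PrimeCycle {V : Type u} (G : SimpleGraph V) : Type u :=
  {c : Quotient (ClosedPath.shiftSetoid G) //
    ∀ p : G.ClosedPath, Quotient.mk (ClosedPath.shiftSetoid G) p = c →
      0 < p.2.length ∧ p.IsReduced ∧ ∀ (q : G.ClosedPath) (k : ℕ), p = q.power k → k = 1}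

/-- A closed path representing a prime cycle. -/
noncomputable def SimpleGraph.PrimeCycle.path {V : Type u} {G : SimpleGraph V}
    (c : G.PrimeCycle) : G.ClosedPath :=
  Quotient.out c.1

/-! ### The Euler factors -/

namespace WeightedGraph

variable {V : Type u} (X : WeightedGraph V)

/-- The weight of a path: the product of the weights of its oriented edges. -/
def walkWeight {x y : V} (p : X.graph.Walk x y) : ℝ := (p.darts.map X.weight).prod

/-- An element `γ_p` of the conjugacy class in `π₁(X, x₀)` defined by a closed path `p`: go from
`x₀` to the starting vertex of `p` along some path, then along `p`, then back by the same path.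
Another choice of the connecting path, or a shift of `p`, gives a conjugate element. -/
noncomputable def loopClass (x₀ : V) (p : X.graph.ClosedPath) : X.graph.FundGroup x₀ :=
  let q : X.graph.Walk x₀ p.1 := Classical.choice (X.connected.preconnected x₀ p.1)
  .mk (q.append (p.2.append q.reverse))

variable {E : Type v} [NormedAddCommGroup E] [InnerProductSpace ℂ E] {x₀ : V}

/-- `det (1 - w(p) u^{l(p)} τ(γ_p))`, for a unitary representation `τ` of `π₁(X, x₀)`. -/
noncomputable def eulerDet (τ : X.graph.FundGroup x₀ →* (E ≃ₗᵢ[ℂ] E)) (s : ℂ)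
    (p : X.graph.ClosedPath) : ℂ :=
  LinearMap.det ((1 : E →ₗ[ℂ] E) - ((X.walkWeight p.2 : ℂ) * s ^ p.2.length) •
    ((τ (X.loopClass x₀ p)).toLinearEquiv : E →ₗ[ℂ] E))

/-- `W(e) = w(e₁) w(e₂)`, where `e₁`, `e₂` are the two orientations of the edge `e`. -/
noncomputable def edgeWeight (e : X.graph.edgeSet) : ℝ :=
  ∏ᶠ (d : X.graph.Dart) (_ : d.edge = e), X.weight d

theorem edgeWeight_dart (d : X.graph.Dart) :
    X.edgeWeight ⟨d.edge, d.edge_mem⟩ = X.weight d * X.weight d.symm := by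
  classical
  unfold edgeWeight
  have : ∀ d' : X.graph.Dart, d'.edge = d.edge ↔ d' ∈ ({d, d.symm} : Finset X.graph.Dart) := by
    intro d'
    rw [SimpleGraph.dart_edge_eq_iff]
    simp
  simp only [this]
  rw [finprod_mem_finset_eq_prod, Finset.prod_pair d.symm_ne.symm]

end WeightedGraph

/-! ### Hermitian local systems -/

/-- A hermitian local system on a graph: a finite-dimensional hermitian space at each vertex and a
unitary parallel transport along each oriented edge, inverse to that along the reversed edge. -/
structure HermitianLocalSystem {V : Type u} (G : SimpleGraph V) where
  fiber : V → Type v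
  [normed : ∀ x, NormedAddCommGroup (fiber x)]
  [inner : ∀ x, InnerProductSpace ℂ (fiber x)]
  [finite : ∀ x, FiniteDimensional ℂ (fiber x)]
  transport : ∀ {x y : V}, G.Adj x y → (fiber x ≃ₗᵢ[ℂ] fiber y)
  transport_symm : ∀ {x y : V} (h : G.Adj x y), transport h.symm = (transport h).symm

namespace HermitianLocalSystem

attribute [instance] normed inner finite

variable {V : Type u} {G : SimpleGraph V} (L : HermitianLocalSystem.{u, v} G)

instance (x : V) : CompleteSpace (L.fiber x) := FiniteDimensional.complete ℂ _

/-- The parallel transport along a path. -/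
def transportAlong : ∀ {x y : V}, G.Walk x y → (L.fiber x ≃ₗᵢ[ℂ] L.fiber y)
  | _, _, .nil => .refl ℂ _
  | _, _, .cons h p => (L.transport h).trans (transportAlong p)

variable {E : Type v} [NormedAddCommGroup E] [InnerProductSpace ℂ E] {x₀ : V}

/-- `L` is the local system given by the unitary representation `τ` of `π₁(G, x₀)`: up to a
unitary identification of the fiber at `x₀` with the space of `τ`, parallel transport along a
closed path `p` at `x₀` is `τ [p]`. -/
def IsGivenBy (τ : G.FundGroup x₀ →* (E ≃ₗᵢ[ℂ] E)) : Prop :=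
  ∃ φ : E ≃ₗᵢ[ℂ] L.fiber x₀, ∀ (p : G.Walk x₀ x₀) (a : E),
    L.transportAlong p (φ a) = φ (τ (.mk p) a)

/-- Every finite-dimensional unitary representation gives a hermitian local system. -/
theorem exists_isGivenBy [FiniteDimensional ℂ E] (hG : G.Connected)
    (τ : G.FundGroup x₀ →* (E ≃ₗᵢ[ℂ] E)) :
    ∃ L : HermitianLocalSystem.{u, v} G, L.IsGivenBy τ := by
  have q : ∀ x, G.Walk x₀ x := fun x => Classical.choice (hG.preconnected x₀ x)
  let c : ∀ {x y : V}, G.Walk x y → G.FundGroup x₀ := fun {x y} p =>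
    .mk ((q x).append (p.append (q y).reverse))
  have hc : ∀ {x y z : V} (p : G.Walk x y) (r : G.Walk y z), c (p.append r) = c r * c p := by
    intro x y z p r
    simp only [c, SimpleGraph.FundGroup.mk_mul_mk]
    refine SimpleGraph.FundGroup.mk_eq ?_
    simp only [SimpleGraph.Walk.append_assoc]
    simp only [← SimpleGraph.Walk.append_assoc (q x)]
    refine .append_left _ ?_
    have := (SimpleGraph.WalkHomotopic.reverse_append (q y)).symm.append_right
      (r.append (q z).reverse)
    simpa only [SimpleGraph.Walk.append_assoc, SimpleGraph.Walk.nil_append] using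
      SimpleGraph.WalkHomotopic.append_left p this
  have hr : ∀ {x y : V} (p : G.Walk x y), c p.reverse = (c p)⁻¹ := by
    intro x y p
    simp only [c, SimpleGraph.FundGroup.mk_inv, SimpleGraph.Walk.reverse_append,
      SimpleGraph.Walk.reverse_reverse, SimpleGraph.Walk.append_assoc]
  have hn : ∀ x, c (.nil : G.Walk x x) = 1 := fun x => by
    rw [← SimpleGraph.FundGroup.mk_nil]
    exact SimpleGraph.FundGroup.mk_eq (.append_reverse (q x))
  let L : HermitianLocalSystem.{u, v} G :=
    { fiber := fun _ => E
      transport := fun h => τ (c h.toWalk)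
      transport_symm := fun {x y} h => by
        have h1 : c h.symm.toWalk = (c h.toWalk)⁻¹ := hr h.toWalk
        rw [h1, map_inv]
        rfl }
  have hL : ∀ {x y : V} (p : G.Walk x y), L.transportAlong p = τ (c p) := by
    intro x y p
    induction p with
    | nil => rw [hn, map_one]; rfl
    | cons h p ih =>
      have : SimpleGraph.Walk.cons h p = h.toWalk.append p := rfl
      rw [this, hc, map_mul, ← ih]
      rfl
  refine ⟨L, τ (.mk (q x₀))⁻¹, fun p a => ?_⟩
  rw [hL]
  change (τ (c p) * τ (.mk (q x₀))⁻¹) a = (τ (.mk (q x₀))⁻¹ * τ (.mk p)) a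
  rw [← map_mul, ← map_mul]
  congr 2
  rw [mul_inv_eq_iff_eq_mul]
  simp only [SimpleGraph.FundGroup.mk_inv, SimpleGraph.FundGroup.mk_mul_mk, c]

end HermitianLocalSystem

/-! ### Trace class operators and Fredholm determinants -/

section Fredholm

variable {H : Type u} [NormedAddCommGroup H] [InnerProductSpace ℂ H]

/-- Trace class (equivalently, nuclear) operators on a Hilbert space: norm-absolutely convergent
sums of operators of rank at most one. -/
def IsTraceClass (K : H →L[ℂ] H) : Prop :=
  ∃ f g : ℕ → H, Summable (fun n => ‖f n‖ * ‖g n‖) ∧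
    ∀ a : H, HasSum (fun n => ⟪g n, a⟫_ℂ • f n) (K a)

open Classical in
/-- `tr (⋀ᵏ K) = t`, the trace of `⋀ᵏ K` on the Hilbert space `⋀ᵏ H`.  If `b` is an orthonormal
basis of `H`, the vectors `b_S = b_{i₁} ∧ ⋯ ∧ b_{iₖ}`, for the subsets `S = {i₁ < ⋯ < iₖ}` of the
index set, are an orthonormal basis of `⋀ᵏ H`, and `⟪b_S, (⋀ᵏ K) b_S⟫ = det (⟪b i, K b j⟫)_{i, j ∈ S}`.
The sum over `S` has to converge absolutely to `t` in every orthonormal basis. -/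
def HasExteriorTrace (K : H →L[ℂ] H) (k : ℕ) (t : ℂ) : Prop :=
  ∀ (ι : Type u) (b : HilbertBasis ι ℂ H),
    HasSum (fun S : {S : Finset ι // S.card = k} =>
      (Matrix.of fun i j : S.1 => ⟪b i, K (b j)⟫_ℂ).det) t

/-- The Fredholm determinant `det (1 - K) = ∑ₖ (-1)ᵏ tr (⋀ᵏ K)` exists and has the value `d`. -/
def HasFredholmDet (K : H →L[ℂ] H) (d : ℂ) : Prop :=
  ∃ t : ℕ → ℂ, (∀ k, HasExteriorTrace K k (t k)) ∧ HasSum (fun k => (-1) ^ k * t k) d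

end Fredholm

/-! ### The operators `σ`, `τ` and `J` -/

section Operators

/-- The bounded operator between `ℓ²`-sums that is given by a formula `T` and a bound for it. -/
noncomputable def l2Operator {ι : Type u} {κ : Type w} {A : ι → Type v} {B : κ → Type v}
    [∀ i, NormedAddCommGroup (A i)] [∀ i, InnerProductSpace ℂ (A i)]
    [∀ j, NormedAddCommGroup (B j)] [∀ j, InnerProductSpace ℂ (B j)]
    (T : (∀ i, A i) →ₗ[ℂ] ∀ j, B j)
    (hT : ∃ C : ℝ, 0 ≤ C ∧ ∀ (s : lp A 2) (t : Finset κ),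
      ∑ j ∈ t, ‖T s j‖ ^ 2 ≤ C ^ 2 * ‖s‖ ^ 2) :
    lp A 2 →L[ℂ] lp B 2 :=
  LinearMap.mkContinuousOfExistsBound
    { toFun := fun s => ⟨T s, by
        obtain ⟨C, -, hC⟩ := hT
        refine memℓp_gen' (C := C ^ 2 * ‖s‖ ^ 2) fun t => ?_
        simpa using hC s t⟩
      map_add' := fun s s' => by
        ext j
        exact congrFun (map_add T (s : ∀ i, A i) s') j
      map_smul' := fun a s => by
        ext j
        exact congrFun (map_smul T a (s : ∀ i, A i)) j }
    (by
      obtain ⟨C, hC0, hC⟩ := hT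
      refine ⟨C, fun s => lp.norm_le_of_forall_sum_le (by simp) (by positivity) fun t => ?_⟩
      simpa [mul_pow] using hC s t)

namespace WeightedGraph

variable {V : Type u} (X : WeightedGraph V)

noncomputable instance : X.graph.LocallyFinite := fun x =>
  Set.Finite.fintype (by
    obtain ⟨M, hM⟩ := X.bounded_valency
    exact Set.finite_of_encard_le_coe (hM x))

variable (L : HermitianLocalSystem.{u, v} X.graph)

/-- `C₀`, the `ℓ²`-sum of the fibers over the vertices. -/
abbrev C₀ : Type (max u v) := lp L.fiber 2

/-- `C₁`, the `ℓ²`-sum over the oriented edges of `V_e`, which is realised as the fiber at the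
origin `e.fst` of `e`; then `V_e ≅ V_{o(e)}` is the identity, and `V_e ≅ V_{t(e)}` and
`V_e ≅ V_{e⁻¹}` are the parallel transport along `e`. -/
abbrev C₁ : Type (max u v) := lp (fun e : X.graph.Dart => L.fiber e.fst) 2

theorem sum_weight_sq_le {a : X.graph.Dart → ℝ} {c : ℝ} (h0 : ∀ e, 0 ≤ a e) (h : ∀ e, a e ≤ c)
    (t : Finset X.graph.Dart) :
    ∑ e ∈ t, (X.weight e * a e) ^ 2 ≤ (∑' e, X.weight e) ^ 2 * c ^ 2 := by
  have h1 : ∀ t : Finset X.graph.Dart, ∑ e ∈ t, X.weight e ≤ ∑' e, X.weight e := fun t =>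
    X.summable_weight.sum_le_tsum t fun e _ => (X.weight_pos e).le
  have hW : ∀ e, X.weight e ≤ ∑' e, X.weight e := fun e => by simpa using h1 {e}
  have h2 : 0 ≤ ∑' e, X.weight e := tsum_nonneg fun e => (X.weight_pos e).le
  calc ∑ e ∈ t, (X.weight e * a e) ^ 2
      ≤ ∑ e ∈ t, X.weight e * ((∑' e, X.weight e) * c ^ 2) := by
        refine Finset.sum_le_sum fun e _ => ?_
        have := X.weight_pos e
        have := pow_le_pow_left₀ (h0 e) (h e) 2
        calc (X.weight e * a e) ^ 2 = X.weight e * (X.weight e * a e ^ 2) := by ring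
          _ ≤ _ := by gcongr; exact hW e
    _ = (∑ e ∈ t, X.weight e) * ((∑' e, X.weight e) * c ^ 2) := by rw [Finset.sum_mul]
    _ ≤ (∑' e, X.weight e) * ((∑' e, X.weight e) * c ^ 2) := by gcongr; exact h1 t
    _ = _ := by ring

/-- `σ(v_x) = ∑_{o(e) = x} w(e) õ_e⁻¹(v_x)`; in coordinates, `(σ s)(e) = w(e) s(o(e))`. -/
noncomputable def opSigma : C₀ X L →L[ℂ] C₁ X L :=
  l2Operator
    { toFun := fun s e => (X.weight e : ℂ) • s e.fst
      map_add' := fun s s' => by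
        ext e
        simp only [Pi.add_apply, smul_add]
      map_smul' := fun a s => by
        ext e
        simp only [Pi.smul_apply, RingHom.id_apply]
        exact smul_comm _ _ _ }
    ⟨∑' e, X.weight e, tsum_nonneg fun e => (X.weight_pos e).le, fun s t => by
      have := X.sum_weight_sq_le (a := fun e => ‖s e.fst‖) (c := ‖s‖) (fun e => norm_nonneg _)
        (fun e => lp.norm_apply_le_norm two_ne_zero s e.fst) t
      simpa [norm_smul, abs_of_pos (X.weight_pos _)] using this⟩

/-- The weighted flip `J(v_e) = w(e⁻¹) v_{e⁻¹}`; in coordinates, `(J f)(e) = w(e) v`, where `v` is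
the transport of `f(e⁻¹)` along `e⁻¹`. -/
noncomputable def opJ : C₁ X L →L[ℂ] C₁ X L :=
  l2Operator
    { toFun := fun f e => (X.weight e : ℂ) • L.transport e.symm.adj (f e.symm)
      map_add' := fun s s' => by
        ext e
        simp only [Pi.add_apply, map_add, smul_add]
        rfl
      map_smul' := fun a s => by
        ext e
        simp only [Pi.smul_apply, map_smul, RingHom.id_apply]
        exact smul_comm _ _ _ }
    ⟨∑' e, X.weight e, tsum_nonneg fun e => (X.weight_pos e).le, fun s t => by
      have := X.sum_weight_sq_le (a := fun e => ‖s e.symm‖) (c := ‖s‖) (fun e => norm_nonneg _)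
        (fun e => lp.norm_apply_le_norm two_ne_zero s e.symm) t
      change ∑ e ∈ t, ‖(X.weight e : ℂ) • L.transport e.symm.adj (s e.symm)‖ ^ 2 ≤ _
      simpa only [norm_smul, Complex.norm_real, Real.norm_of_nonneg (X.weight_pos _).le,
        LinearIsometryEquiv.norm_map] using this⟩

/-- `τ(v_e) = τ̃_e(v_e) ∈ V_{t(e)}`; in coordinates, `(τ f)(y)` is the sum, over the oriented edges
`e = (x, y)` with target `y`, of the transport of `f(e)` along `e`. -/
noncomputable def opTau : C₁ X L →L[ℂ] C₀ X L :=
  l2Operator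
    { toFun := fun f y => ∑ x : X.graph.neighborSet y,
        L.transport (SimpleGraph.Adj.symm x.2) (f ⟨(x.1, y), SimpleGraph.Adj.symm x.2⟩)
      map_add' := fun s s' => by ext e; simp [Finset.sum_add_distrib]
      map_smul' := fun a s => by ext e; simp [Finset.smul_sum] }
    (by
      classical
      obtain ⟨M, hM⟩ := X.bounded_valency
      refine ⟨Real.sqrt M, Real.sqrt_nonneg _, fun f t => ?_⟩
      rw [Real.sq_sqrt (Nat.cast_nonneg M)]
      have hcard : ∀ y, (Fintype.card (X.graph.neighborSet y) : ℝ) ≤ M := fun y => by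
        have := hM y
        rw [Set.encard_eq_coe_toFinset_card, Set.toFinset_card] at this
        exact_mod_cast this
      let g : (Σ y : V, X.graph.neighborSet y) → X.graph.Dart :=
        fun a => ⟨(a.2.1, a.1), SimpleGraph.Adj.symm a.2.2⟩
      have hg : Function.Injective g := by
        rintro ⟨y, x, hx⟩ ⟨y', x', hx'⟩ h
        simp only [g, SimpleGraph.Dart.mk.injEq, Prod.mk.injEq] at h
        obtain ⟨rfl, rfl⟩ := h
        rfl
      calc _ ≤ ∑ y ∈ t, (M : ℝ) * ∑ x : X.graph.neighborSet y, ‖f (g ⟨y, x⟩)‖ ^ 2 := by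
            refine Finset.sum_le_sum fun y _ => ?_
            have h1 : ‖∑ x : X.graph.neighborSet y, L.transport (SimpleGraph.Adj.symm x.2)
                (f ⟨(x.1, y), SimpleGraph.Adj.symm x.2⟩)‖ ≤
                ∑ x : X.graph.neighborSet y, ‖f (g ⟨y, x⟩)‖ :=
              (norm_sum_le _ _).trans (le_of_eq (by simp [g]))
            calc _ ≤ (∑ x : X.graph.neighborSet y, ‖f (g ⟨y, x⟩)‖) ^ 2 :=
                  pow_le_pow_left₀ (norm_nonneg _) h1 2
              _ ≤ (Fintype.card (X.graph.neighborSet y) : ℝ) *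
                    ∑ x : X.graph.neighborSet y, ‖f (g ⟨y, x⟩)‖ ^ 2 := by
                  simpa using sq_sum_le_card_mul_sum_sq (s := Finset.univ)
                    (f := fun x : X.graph.neighborSet y => ‖f (g ⟨y, x⟩)‖)
              _ ≤ _ := by exact mul_le_mul_of_nonneg_right (hcard y) (by positivity)
        _ = M * ∑ e ∈ (t.sigma fun _ => Finset.univ).image g, ‖f e‖ ^ 2 := by
            rw [← Finset.mul_sum, Finset.sum_image (fun a _ b _ h => hg h), Finset.sum_sigma]
        _ ≤ M * ‖f‖ ^ 2 := by
            gcongr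
            simpa using lp.sum_rpow_le_norm_rpow (p := 2) (by simp) f
              ((t.sigma fun _ => Finset.univ).image g))

/-- `u τ (1 + uJ)⁻¹ σ` on `C₀`; `Ring.inverse` is the inverse where `1 + uJ` is invertible. -/
noncomputable def opK (s : ℂ) : C₀ X L →L[ℂ] C₀ X L :=
  s • (opTau X L ∘L Ring.inverse (1 + s • opJ X L) ∘L opSigma X L)

end WeightedGraph

end Operators

/-! ### Hadamard's inequality -/

section Hadamard

variable {n : Type*} [Fintype n] [DecidableEq n]

/-! Trivialise the local system along base paths and let `B(s)` be `edgeMatrix`: its block at `(e',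
e)` is `s w(e')` times the transport along `e` when `e'` can follow `e` without backtracking, and
zero otherwise. The entire function `F(s) = det (1 - B(s))` serves as the reciprocal of the zeta
function, and the theorem follows by computing it in two ways.

For small `s`, `-log F(s) = ∑ tr Bⁿ / n` is a sum over closed sequences of oriented edges
(`fredholmDet_comp_eq_exp`). Only non-backtracking sequences contribute. Each of them runs `k + 1`
times through exactly one prime cycle, of length `l` say, from exactly one of its `l` starting
edges. Summing over the starting edges cancels `l` in the denominator `l (k + 1)` and leaves the
logarithm series of one Euler factor (`exists_hasSum_log`).

For general `s`, the non-backtracking operator is `σ𝗍 - J`, so with `R = (1 + sJ)⁻¹` one has `1 -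
s(σ𝗍 - J) = (1 - s σ𝗍R)(1 + sJ)`. Multiplicativity (`fredholmDet_mul`) splits `F` into two
determinants (`fredholmDet_edgeMatrix_eq_mul`). That of `1 + sJ` is the product over edges, because
`J` only exchanges the two orientations (`hasProd_fredholmDet_flipMatrix`). The other equals `det (1
- s 𝗍Rσ)` because `tr ⋀ᵏ(AB) = tr ⋀ᵏ(BA)` (`exists_hasSum_principalMinor`); writing `w = √w √w`
makes both factors Hilbert–Schmidt, and the resulting value does not depend on the orthonormal
basis.

The analysis rests on one estimate. In every matrix used, the entries of the row of `e` are bounded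
by a constant times `w(e)`. Hadamard's inequality then dominates the principal minors by a summable
family depending only on the row bounds, so identities for finite matrices pass to the limit over
truncations. -/

theorem Real.prod_le_sum_div_card_pow {n : Type*} [Fintype n] (z : n → ℝ) (hz : ∀ i, 0 ≤ z i) :
    ∏ i, z i ≤ ((∑ i, z i) / Fintype.card n) ^ Fintype.card n := by
  rcases isEmpty_or_nonempty n with h | h
  · simp
  have hc : (0 : ℝ) < Fintype.card n := by exact_mod_cast Fintype.card_pos
  have := Real.geom_mean_le_arith_mean Finset.univ (fun _ : n => (1 : ℝ)) z (by simp)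
    (by simpa using Fintype.card_pos) (fun i _ => hz i)
  simp only [Real.rpow_one, Finset.sum_const, Finset.card_univ, nsmul_eq_mul, mul_one,
    one_mul] at this
  have h2 := pow_le_pow_left₀ (Real.rpow_nonneg (Finset.prod_nonneg fun i _ => hz i) _) this
    (Fintype.card n)
  rwa [← Real.rpow_natCast, ← Real.rpow_mul (Finset.prod_nonneg fun i _ => hz i),
    inv_mul_cancel₀ hc.ne', Real.rpow_one] at h2

-- `|det A|²` is the product of the eigenvalues of `A Aᴴ`, whose sum is the trace `∑ |A i j|² ≤ n²`;
-- the inequality of arithmetic and geometric means concludes.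
open scoped ComplexOrder in
theorem Matrix.norm_det_sq_le (A : Matrix n n ℂ) (hA : ∀ i j, ‖A i j‖ ≤ 1) :
    ‖A.det‖ ^ 2 ≤ (Fintype.card n : ℝ) ^ Fintype.card n := by
  have hG := Matrix.posSemidef_self_mul_conjTranspose A
  have h1 : ‖A.det‖ ^ 2 = ∏ i, hG.1.eigenvalues i := by
    have := hG.1.det_eq_prod_eigenvalues
    rw [Matrix.det_mul, Matrix.det_conjTranspose] at this
    have h2 : A.det * star A.det = ((‖A.det‖ ^ 2 : ℝ) : ℂ) := by
      push_cast
      exact Complex.mul_conj' _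
    rw [h2] at this
    refine Complex.ofReal_injective (this.trans ?_)
    push_cast
    rfl
  have h2 : ∑ i, hG.1.eigenvalues i = ∑ i, ∑ j, ‖A i j‖ ^ 2 := by
    have := hG.1.trace_eq_sum_eigenvalues
    have h3 : (A * A.conjTranspose).trace = ((∑ i, ∑ j, ‖A i j‖ ^ 2 : ℝ) : ℂ) := by
      simp only [Matrix.trace, Matrix.diag, Matrix.mul_apply, Matrix.conjTranspose_apply]
      push_cast
      exact Finset.sum_congr rfl fun i _ => Finset.sum_congr rfl fun j _ => Complex.mul_conj' _
    rw [h3] at this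
    refine Complex.ofReal_injective (Eq.trans ?_ this.symm)
    push_cast
    rfl
  rw [h1]
  refine (Real.prod_le_sum_div_card_pow _ hG.eigenvalues_nonneg).trans ?_
  rw [h2]
  refine pow_le_pow_left₀ (by positivity) ?_ _
  rcases isEmpty_or_nonempty n with h | h
  · simp
  have hc : (0 : ℝ) < Fintype.card n := by exact_mod_cast Fintype.card_pos
  rw [div_le_iff₀ hc]
  calc ∑ i, ∑ j, ‖A i j‖ ^ 2 ≤ ∑ _i : n, ∑ _j : n, (1 : ℝ) :=
        Finset.sum_le_sum fun i _ => Finset.sum_le_sum fun j _ =>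
          pow_le_one₀ (norm_nonneg _) (hA i j)
    _ = _ := by simp

/-- Hadamard's inequality for a matrix whose rows are bounded in the supremum norm. -/
theorem Matrix.norm_det_le (M : Matrix n n ℂ) (a : n → ℝ) (hM : ∀ i j, ‖M i j‖ ≤ a i) :
    ‖M.det‖ ≤ √((Fintype.card n : ℝ) ^ Fintype.card n) * ∏ i, a i := by
  have ha : ∀ i, 0 ≤ a i := fun i => (norm_nonneg _).trans (hM i i)
  -- Normalised rows. If `a i = 0`, division gives `0`, which is harmless because that row of `M`
  -- vanishes.
  let A : Matrix n n ℂ := .of fun i j => M i j / a i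
  have hMA : M = .of fun i j => (a i : ℂ) * A i j := by
    ext i j
    rcases eq_or_ne (a i) 0 with h | h
    · have := hM i j
      rw [h] at this
      simp [norm_le_zero_iff.1 this, h]
    · simp only [A, Matrix.of_apply]
      rw [mul_div_cancel₀ _ (Complex.ofReal_ne_zero.2 h)]
  have hA : ∀ i j, ‖A i j‖ ≤ 1 := fun i j => by
    simp only [A, Matrix.of_apply, norm_div, Complex.norm_real, Real.norm_of_nonneg (ha i)]
    exact div_le_one_of_le₀ (hM i j) (ha i)
  have h1 : ‖A.det‖ ≤ √((Fintype.card n : ℝ) ^ Fintype.card n) :=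
    Real.le_sqrt_of_sq_le (A.norm_det_sq_le hA)
  rw [hMA, Matrix.det_mul_column, norm_mul, norm_prod, mul_comm]
  simp only [Complex.norm_real, Real.norm_of_nonneg (ha _)]
  gcongr
  exact Finset.prod_nonneg fun i _ => ha i

end Hadamard

/-! ### Summability of the Hadamard bounds -/

section Summability

variable {ι : Type*}

/-- Expanding `(∑ a i) ^ k` produces each squarefree monomial of degree `k` exactly `k!` times. The
induction splits the subsets according to whether they contain the new element. -/
theorem Finset.sum_powersetCard_prod_le [DecidableEq ι] {a : ι → ℝ} (ha : ∀ i, 0 ≤ a i) (s : Finset ι)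
    (k : ℕ) : ∑ t ∈ s.powersetCard k, ∏ i ∈ t, a i ≤ (∑ i ∈ s, a i) ^ k / k.factorial := by
  induction s using Finset.induction generalizing k with
  | empty =>
    cases k with
    | zero => simp
    | succ k => rw [Finset.powersetCard_eq_empty.2 (by simp)]; simp
  | insert x s hx ih =>
    cases k with
    | zero => simp
    | succ k =>
      have hs : 0 ≤ ∑ i ∈ s, a i := Finset.sum_nonneg fun i _ => ha i
      rw [Finset.powersetCard_succ_insert hx, Finset.sum_union, Finset.sum_image]
      · have h1 : ∑ t ∈ s.powersetCard k, ∏ i ∈ insert x t, a i =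
            a x * ∑ t ∈ s.powersetCard k, ∏ i ∈ t, a i := by
          rw [Finset.mul_sum]
          refine Finset.sum_congr rfl fun t ht => Finset.prod_insert fun h => hx ?_
          exact (Finset.mem_powersetCard.1 ht).1 h
        rw [h1, Finset.sum_insert hx]
        -- Two terms of the binomial expansion suffice; the remaining ones are nonnegative.
        have h2 : (∑ i ∈ s, a i) ^ (k + 1) + (k + 1) * a x * (∑ i ∈ s, a i) ^ k ≤
            (a x + ∑ i ∈ s, a i) ^ (k + 1) := by
          rw [add_pow]
          rw [Finset.sum_range_succ', Finset.sum_range_succ']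
          have : 0 ≤ ∑ i ∈ Finset.range k, a x ^ (i + 1 + 1) * (∑ i ∈ s, a i) ^ (k + 1 - (i + 1 + 1)) *
              (k + 1).choose (i + 1 + 1) :=
            Finset.sum_nonneg fun i _ => by have := ha x; positivity
          simp only [zero_add, pow_one, Nat.add_sub_cancel, Nat.choose_one_right, pow_zero,
            Nat.choose_zero_right, Nat.sub_zero] at this ⊢
          push_cast at this ⊢
          linarith
        have hk : (0 : ℝ) < k.factorial := by positivity
        calc _ ≤ (∑ i ∈ s, a i) ^ (k + 1) / (k + 1).factorial +
              a x * ((∑ i ∈ s, a i) ^ k / k.factorial) :=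
              add_le_add (ih _) (mul_le_mul_of_nonneg_left (ih _) (ha x))
          _ = ((∑ i ∈ s, a i) ^ (k + 1) + (k + 1) * a x * (∑ i ∈ s, a i) ^ k) /
              (k + 1).factorial := by
            rw [Nat.factorial_succ]
            push_cast
            field_simp
          _ ≤ _ := by gcongr
      · intro t ht t' ht' h
        have h1 := (Finset.mem_powersetCard.1 ht).1
        have h2 := (Finset.mem_powersetCard.1 ht').1
        rw [← Finset.erase_insert (fun h => hx (h1 h)), h,
          Finset.erase_insert (fun h => hx (h2 h))]
      · rw [Finset.disjoint_left]
        intro t ht ht'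
        obtain ⟨t', -, rfl⟩ := Finset.mem_image.1 ht'
        exact hx ((Finset.mem_powersetCard.1 ht).1 (Finset.mem_insert_self _ _))

/-- Since `kᵏ ≤ k! eᵏ`, the square of the left side is at most `(eA²)ᵏ / k!`. Trading the square
root for a geometric term leaves a bound by an exponential series plus a geometric series, both
summable in `k`. -/
theorem Real.sqrt_pow_self_mul_pow_div_factorial_le (A : ℝ) (k : ℕ) :
    √((k : ℝ) ^ k) * (A ^ k / k.factorial) ≤ (4 * Real.exp 1 * A ^ 2) ^ k / k.factorial + (1 / 4) ^ k := by
  have hk : (0 : ℝ) < k.factorial := by positivity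
  have h1 : (k : ℝ) ^ k ≤ k.factorial * Real.exp 1 ^ k := by
    have := Real.pow_div_factorial_le_exp (x := k) (by positivity) k
    rw [div_le_iff₀ hk] at this
    rw [← Real.exp_nat_mul, mul_one, mul_comm]
    exact this
  set x := √((k : ℝ) ^ k) * (A ^ k / k.factorial) with hx
  have hx2 : x ^ 2 ≤ (Real.exp 1 * A ^ 2) ^ k / k.factorial := by
    rw [hx, mul_pow, Real.sq_sqrt (by positivity)]
    calc (k : ℝ) ^ k * (A ^ k / k.factorial) ^ 2
        ≤ (k.factorial * Real.exp 1 ^ k) * (A ^ k / k.factorial) ^ 2 := by gcongr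
      _ = _ := by field_simp; ring
  -- With `y = 4ᵏ`, multiplying the difference of the two sides by `y` gives `(yx - 1/2)² + 3/4 >
  -- 0`.
  have h3 : x ≤ 4 ^ k * x ^ 2 + (1 / 4) ^ k := by
    have h4 : (4 : ℝ) ^ k * (1 / 4) ^ k = 1 := by rw [← mul_pow]; norm_num
    have h5 : (0 : ℝ) < 4 ^ k := by positivity
    have h6 : (0 : ℝ) < (1 / 4) ^ k := by positivity
    set y : ℝ := 4 ^ k
    set z : ℝ := (1 / 4) ^ k
    have h7 : y * (y * x ^ 2 + z - x) = (y * x - 1 / 2) ^ 2 + 3 / 4 := by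
      linear_combination h4
    by_contra h
    nlinarith [sq_nonneg (y * x - 1 / 2)]
  refine h3.trans ?_
  gcongr
  calc (4 : ℝ) ^ k * x ^ 2 ≤ 4 ^ k * ((Real.exp 1 * A ^ 2) ^ k / k.factorial) := by gcongr
    _ = _ := by rw [mul_assoc 4, mul_pow 4]; ring

/-- A finite family of subsets lies in the power set of its union. Sorted by cardinality, that power
set contributes at most `k^(k/2) Aᵏ / k!` in degree `k`, where `A = ∑ a i`. -/
theorem summable_sqrt_card_pow_mul_prod {a : ι → ℝ} (ha : ∀ i, 0 ≤ a i) (hs : Summable a) :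
    Summable fun S : Finset ι => √((S.card : ℝ) ^ S.card) * ∏ i ∈ S, a i := by
  classical
  set A := ∑' i, a i
  have hA : 0 ≤ A := tsum_nonneg ha
  have hsum : Summable fun k : ℕ => √((k : ℝ) ^ k) * (A ^ k / k.factorial) :=
    Summable.of_nonneg_of_le (fun k => by positivity)
      (Real.sqrt_pow_self_mul_pow_div_factorial_le A)
      ((Real.summable_pow_div_factorial _).add
        (summable_geometric_of_lt_one (by norm_num) (by norm_num)))
  have h0 : ∀ S : Finset ι, 0 ≤ √((S.card : ℝ) ^ S.card) * ∏ i ∈ S, a i := fun S =>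
    mul_nonneg (Real.sqrt_nonneg _) (Finset.prod_nonneg fun i _ => ha i)
  refine summable_of_sum_le h0 (c := ∑' k : ℕ, √((k : ℝ) ^ k) * (A ^ k / k.factorial)) fun T => ?_
  calc ∑ S ∈ T, √((S.card : ℝ) ^ S.card) * ∏ i ∈ S, a i
      ≤ ∑ S ∈ (T.biUnion id).powerset, √((S.card : ℝ) ^ S.card) * ∏ i ∈ S, a i :=
        Finset.sum_le_sum_of_subset_of_nonneg (fun s hs => Finset.mem_powerset.mpr
          (Finset.subset_biUnion_of_mem id hs)) (fun s _ _ => h0 s)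
    _ = ∑ k ∈ Finset.range ((T.biUnion id).card + 1), √((k : ℝ) ^ k) *
          ∑ S ∈ (T.biUnion id).powersetCard k, ∏ i ∈ S, a i := by
        rw [Finset.sum_powerset]
        refine Finset.sum_congr rfl fun k _ => ?_
        rw [Finset.mul_sum]
        refine Finset.sum_congr rfl fun S hS => ?_
        rw [(Finset.mem_powersetCard.1 hS).2]
    _ ≤ ∑ k ∈ Finset.range ((T.biUnion id).card + 1), √((k : ℝ) ^ k) * (A ^ k / k.factorial) := by
        refine Finset.sum_le_sum fun k _ => ?_
        refine mul_le_mul_of_nonneg_left ?_ (Real.sqrt_nonneg _)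
        refine (Finset.sum_powersetCard_prod_le ha _ k).trans ?_
        gcongr
        · exact Finset.sum_nonneg fun i _ => ha i
        · exact hs.sum_le_tsum _ fun i _ => ha i
    _ ≤ _ := hsum.sum_le_tsum _ fun k _ => by positivity

end Summability

/-! ### Fredholm determinants of infinite matrices -/

section FredholmDet

open Filter Topology

variable {ι : Type*}

open Classical in
/-- The principal minor of an infinite matrix on a finite set of indices. -/
noncomputable def Matrix.principalMinor (M : Matrix ι ι ℂ) (S : Finset ι) : ℂ :=
  (M.submatrix ((↑) : S → ι) ((↑) : S → ι)).det

/-- The Fredholm determinant of `1 - M`, the alternating sum of the principal minors of `M`. -/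
noncomputable def Matrix.fredholmDet (M : Matrix ι ι ℂ) : ℂ :=
  ∑' S : Finset ι, (-1) ^ S.card * M.principalMinor S

namespace Matrix

theorem norm_principalMinor_le {M : Matrix ι ι ℂ} {a : ι → ℝ} (hM : ∀ i j, ‖M i j‖ ≤ a i)
    (S : Finset ι) : ‖M.principalMinor S‖ ≤ √((S.card : ℝ) ^ S.card) * ∏ i ∈ S, a i := by
  classical
  have := (M.submatrix ((↑) : S → ι) ((↑) : S → ι)).norm_det_le (fun i => a i) (fun i j => hM i j)
  rw [Fintype.card_coe, Finset.prod_coe_sort S a] at this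
  unfold principalMinor
  convert this

theorem principalMinor_smul (z : ℂ) (M : Matrix ι ι ℂ) (S : Finset ι) :
    (z • M).principalMinor S = z ^ S.card * M.principalMinor S := by
  simp [principalMinor, submatrix_smul]

theorem nonneg_of_rowBound {M : Matrix ι ι ℂ} {a : ι → ℝ} (hM : ∀ i j, ‖M i j‖ ≤ a i) (i : ι) :
    0 ≤ a i :=
  (norm_nonneg _).trans (hM i i)

theorem hasSum_fredholmDet {M : Matrix ι ι ℂ} {a : ι → ℝ} (ha : Summable a)
    (hM : ∀ i j, ‖M i j‖ ≤ a i) :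
    HasSum (fun S : Finset ι => (-1) ^ S.card * M.principalMinor S) M.fredholmDet := by
  refine Summable.hasSum (Summable.of_norm_bounded
    (summable_sqrt_card_pow_mul_prod (nonneg_of_rowBound hM) ha) fun S => ?_)
  rw [norm_mul, norm_pow, norm_neg, norm_one, one_pow, one_mul]
  exact norm_principalMinor_le hM S

/-- Dominated convergence: a minor is continuous in its finitely many entries, and Hadamard's bound
depends only on `a`. This is what reduces statements on infinite matrices to finite ones. -/
theorem tendsto_fredholmDet {α : Type*} {l : Filter α} {Mn : α → Matrix ι ι ℂ} {M : Matrix ι ι ℂ}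
    {a : ι → ℝ} (ha : Summable a) (hM : ∀ n i j, ‖Mn n i j‖ ≤ a i)
    (h : ∀ i j, Tendsto (fun n => Mn n i j) l (𝓝 (M i j))) :
    Tendsto (fun n => (Mn n).fredholmDet) l (𝓝 M.fredholmDet) := by
  classical
  rcases isEmpty_or_nonempty α with hα | ⟨⟨n₀⟩⟩
  · rw [Filter.filter_eq_bot_of_isEmpty l]
    exact tendsto_bot
  refine tendsto_tsum_of_dominated_convergence
    (summable_sqrt_card_pow_mul_prod (nonneg_of_rowBound (hM n₀)) ha) (fun S => ?_)
    (Eventually.of_forall fun n S => ?_)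
  · refine Tendsto.const_mul _ ?_
    have hc : Continuous fun A : Matrix S S ℂ => A.det := continuous_id.matrix_det
    refine (hc.tendsto _).comp ?_
    exact tendsto_pi_nhds.2 fun i => tendsto_pi_nhds.2 fun j => h i j
  · rw [norm_mul, norm_pow, norm_neg, norm_one, one_pow, one_mul]
    exact norm_principalMinor_le (hM n) S

/-- The terms are monomials in `z`, and on a ball of radius `ρ` they are dominated by the Hadamard
bounds for `ρ a`, so the series converges locally uniformly. -/
theorem differentiable_fredholmDet_smul {M : Matrix ι ι ℂ} {a : ι → ℝ} (ha : Summable a)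
    (hM : ∀ i j, ‖M i j‖ ≤ a i) : Differentiable ℂ fun z : ℂ => (z • M).fredholmDet := by
  intro z
  have hd : DifferentiableOn ℂ (fun z : ℂ => (z • M).fredholmDet) (Metric.ball 0 (‖z‖ + 1)) := by
    refine Complex.differentiableOn_tsum_of_summable_norm
      (u := fun S => √((S.card : ℝ) ^ S.card) * ∏ i ∈ S, ((‖z‖ + 1) * a i))
      (summable_sqrt_card_pow_mul_prod
        (fun i => mul_nonneg (by positivity) (nonneg_of_rowBound hM i)) (ha.mul_left _))
      (fun S => ?_) Metric.isOpen_ball (fun S y hy => ?_)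
    · simp only [principalMinor_smul]
      fun_prop
    · rw [norm_mul, norm_pow, norm_neg, norm_one, one_pow, one_mul]
      refine norm_principalMinor_le (fun i j => ?_) S
      rw [smul_apply, norm_smul]
      rw [mem_ball_zero_iff] at hy
      exact mul_le_mul hy.le (hM i j) (norm_nonneg _) (by positivity)
  exact hd.differentiableAt (Metric.isOpen_ball.mem_nhds (by simp))

/-- Multilinearity in the rows: take the rows in `S` from `-M` and the others from the identity. -/
theorem det_one_sub_eq_sum_principalMinor {n : Type*} [Fintype n] [DecidableEq n]
    (M : Matrix n n ℂ) :
    (1 - M).det = ∑ S : Finset n, (-1) ^ S.card * M.principalMinor S := by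
  have h1 : (1 - M).det = ∑ S : Finset n, det (S.piecewise (-M) (1 : Matrix n n ℂ)) := by
    rw [sub_eq_neg_add]
    exact detRowAlternating.map_add_univ (-M) (1 : Matrix n n ℂ)
  rw [h1]
  refine Finset.sum_congr rfl fun S _ => ?_
  have h2 := det_piecewise_one_eq_submatrix_det (-M) S
  change det (S.piecewise (-M) (1 : Matrix n n ℂ)) = _ at h2
  rw [h2, ← neg_one_smul ℂ, ← principalMinor_smul, principalMinor]
  convert rfl

theorem principalMinor_eq_zero {M : Matrix ι ι ℂ} {S : Finset ι} {i : ι} (hi : i ∈ S)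
    (h : ∀ j, M i j = 0) : M.principalMinor S = 0 := by
  classical
  exact det_eq_zero_of_row_eq_zero ⟨i, hi⟩ fun j => h j

theorem principalMinor_map {m : Type*} (f : m ↪ ι) (M : Matrix ι ι ℂ) (S : Finset m) :
    M.principalMinor (S.map f) = (M.submatrix f f).principalMinor S := by
  classical
  let e : S ≃ S.map f := Equiv.ofBijective (fun i => ⟨f i, Finset.mem_map_of_mem f i.2⟩)
    ⟨fun i j h => Subtype.ext (f.injective (congrArg Subtype.val h)), fun ⟨i, hi⟩ => by
      obtain ⟨j, hj, rfl⟩ := Finset.mem_map.1 hi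
      exact ⟨⟨j, hj⟩, rfl⟩⟩
  unfold principalMinor
  rw [← det_submatrix_equiv_self e, submatrix_submatrix, submatrix_submatrix]
  congr 1

theorem fredholmDet_eq_det {m : Type*} [Fintype m] [DecidableEq m] (f : m ↪ ι)
    {M : Matrix ι ι ℂ} (h : ∀ i ∉ Set.range f, ∀ j, M i j = 0) :
    M.fredholmDet = (1 - M.submatrix f f).det := by
  classical
  rw [det_one_sub_eq_sum_principalMinor, fredholmDet,
    ← (Finset.map_injective f).tsum_eq, tsum_fintype]
  · simp only [principalMinor_map, Finset.card_map]
  · intro S hS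
    by_contra hS'
    refine hS (mul_eq_zero_of_right _ ?_)
    have : ∃ i ∈ S, i ∉ Set.range f := by
      by_contra! hc
      refine hS' ⟨S.preimage f f.injective.injOn, ?_⟩
      ext i
      simp only [Finset.mem_map, Finset.mem_preimage]
      constructor
      · rintro ⟨j, hj, rfl⟩
        exact hj
      · intro hi
        obtain ⟨j, rfl⟩ := hc i hi
        exact ⟨j, hi, rfl⟩
    obtain ⟨i, hi, hi'⟩ := this
    exact principalMinor_eq_zero hi (h i hi')

-- Clearing only the rows outside `S` already kills every minor with an index outside `S`, and it
-- preserves the row bounds needed for `tendsto_fredholmDet`.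
open Classical in
theorem fredholmDet_rowRestrict (M : Matrix ι ι ℂ) (S : Finset ι) :
    (of fun i j => if i ∈ S then M i j else 0).fredholmDet =
      (1 - M.submatrix ((↑) : S → ι) ((↑) : S → ι)).det := by
  rw [fredholmDet_eq_det (Function.Embedding.subtype (· ∈ S))]
  · congr 2
    ext i j
    simp
  · intro i hi j
    rw [of_apply, if_neg]
    simpa using hi

open Classical in
theorem tendsto_det_one_sub_submatrix {M : Matrix ι ι ℂ} {a : ι → ℝ} (ha : Summable a)
    (hM : ∀ i j, ‖M i j‖ ≤ a i) :
    Tendsto (fun S : Finset ι => (1 - M.submatrix ((↑) : S → ι) ((↑) : S → ι)).det) atTop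
      (𝓝 M.fredholmDet) := by
  simp only [← fredholmDet_rowRestrict]
  refine tendsto_fredholmDet ha (fun S i j => ?_) (fun i j => ?_)
  · rw [of_apply]
    split_ifs
    · exact hM i j
    · simpa using nonneg_of_rowBound hM i
  · refine tendsto_const_nhds.congr' ?_
    filter_upwards [eventually_ge_atTop {i}] with S hS
    rw [of_apply, if_pos (Finset.singleton_subset_iff.1 hS)]

/-- The Fredholm determinant is multiplicative: `det ((1 - M) (1 - N)) = det (1 - M) det (1 - N)`. -/
theorem fredholmDet_mul {M N P : Matrix ι ι ℂ} {a b : ι → ℝ} (ha : Summable a) (hb : Summable b)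
    (hM : ∀ i j, ‖M i j‖ ≤ a i) (hN : ∀ i j, ‖N i j‖ ≤ b i)
    (hP : ∀ i j, HasSum (fun k => M i k * N k j) (P i j)) :
    (M + N - P).fredholmDet = M.fredholmDet * N.fredholmDet := by
  classical
  have ha0 := nonneg_of_rowBound hM
  have hb0 := nonneg_of_rowBound hN
  have h1 := (tendsto_det_one_sub_submatrix ha hM).mul (tendsto_det_one_sub_submatrix hb hN)
  refine tendsto_nhds_unique ?_ h1
  -- The inner sum is truncated as well, so that on `S × S` the matrix `1 - Q S` is exactly the
  -- product of the truncations of `1 - M` and `1 - N`.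
  let Q : Finset ι → Matrix ι ι ℂ := fun S => of fun i j => M i j + N i j - ∑ k ∈ S, M i k * N k j
  have h2 : ∀ S : Finset ι, (1 - M.submatrix ((↑) : S → ι) ((↑) : S → ι)).det *
      (1 - N.submatrix ((↑) : S → ι) ((↑) : S → ι)).det =
      (of fun i j => if i ∈ S then Q S i j else 0).fredholmDet := by
    intro S
    rw [fredholmDet_rowRestrict, ← det_mul]
    congr 1
    have h3 : (Q S).submatrix ((↑) : S → ι) ((↑) : S → ι) = M.submatrix ((↑) : S → ι) ((↑) : S → ι) +
        N.submatrix ((↑) : S → ι) ((↑) : S → ι) -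
        M.submatrix ((↑) : S → ι) ((↑) : S → ι) * N.submatrix ((↑) : S → ι) ((↑) : S → ι) := by
      ext i j
      simp only [Q, submatrix_apply, of_apply, sub_apply, add_apply, mul_apply]
      rw [← Finset.sum_coe_sort S]
    rw [h3]
    noncomm_ring
  simp only [h2]
  refine tendsto_fredholmDet (a := fun i => a i + b i + a i * ∑' k, b k)
    ((ha.add hb).add (ha.mul_right _)) (fun S i j => ?_) (fun i j => ?_)
  · rw [of_apply]
    split_ifs
    · simp only [Q, of_apply]
      refine (norm_sub_le _ _).trans (add_le_add ((norm_add_le _ _).trans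
        (add_le_add (hM i j) (hN i j))) ((norm_sum_le _ _).trans ?_))
      calc ∑ k ∈ S, ‖M i k * N k j‖ ≤ ∑ k ∈ S, a i * b k :=
            Finset.sum_le_sum fun k _ => by
              rw [norm_mul]
              exact mul_le_mul (hM i k) (hN k j) (norm_nonneg _) (ha0 i)
        _ = a i * ∑ k ∈ S, b k := by rw [Finset.mul_sum]
        _ ≤ _ := mul_le_mul_of_nonneg_left (hb.sum_le_tsum _ fun k _ => hb0 k) (ha0 i)
    · rw [norm_zero]
      have := ha0 i
      have := hb0 i
      have : 0 ≤ ∑' k, b k := tsum_nonneg hb0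
      positivity
  · have h4 : Tendsto (fun S : Finset ι => Q S i j) atTop (𝓝 ((M + N - P) i j)) :=
      tendsto_const_nhds.sub (hP i j)
    refine h4.congr' ?_
    filter_upwards [eventually_ge_atTop {i}] with S hS
    rw [of_apply, if_pos (Finset.singleton_subset_iff.1 hS)]

end Matrix

end FredholmDet

/-! ### The determinant as the exponential of traces of powers -/

section TracePow

namespace Matrix

variable {n : Type*} [Fintype n] [DecidableEq n]

/-- Spectral mapping with multiplicities, without triangularisation. Up to sign, `det (x - Nᵏ)` is
`det q(N)` for `q = Xᵏ - x`. Factoring `q` into linear terms and each `det (N - y)` over the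
eigenvalues `z`, then exchanging the two products, gives `∏ q(z)`. -/
theorem charpoly_pow_eq_prod (N : Matrix n n ℂ) (k : ℕ) (hk : k ≠ 0) :
    (N ^ k).charpoly = (N.charpoly.roots.map fun z => Polynomial.X - Polynomial.C (z ^ k)).prod := by
  set m := N.charpoly.roots with hm
  have hcard : m.card = Fintype.card n := by
    rw [hm, ← (IsAlgClosed.splits N.charpoly).natDegree_eq_card_roots, N.charpoly_natDegree_eq_dim]
  have hneg : ∀ f : ℂ → ℂ, (m.map fun z => -f z).prod = (-1) ^ Fintype.card n * (m.map f).prod := by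
    intro f
    rw [← hcard, ← Multiset.card_map f m, ← Multiset.prod_map_neg, Multiset.map_map]
    rfl
  have hdet : ∀ y : ℂ, (Polynomial.aeval N (Polynomial.X - Polynomial.C y)).det =
      (m.map fun z => z - y).prod := by
    intro y
    have h := (IsAlgClosed.splits N.charpoly).eq_prod_roots_of_monic N.charpoly_monic
    have h1 : Polynomial.aeval N (Polynomial.X - Polynomial.C y) = -(Matrix.scalar n y - N) := by
      simp [Matrix.algebraMap_eq_diagonal, Pi.algebraMap_def]
    rw [h1, Matrix.det_neg, ← Matrix.eval_charpoly]
    conv_lhs => rw [h]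
    rw [Polynomial.eval_multiset_prod, Multiset.map_map, ← hm, ← hneg]
    simp
  refine Polynomial.funext fun x => ?_
  rw [Matrix.eval_charpoly, Polynomial.eval_multiset_prod, Multiset.map_map]
  set q : Polynomial ℂ := Polynomial.X ^ k - Polynomial.C x with hq
  have hqm : q.Monic := Polynomial.monic_X_pow_sub_C x hk
  have hq' := (IsAlgClosed.splits q).eq_prod_roots_of_monic hqm
  have h1 : ∀ z : ℂ, (q.roots.map fun y => z - y).prod = q.eval z := by
    intro z
    conv_rhs => rw [hq']
    rw [Polynomial.eval_multiset_prod, Multiset.map_map]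
    simp
  have h2 : ∀ t : Multiset ℂ,
      (Polynomial.aeval N (t.map fun y => Polynomial.X - Polynomial.C y).prod).det =
        (t.map fun y => (m.map fun z => z - y).prod).prod := by
    intro t
    induction t using Multiset.induction with
    | empty => simp
    | cons y t ih => simp only [Multiset.map_cons, Multiset.prod_cons, map_mul, det_mul, ih, hdet]
  have h3 : Matrix.scalar n x - N ^ k = -Polynomial.aeval N q := by
    simp [hq, Matrix.algebraMap_eq_diagonal, Pi.algebraMap_def]
  rw [h3, Matrix.det_neg, hq', h2, Multiset.prod_map_prod_map]
  simp only [h1]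
  rw [← hneg]
  simp [hq]

theorem trace_pow_eq_sum_roots (N : Matrix n n ℂ) (k : ℕ) (hk : k ≠ 0) :
    (N ^ k).trace = (N.charpoly.roots.map (· ^ k)).sum := by
  rw [trace_eq_sum_roots_charpoly, charpoly_pow_eq_prod N k hk]
  have : (N.charpoly.roots.map fun z => Polynomial.X - Polynomial.C (z ^ k)) =
      ((N.charpoly.roots.map (· ^ k)).map fun z => Polynomial.X - Polynomial.C z) := by
    rw [Multiset.map_map]
    rfl
  rw [this, Polynomial.roots_multiset_prod_X_sub_C]

theorem hasSum_trace_pow_div {N : Matrix n n ℂ} (h : ∀ z ∈ N.charpoly.roots, ‖z‖ < 1) :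
    ∃ s, HasSum (fun k : ℕ => (N ^ (k + 1)).trace / (k + 1 : ℂ)) s ∧
      (1 - N).det = Complex.exp (-s) := by
  have h1 : (1 - N).det = (N.charpoly.roots.map fun z => 1 - z).prod := by
    have h := (IsAlgClosed.splits N.charpoly).eq_prod_roots_of_monic N.charpoly_monic
    have h2 := Matrix.eval_charpoly N 1
    rw [map_one] at h2
    rw [← h2]
    conv_lhs => rw [h]
    rw [Polynomial.eval_multiset_prod, Multiset.map_map]
    simp
  have h2 : ∀ t : Multiset ℂ, (∀ z ∈ t, ‖z‖ < 1) →
      ∃ s, HasSum (fun k : ℕ => (t.map (· ^ (k + 1))).sum / (k + 1 : ℂ)) s ∧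
        (t.map fun z => 1 - z).prod = Complex.exp (-s) := by
    intro t
    induction t using Multiset.induction with
    | empty => exact fun _ => ⟨0, by simp, by simp⟩
    | cons z t ih =>
      intro ht
      obtain ⟨s, hs, hs'⟩ := ih fun y hy => ht y (Multiset.mem_cons_of_mem hy)
      have hz := ht z (Multiset.mem_cons_self _ _)
      -- The term of index `0` of the logarithm series is `z⁰ / 0 = 0` and is dropped.
      have hl := (hasSum_nat_add_iff' 1).2 (Complex.hasSum_taylorSeries_neg_log hz)
      simp only [Finset.range_one, Finset.sum_singleton, Nat.cast_zero, div_zero, sub_zero] at hl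
      refine ⟨-Complex.log (1 - z) + s, ?_, ?_⟩
      · refine (hl.add hs).congr_fun fun k => ?_
        rw [Multiset.map_cons, Multiset.sum_cons, add_div]
        push_cast
        rfl
      · rw [Multiset.map_cons, Multiset.prod_cons, hs', neg_add, neg_neg, Complex.exp_add,
          Complex.exp_log]
        intro h0
        rw [sub_eq_zero] at h0
        rw [← h0, norm_one] at hz
        exact lt_irrefl _ hz
  rw [h1]
  simp only [trace_pow_eq_sum_roots N _ (Nat.succ_ne_zero _)]
  exact h2 _ h

/-- Row bounds `a` bound the operator norm on `ℓ¹` by `∑ a i`; apply this to an eigenvector. -/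
theorem norm_root_charpoly_le {N : Matrix n n ℂ} {a : n → ℝ} (hN : ∀ i j, ‖N i j‖ ≤ a i) {z : ℂ}
    (hz : z ∈ N.charpoly.roots) : ‖z‖ ≤ ∑ i, a i := by
  have h1 : (Matrix.scalar n z - N).det = 0 := by
    rw [← Matrix.eval_charpoly]
    exact Polynomial.isRoot_of_mem_roots hz
  obtain ⟨v, hv0, hv⟩ := Matrix.exists_mulVec_eq_zero_iff.2 h1
  have h2 : ∀ i, z * v i = ∑ j, N i j * v j := by
    intro i
    have := congrFun hv i
    simp only [sub_mulVec, Pi.sub_apply, Pi.zero_apply, sub_eq_zero, scalar_apply,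
      mulVec_diagonal] at this
    exact this
  have hpos : 0 < ∑ i, ‖v i‖ := by
    obtain ⟨i, hi⟩ := Function.ne_iff.1 hv0
    exact Finset.sum_pos' (fun i _ => norm_nonneg _) ⟨i, Finset.mem_univ _, norm_pos_iff.2 hi⟩
  have h3 : ‖z‖ * ∑ i, ‖v i‖ ≤ (∑ i, a i) * ∑ i, ‖v i‖ := by
    rw [Finset.mul_sum, Finset.sum_mul]
    refine Finset.sum_le_sum fun i _ => ?_
    rw [← norm_mul, h2, Finset.mul_sum]
    refine (norm_sum_le _ _).trans (Finset.sum_le_sum fun j _ => ?_)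
    rw [norm_mul]
    exact mul_le_mul_of_nonneg_right (hN i j) (norm_nonneg _)
  exact le_of_mul_le_mul_right h3 hpos

end Matrix

end TracePow

/-! ### Sums of products over tuples -/

section TupleSums

variable {κ R : Type*} [NormedCommRing R] [CompleteSpace R]

theorem hasSum_pi_prod {k : ℕ} {f : Fin k → κ → R} (hf : ∀ a, Summable fun x => ‖f a x‖) :
    (Summable fun g : Fin k → κ => ‖∏ a, f a (g a)‖) ∧
      HasSum (fun g : Fin k → κ => ∏ a, f a (g a)) (∏ a, ∑' x, f a x) := by
  induction k with
  | zero =>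
    refine ⟨(hasSum_unique _).summable, ?_⟩
    simp
  | succ k ih =>
    obtain ⟨h1, h2⟩ := ih fun a => hf a.succ
    let e := Fin.consEquiv (fun _ : Fin (k + 1) => κ)
    have he : ∀ p : κ × (Fin k → κ), ∏ a, f a (e p a) = f 0 p.1 * ∏ a, f (Fin.succ a) (p.2 a) := by
      intro p
      rw [Fin.prod_univ_succ]
      rfl
    constructor
    · rw [← e.summable_iff]
      refine ((hf 0).mul_norm h1).congr fun p => ?_
      rw [Function.comp_apply, he]
    · rw [← e.hasSum_iff, Fin.prod_univ_succ, ← h2.tsum_eq,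
        tsum_mul_tsum_of_summable_norm (hf 0) h1]
      refine HasSum.congr_fun ?_ fun p => he p
      exact (summable_mul_of_summable_norm (hf 0) h1).hasSum

end TupleSums

/-! ### Products of matrix coefficients along sequences -/

section PathProd

variable {ι R : Type*}

/-- The product `B (f n) (f (n-1)) * ⋯ * B (f 1) (f 0)`. -/
def Matrix.pathProd [Monoid R] (B : Matrix ι ι R) (f : ℕ → ι) : ℕ → R
  | 0 => 1
  | n + 1 => B (f (n + 1)) (f n) * Matrix.pathProd B f n

/-- The periodic sequence obtained by repeating a tuple. -/
def Fin.cyclicSeq {n : ℕ} (g : Fin (n + 1) → ι) (k : ℕ) : ι := g (Fin.ofNat (n + 1) k)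

theorem Fin.cyclicSeq_val {n : ℕ} (g : Fin (n + 1) → ι) (k : Fin (n + 1)) :
    Fin.cyclicSeq g k = g k := by
  rw [Fin.cyclicSeq, Fin.ofNat_val_eq_self]

theorem Fin.cyclicSeq_of_lt {n k : ℕ} (g : Fin (n + 1) → ι) (hk : k < n + 1) :
    Fin.cyclicSeq g k = g ⟨k, hk⟩ := Fin.cyclicSeq_val g ⟨k, hk⟩

namespace Matrix

theorem pathProd_congr [Monoid R] (B : Matrix ι ι R) {f f' : ℕ → ι} {n : ℕ}
    (h : ∀ k ≤ n, f k = f' k) : pathProd B f n = pathProd B f' n := by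
  induction n with
  | zero => rfl
  | succ n ih =>
    rw [pathProd, pathProd, ih fun k hk => h k (by omega), h _ le_rfl, h n (by omega)]

theorem pathProd_add [Monoid R] (B : Matrix ι ι R) (f : ℕ → ι) (m n : ℕ) :
    pathProd B f (m + n) = pathProd B (fun k => f (m + k)) n * pathProd B f m := by
  induction n with
  | zero => simp [pathProd]
  | succ n ih => rw [← add_assoc, pathProd, ih, pathProd, mul_assoc, add_assoc]

theorem pathProd_mul [Monoid R] (B : Matrix ι ι R) {f : ℕ → ι} {m : ℕ} (hf : ∀ k, f (m + k) = f k)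
    (n : ℕ) : pathProd B f (m * n) = pathProd B f m ^ n := by
  induction n with
  | zero => rw [mul_zero, pow_zero, pathProd]
  | succ n ih => rw [mul_add, mul_one, add_comm, pathProd_add, funext hf, ih, pow_succ]

theorem pow_apply_eq_sum_pathProd [Fintype ι] [DecidableEq ι] [Semiring R] (B : Matrix ι ι R)
    (n : ℕ) (j i : ι) : (B ^ n) j i = ∑ g : Fin (n + 1) → ι,
      if g 0 = i ∧ g (Fin.last n) = j then pathProd B (Fin.cyclicSeq g) n else 0 := by
  induction n generalizing j with
  | zero =>
    rw [← (Equiv.funUnique (Fin 1) ι).symm.sum_comp]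
    simp only [pow_zero, one_apply, pathProd]
    rw [Finset.sum_eq_single i]
    · simp [eq_comm]
    · intro b _ hb
      simp [hb]
    · simp
  | succ n ih =>
    rw [pow_succ', mul_apply]
    simp only [ih, Finset.mul_sum]
    rw [← (Fin.snocEquiv fun _ : Fin (n + 2) => ι).sum_comp, Fintype.sum_prod_type,
      Finset.sum_comm, Finset.sum_comm (s := Finset.univ (α := ι))]
    refine Finset.sum_congr rfl fun g _ => ?_
    rw [Finset.sum_eq_single (g (Fin.last n)), Finset.sum_eq_single j]
    · have h0 : (Fin.snocEquiv fun _ : Fin (n + 2) => ι) (j, g) 0 = g 0 :=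
        Fin.snoc_castSucc (α := fun _ : Fin (n + 2) => ι) j g 0
      have h1 : (Fin.snocEquiv fun _ : Fin (n + 2) => ι) (j, g) (Fin.last (n + 1)) = j :=
        Fin.snoc_last (α := fun _ : Fin (n + 2) => ι) j g
      have h2 : ∀ k ≤ n, Fin.cyclicSeq ((Fin.snocEquiv fun _ : Fin (n + 2) => ι) (j, g)) k =
          Fin.cyclicSeq g k := fun k hk => by
        rw [Fin.cyclicSeq_of_lt _ (by omega : k < n + 2), Fin.cyclicSeq_of_lt _ (by omega)]
        exact Fin.snoc_castSucc (α := fun _ : Fin (n + 2) => ι) j g ⟨k, by omega⟩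
      rw [h0, h1, pathProd, pathProd_congr B h2, h2 n le_rfl,
        Fin.cyclicSeq_of_lt _ (by omega : n + 1 < n + 2), Fin.cyclicSeq_of_lt g (by omega : n < n + 1)]
      change _ = if g 0 = i ∧ j = j then B ((Fin.snocEquiv fun _ : Fin (n + 2) => ι) (j, g)
        (Fin.last (n + 1))) (g (Fin.last n)) * _ else 0
      rw [h1]
      simp
    · intro b _ hb
      rw [if_neg]
      rintro ⟨-, h⟩
      refine hb (Eq.trans ?_ h)
      exact (Fin.snoc_last (α := fun _ : Fin (n + 2) => ι) b g).symm
    · simp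
    · intro b _ hb
      rw [if_neg (fun h => hb h.2.symm), mul_zero]
    · simp

/-- The closing step, from the last entry of the tuple back to the first, is built into the
periodicity of `Fin.cyclicSeq`. The entries lie in a possibly noncommutative ring because they will
be blocks. -/
theorem sum_pow_diag_eq_sum_pathProd [Fintype ι] [DecidableEq ι] [Semiring R] (B : Matrix ι ι R)
    (n : ℕ) : ∑ i, (B ^ (n + 1)) i i =
      ∑ g : Fin (n + 1) → ι, pathProd B (Fin.cyclicSeq g) (n + 1) := by
  have h0 : ∀ i, (B ^ (n + 1)) i i = ∑ k, ∑ g : Fin (n + 1) → ι, B i k *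
      (if g 0 = i ∧ g (Fin.last n) = k then pathProd B (Fin.cyclicSeq g) n else 0) := fun i => by
    rw [pow_succ', mul_apply]
    refine Finset.sum_congr rfl fun k _ => ?_
    rw [pow_apply_eq_sum_pathProd, Finset.mul_sum]
  simp only [h0]
  have h1 : ∀ i k, ∑ g : Fin (n + 1) → ι, B i k * (if g 0 = i ∧ g (Fin.last n) = k then
      pathProd B (Fin.cyclicSeq g) n else 0) = ∑ g : Fin (n + 1) → ι,
      if g 0 = i then (if g (Fin.last n) = k then pathProd B (Fin.cyclicSeq g) (n + 1) else 0)
        else 0 := by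
    intro i k
    refine Finset.sum_congr rfl fun g _ => ?_
    by_cases h0 : g 0 = i
    · by_cases h1 : g (Fin.last n) = k
      · rw [if_pos ⟨h0, h1⟩, if_pos h0, if_pos h1, pathProd, Fin.cyclicSeq_of_lt g (by omega : n < n + 1),
          ← h0, ← h1]
        congr 2
        simp [Fin.cyclicSeq]
      · simp [h1]
    · simp [h0]
  simp only [h1]
  have h2 : ∀ i, ∑ k, ∑ g : Fin (n + 1) → ι, (if g 0 = i then
      (if g (Fin.last n) = k then pathProd B (Fin.cyclicSeq g) (n + 1) else 0) else 0) =
      ∑ g : Fin (n + 1) → ι, if g 0 = i then pathProd B (Fin.cyclicSeq g) (n + 1) else 0 := by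
    intro i
    rw [Finset.sum_comm]
    refine Finset.sum_congr rfl fun g _ => ?_
    by_cases h : g 0 = i <;> simp [h]
  simp only [h2]
  rw [Finset.sum_comm]
  exact Finset.sum_congr rfl fun g _ => by simp

end Matrix

end PathProd

/-! ### Fredholm determinants of block matrices and closed sequences -/

section BlockDet

open Filter Topology

variable {ι κ : Type*} [Fintype κ] [DecidableEq κ]

namespace Matrix

theorem norm_pathProd_apply_le {B : Matrix ι ι (Matrix κ κ ℂ)} {c : ι → ℝ}
    (hB : ∀ i j a b, ‖B i j a b‖ ≤ c i) (hc : ∀ i, 0 ≤ c i) (f : ℕ → ι) (n : ℕ) (a b : κ) :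
    ‖pathProd B f n a b‖ ≤ ∏ k ∈ Finset.range n, (Fintype.card κ * c (f (k + 1))) := by
  induction n generalizing a with
  | zero =>
    rw [pathProd, one_apply]
    split_ifs <;> simp
  | succ n ih =>
    rw [pathProd, mul_apply, Finset.prod_range_succ]
    calc _ ≤ ∑ k : κ, ‖B (f (n + 1)) (f n) a k * pathProd B f n k b‖ := norm_sum_le _ _
      _ ≤ ∑ _k : κ, c (f (n + 1)) * ∏ k ∈ Finset.range n, (Fintype.card κ * c (f (k + 1))) := by
        refine Finset.sum_le_sum fun k _ => ?_
        rw [norm_mul]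
        exact mul_le_mul (hB _ _ _ _) (ih k) (norm_nonneg _) (hc _)
      _ = _ := by
        rw [Finset.sum_const, Finset.card_univ, nsmul_eq_mul]
        ring

/-- The contribution of a closed sequence to the logarithm of the determinant. -/
noncomputable def closedTerm (B : Matrix ι ι (Matrix κ κ ℂ)) (p : Σ n : ℕ, Fin (n + 1) → ι) : ℂ :=
  (pathProd B (Fin.cyclicSeq p.2) (p.1 + 1)).trace / (p.1 + 1 : ℂ)

theorem norm_closedTerm_le {B : Matrix ι ι (Matrix κ κ ℂ)} {c : ι → ℝ}
    (hB : ∀ i j a b, ‖B i j a b‖ ≤ c i) (hc : ∀ i, 0 ≤ c i) (p : Σ n : ℕ, Fin (n + 1) → ι) :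
    ‖closedTerm B p‖ ≤ Fintype.card κ * ∏ k, (Fintype.card κ * c (p.2 k)) := by
  obtain ⟨n, g⟩ := p
  -- The bound for `pathProd` uses the indices `1, …, n + 1`; by periodicity the last one may be
  -- replaced by `0`.
  have h1 : ∏ k ∈ Finset.range (n + 1), (Fintype.card κ * c (Fin.cyclicSeq g (k + 1))) =
      ∏ k, (Fintype.card κ * c (g k)) := by
    rw [Finset.prod_range_succ, ← Finset.prod_range (n := n + 1)
      (f := fun k => Fintype.card κ * c (Fin.cyclicSeq g k)) |>.trans
      (Finset.prod_congr rfl fun k _ => by rw [Fin.cyclicSeq_val]), Finset.prod_range_succ']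
    congr 3
    simp [Fin.cyclicSeq]
  rw [closedTerm, norm_div, ← h1]
  have h2 : (1 : ℝ) ≤ ‖((n : ℂ) + 1)‖ := by
    have : ((n : ℂ) + 1) = ((n + 1 : ℕ) : ℂ) := by push_cast; rfl
    rw [this, Complex.norm_natCast]
    exact_mod_cast Nat.succ_le_succ (Nat.zero_le n)
  refine (div_le_self (norm_nonneg _) h2).trans ((norm_sum_le _ _).trans ?_)
  refine (Finset.sum_le_sum fun a _ => norm_pathProd_apply_le hB hc _ _ a a).trans ?_
  rw [Finset.sum_const, Finset.card_univ, nsmul_eq_mul]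

/-- The tuples of length `n + 1` contribute at most a constant times the power `n + 1` of `card κ *
∑ c i`, so a geometric series dominates. -/
theorem summable_closedTerm {B : Matrix ι ι (Matrix κ κ ℂ)} {c : ι → ℝ}
    (hB : ∀ i j a b, ‖B i j a b‖ ≤ c i) (hc : ∀ i, 0 ≤ c i) (hs : Summable c)
    (h1 : Fintype.card κ * ∑' i, c i < 1) : Summable fun p => ‖closedTerm B p‖ := by
  refine Summable.of_nonneg_of_le (fun _ => norm_nonneg _) (norm_closedTerm_le hB hc) ?_
  refine Summable.mul_left _ ?_
  have h0 : ∀ i, 0 ≤ Fintype.card κ * c i := fun i => mul_nonneg (Nat.cast_nonneg _) (hc i)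
  have h2 : ∀ n : ℕ, HasSum (fun g : Fin (n + 1) → ι => ∏ k, (Fintype.card κ * c (g k)))
      ((Fintype.card κ * ∑' i, c i) ^ (n + 1)) := by
    intro n
    have := (hasSum_pi_prod (k := n + 1) (f := fun _ i => Fintype.card κ * c i)
      fun _ => (hs.mul_left _).norm).2
    simpa [tsum_mul_left] using this
  rw [summable_sigma_of_nonneg fun p => Finset.prod_nonneg fun k _ => h0 _]
  refine ⟨fun n => (h2 n).summable, ?_⟩
  simp only [(h2 _).tsum_eq]
  have h3 : 0 ≤ Fintype.card κ * ∑' i, c i := mul_nonneg (Nat.cast_nonneg _) (tsum_nonneg hc)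
  exact (summable_nat_add_iff 1).2 (summable_geometric_of_lt_one h3 h1)

theorem trace_comp_pow [Fintype ι] [DecidableEq ι] (B : Matrix ι ι (Matrix κ κ ℂ)) (n : ℕ) :
    (comp ι ι κ κ ℂ B ^ n).trace = (∑ i, (B ^ n) i i).trace := by
  have h1 : comp ι ι κ κ ℂ B ^ n = comp ι ι κ κ ℂ (B ^ n) :=
    (map_pow (compRingEquiv ι κ ℂ) B n).symm
  rw [h1, trace_sum, trace, Fintype.sum_prod_type]
  rfl

theorem pathProd_comp {ι' R : Type*} [Monoid R] (e : ι' → ι) (B : Matrix ι ι R) (f : ℕ → ι') (n : ℕ) :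
    pathProd (B.submatrix e e) f n = pathProd B (e ∘ f) n := by
  induction n with
  | zero => rw [pathProd, pathProd]
  | succ n ih => rw [pathProd, pathProd, ih]; rfl

theorem det_one_sub_comp_eq_exp [Fintype ι] [DecidableEq ι] {B : Matrix ι ι (Matrix κ κ ℂ)} {c : ι → ℝ}
    (hB : ∀ i j a b, ‖B i j a b‖ ≤ c i) (hc : ∀ i, 0 ≤ c i)
    (h1 : Fintype.card κ * ∑ i, c i < 1) :
    (1 - comp ι ι κ κ ℂ B).det = Complex.exp (-∑' p, closedTerm B p) := by
  obtain ⟨s, hs, hd⟩ := hasSum_trace_pow_div (N := comp ι ι κ κ ℂ B) fun z hz => by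
    refine lt_of_le_of_lt (norm_root_charpoly_le (a := fun p : ι × κ => c p.1)
      (fun i j => hB i.1 j.1 i.2 j.2) hz) ?_
    rw [Fintype.sum_prod_type]
    simpa [← Finset.mul_sum] using h1
  have h2 := (summable_closedTerm hB hc (hasSum_fintype c).summable
    (by rwa [tsum_fintype])).of_norm.hasSum.sigma fun n => hasSum_fintype _
  have h3 : ∀ n : ℕ, ∑ g : Fin (n + 1) → ι, closedTerm B ⟨n, g⟩ =
      (comp ι ι κ κ ℂ B ^ (n + 1)).trace / (n + 1 : ℂ) := by
    intro n
    rw [trace_comp_pow, sum_pow_diag_eq_sum_pathProd, trace_sum, Finset.sum_div]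
    rfl
  simp only [h3] at h2
  rw [hd, hs.unique h2]

/-- Truncation to finitely many block indices `S` makes the left side a finite determinant and
restricts the sum on the right to tuples in `S`. Both sides converge under domination as `S` grows.
-/
theorem fredholmDet_comp_eq_exp {B : Matrix ι ι (Matrix κ κ ℂ)} {c : ι → ℝ}
    (hB : ∀ i j a b, ‖B i j a b‖ ≤ c i) (hc : ∀ i, 0 ≤ c i) (hs : Summable c)
    (h1 : Fintype.card κ * ∑' i, c i < 1) :
    (comp ι ι κ κ ℂ B).fredholmDet = Complex.exp (-∑' p, closedTerm B p) := by
  classical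
  have hsum := summable_closedTerm hB hc hs h1
  have hrow : Summable fun p : ι × κ => c p.1 := by
    rw [summable_prod_of_nonneg fun p => hc p.1]
    refine ⟨fun i => (hasSum_fintype _).summable, ?_⟩
    simpa using hs.mul_left (Fintype.card κ : ℝ)
  let T : Finset ι → Matrix (ι × κ) (ι × κ) ℂ := fun S =>
    of fun p q => if p.1 ∈ S then comp ι ι κ κ ℂ B p q else 0
  have hT : Tendsto (fun S => (T S).fredholmDet) atTop (𝓝 (comp ι ι κ κ ℂ B).fredholmDet) := by
    refine tendsto_fredholmDet hrow (fun S p q => ?_) (fun p q => ?_)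
    · simp only [T, of_apply]
      split_ifs
      · exact hB _ _ _ _
      · simpa using hc p.1
    · refine tendsto_const_nhds.congr' ?_
      filter_upwards [eventually_ge_atTop {p.1}] with S hS
      simp only [T, of_apply]
      rw [if_pos (Finset.singleton_subset_iff.1 hS)]
  let X : Finset ι → (Σ n : ℕ, Fin (n + 1) → ι) → ℂ := fun S p =>
    if ∀ k, p.2 k ∈ S then closedTerm B p else 0
  have hX : Tendsto (fun S => ∑' p, X S p) atTop (𝓝 (∑' p, closedTerm B p)) := by
    refine tendsto_tsum_of_dominated_convergence hsum (fun p => ?_)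
      (Eventually.of_forall fun S p => ?_)
    · refine tendsto_const_nhds.congr' ?_
      filter_upwards [eventually_ge_atTop (Finset.univ.image p.2)] with S hS
      simp only [X]
      rw [if_pos fun k => hS (Finset.mem_image_of_mem _ (Finset.mem_univ k))]
    · simp only [X]
      split_ifs <;> simp
  refine tendsto_nhds_unique hT (Tendsto.congr (fun S => ?_) (Complex.continuous_exp.tendsto _
    |>.comp hX.neg))
  rw [Function.comp_apply]
  let e : S × κ ↪ ι × κ := ⟨fun p => (p.1, p.2), fun p q h => by
    simp only [Prod.mk.injEq] at h
    exact Prod.ext (Subtype.ext h.1) h.2⟩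
  rw [fredholmDet_eq_det e]
  · have h2 : (T S).submatrix e e = comp S S κ κ ℂ (B.submatrix (↑) (↑)) := by
      ext p q
      change (if (p.1 : ι) ∈ S then _ else _) = _
      rw [if_pos p.1.2]
      rfl
    have h3 : ∑ i : S, c i ≤ ∑' i, c i := by
      rw [Finset.sum_coe_sort S c]
      exact hs.sum_le_tsum _ fun i _ => hc i
    rw [h2, det_one_sub_comp_eq_exp (B := B.submatrix ((↑) : S → ι) ((↑) : S → ι)) (c := fun i : S => c i) (fun i j => hB i j)
      (fun i => hc i) (lt_of_le_of_lt (mul_le_mul_of_nonneg_left h3 (Nat.cast_nonneg _)) h1)]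
    congr 2
    let E : (Σ n : ℕ, Fin (n + 1) → S) → Σ n : ℕ, Fin (n + 1) → ι := fun p =>
      ⟨p.1, fun k => p.2 k⟩
    have hE : Function.Injective E := by
      rintro ⟨n, g⟩ ⟨n', g'⟩ h
      obtain rfl : n = n' := congrArg Sigma.fst h
      have := eq_of_heq (Sigma.mk.inj h).2
      congr 1
      funext k
      exact Subtype.ext (congrFun this k)
    rw [← hE.tsum_eq]
    · refine tsum_congr fun p => ?_
      simp only [X]
      rw [if_pos fun k => (p.2 k).2, closedTerm, closedTerm, pathProd_comp]
      rfl
    · rintro ⟨n, g⟩ hp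
      have h4 : ∀ k, g k ∈ S := by
        by_contra h
        exact hp (if_neg h)
      exact ⟨⟨n, fun k => ⟨g k, h4 k⟩⟩, rfl⟩
  · rintro p hp q
    change (if p.1 ∈ S then _ else _) = _
    rw [if_neg]
    exact fun h => hp ⟨(⟨p.1, h⟩, p.2), rfl⟩

end Matrix

end BlockDet

/-! ### The Fredholm determinant of an operator with a Hilbert–Schmidt factorization -/

section OperatorDet

namespace Matrix

/-- Every `k`-element set has `k!` enumerations, all with the same minor, while a tuple with a
repetition gives two equal rows and hence a zero determinant. -/
theorem hasSum_principalMinor_of_tuples {α : Type*} {N : Matrix α α ℂ} {k : ℕ} {s : ℂ}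
    (h : HasSum (fun i : Fin k → α => (N.submatrix i i).det) s) :
    HasSum (fun S : {S : Finset α // S.card = k} => N.principalMinor S.1) (s / k.factorial) := by
  classical
  let e : (Σ S : {S : Finset α // S.card = k}, Fin k ≃ S.1) → (Fin k → α) := fun p a => p.2 a
  have himg : ∀ p, Finset.univ.image (e p) = p.1.1 := by
    rintro ⟨S, f⟩
    ext x
    simp only [e, Finset.mem_image, Finset.mem_univ, true_and]
    exact ⟨fun ⟨a, ha⟩ => ha ▸ (f a).2, fun hx => ⟨f.symm ⟨x, hx⟩, by simp⟩⟩
  have he : Function.Injective e := by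
    rintro ⟨S, f⟩ ⟨S', f'⟩ h
    obtain rfl : S = S' := Subtype.ext (by rw [← himg ⟨S, f⟩, ← himg ⟨S', f'⟩, h])
    congr 1
    ext a
    exact congrFun h a
  rw [← he.hasSum_iff] at h
  · have h1 := h.sigma fun S => hasSum_fintype _
    have h2 : ∀ S : {S : Finset α // S.card = k},
        ∑ f : Fin k ≃ S.1, (N.submatrix (e ⟨S, f⟩) (e ⟨S, f⟩)).det =
          k.factorial * N.principalMinor S.1 := by
      intro S
      have h3 : ∀ f : Fin k ≃ S.1, (N.submatrix (e ⟨S, f⟩) (e ⟨S, f⟩)).det =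
          N.principalMinor S.1 := by
        intro f
        unfold principalMinor
        rw [← det_submatrix_equiv_self f, submatrix_submatrix]
        rfl
      simp only [h3]
      rw [Finset.sum_const, nsmul_eq_mul, Finset.card_univ, Fintype.card_equiv (Fintype.equivOfCardEq
        (by simp [S.2])), Fintype.card_fin]
    have hk : (k.factorial : ℂ) ≠ 0 := by exact_mod_cast k.factorial_ne_zero
    refine (h1.div_const (k.factorial : ℂ)).congr_fun fun S => ?_
    refine Eq.symm ((div_eq_iff hk).2 ?_)
    rw [mul_comm]
    exact h2 S
  · intro i hi
    have : ¬ Function.Injective i := by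
      intro hinj
      refine hi ⟨⟨⟨Finset.univ.image i, by simp [Finset.card_image_of_injective _ hinj]⟩,
        Equiv.ofBijective (fun a => ⟨i a, Finset.mem_image_of_mem _ (Finset.mem_univ a)⟩)
        ⟨fun a b hab => hinj (congrArg Subtype.val hab), fun ⟨x, hx⟩ => ?_⟩⟩, rfl⟩
      obtain ⟨a, -, rfl⟩ := Finset.mem_image.1 hx
      exact ⟨a, rfl⟩
    obtain ⟨a, b, hab, hne⟩ := Function.not_injective_iff.1 this
    exact det_zero_of_row_eq hne (funext fun j => by simp [hab])

/-- Fubini for the family `∏ A(i (π a), n a) B(n a, i a)`: summing over `n` first gives products of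
entries of `M = AB`, summing over `i` first gives those of `G = BA`. The permutation is the same on
both sides, so the signs will agree. -/
theorem exists_hasSum_prod_perm {α κ : Type*} {A : Matrix α κ ℂ} {B : Matrix κ α ℂ}
    {M : Matrix α α ℂ} {G : Matrix κ κ ℂ}
    (hA : Summable fun p : α × κ => ‖A p.1 p.2‖ ^ 2)
    (hB : Summable fun p : κ × α => ‖B p.1 p.2‖ ^ 2)
    (hM : ∀ i j, HasSum (fun n => A i n * B n j) (M i j))
    (hG : ∀ m n, HasSum (fun i => B m i * A i n) (G m n)) {k : ℕ} (π : Equiv.Perm (Fin k)) :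
    ∃ s, HasSum (fun i : Fin k → α => ∏ a, M (i (π a)) (i a)) s ∧
      HasSum (fun n : Fin k → κ => ∏ a, G (n (π a)) (n a)) s := by
  let X : (Fin k → α) × (Fin k → κ) → ℂ := fun p =>
    ∏ a, A (p.1 (π a)) (p.2 a) * B (p.2 a) (p.1 a)
  have hA' : Summable fun p : (Fin k → α) × (Fin k → κ) =>
      ∏ a, ‖A (p.1 (π a)) (p.2 a)‖ ^ 2 := by
    have hn : Summable fun p : α × κ => ‖‖A p.1 p.2‖ ^ 2‖ := hA.norm
    have h1 : Summable fun q : Fin k → α × κ => ∏ a, ‖A (q a).1 (q a).2‖ ^ 2 :=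
      (hasSum_pi_prod (R := ℝ) (f := fun (_ : Fin k) (p : α × κ) => ‖A p.1 p.2‖ ^ 2)
        fun _ => hn).2.summable
    let e : (Fin k → α) × (Fin k → κ) ≃ (Fin k → α × κ) :=
      { toFun := fun p a => (p.1 (π a), p.2 a)
        invFun := fun q => (fun a => (q (π.symm a)).1, fun a => (q a).2)
        left_inv := fun p => by simp
        right_inv := fun q => by simp }
    exact (e.summable_iff (f := fun q : Fin k → α × κ => ∏ a, ‖A (q a).1 (q a).2‖ ^ 2)).2 h1
  have hB' : Summable fun p : (Fin k → α) × (Fin k → κ) => ∏ a, ‖B (p.2 a) (p.1 a)‖ ^ 2 := by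
    have hn : Summable fun p : κ × α => ‖‖B p.1 p.2‖ ^ 2‖ := hB.norm
    have h1 : Summable fun q : Fin k → κ × α => ∏ a, ‖B (q a).1 (q a).2‖ ^ 2 :=
      (hasSum_pi_prod (R := ℝ) (f := fun (_ : Fin k) (p : κ × α) => ‖B p.1 p.2‖ ^ 2)
        fun _ => hn).2.summable
    let e : (Fin k → α) × (Fin k → κ) ≃ (Fin k → κ × α) :=
      { toFun := fun p a => (p.2 a, p.1 a)
        invFun := fun q => (fun a => (q a).2, fun a => (q a).1)
        left_inv := fun p => rfl
        right_inv := fun q => rfl }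
    exact (e.summable_iff (f := fun q : Fin k → κ × α => ∏ a, ‖B (q a).1 (q a).2‖ ^ 2)).2 h1
  -- Absolute convergence comes from `xy ≤ x² + y²`, which separates the two Hilbert–Schmidt
  -- factors.
  have hX : Summable X := by
    refine Summable.of_norm_bounded ((hA'.add hB')) fun p => ?_
    simp only [X, norm_prod, norm_mul]
    rw [Finset.prod_mul_distrib, Finset.prod_pow, Finset.prod_pow]
    nlinarith [sq_nonneg (∏ a, ‖A (p.1 (π a)) (p.2 a)‖ - ∏ a, ‖B (p.2 a) (p.1 a)‖),
      sq_nonneg (∏ a, ‖A (p.1 (π a)) (p.2 a)‖ + ∏ a, ‖B (p.2 a) (p.1 a)‖)]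
  have hmul : ∀ x y : ℂ, ‖x * y‖ ≤ ‖x‖ ^ 2 + ‖y‖ ^ 2 := fun x y => by
    rw [norm_mul]
    nlinarith [sq_nonneg (‖x‖ - ‖y‖), sq_nonneg (‖x‖ + ‖y‖)]
  have hAB : ∀ i j, Summable fun n => ‖A i n * B n j‖ := fun i j =>
    Summable.of_nonneg_of_le (fun _ => norm_nonneg _) (fun n => hmul _ _)
      ((hA.prod_factor i).add (hB.prod_symm.prod_factor j))
  have hBA : ∀ m n, Summable fun i => ‖A i n * B m i‖ := fun m n =>
    Summable.of_nonneg_of_le (fun _ => norm_nonneg _) (fun i => hmul _ _)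
      ((hA.prod_symm.prod_factor n).add (hB.prod_factor m))
  refine ⟨∑' p, X p, hX.hasSum.prod_fiberwise fun i => ?_, ?_⟩
  · have := (hasSum_pi_prod (k := k) (f := fun a n => A (i (π a)) n * B n (i a))
      fun a => hAB _ _).2
    simpa only [(hM _ _).tsum_eq] using this
  · have hX' : HasSum (X ∘ Equiv.prodComm _ _) (∑' p, X p) :=
      (Equiv.hasSum_iff _).2 hX.hasSum
    refine hX'.prod_fiberwise fun n => ?_
    have := (hasSum_pi_prod (k := k) (f := fun a i => A i (n (π.symm a)) * B (n a) i)
      fun a => hBA _ _).2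
    have h1 : ∀ a, ∑' i, A i (n (π.symm a)) * B (n a) i = G (n a) (n (π.symm a)) := fun a => by
      rw [← (hG _ _).tsum_eq]
      exact tsum_congr fun i => mul_comm _ _
    simp only [h1] at this
    rw [← Equiv.prod_comp π] at this
    simp only [Equiv.symm_apply_apply] at this
    refine this.congr_fun fun i => ?_
    simp only [X, Function.comp_apply, Equiv.prodComm_apply, Prod.swap]
    rw [Finset.prod_mul_distrib, Finset.prod_mul_distrib,
      ← Equiv.prod_comp π (fun a => A (i a) (n (π.symm a)))]
    simp only [Equiv.symm_apply_apply]

/-- A form of the identity `tr ⋀ᵏ(AB) = tr ⋀ᵏ(BA)`. -/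
theorem exists_hasSum_principalMinor {α κ : Type*} {A : Matrix α κ ℂ} {B : Matrix κ α ℂ}
    {M : Matrix α α ℂ} {G : Matrix κ κ ℂ}
    (hA : Summable fun p : α × κ => ‖A p.1 p.2‖ ^ 2)
    (hB : Summable fun p : κ × α => ‖B p.1 p.2‖ ^ 2)
    (hM : ∀ i j, HasSum (fun n => A i n * B n j) (M i j))
    (hG : ∀ m n, HasSum (fun i => B m i * A i n) (G m n)) (k : ℕ) :
    ∃ s, HasSum (fun S : {S : Finset α // S.card = k} => M.principalMinor S.1) s ∧
      HasSum (fun S : {S : Finset κ // S.card = k} => G.principalMinor S.1) s := by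
  choose s hs hs' using fun π : Equiv.Perm (Fin k) => exists_hasSum_prod_perm hA hB hM hG π
  refine ⟨(∑ π, (Equiv.Perm.sign π : ℂ) * s π) / k.factorial, hasSum_principalMinor_of_tuples ?_,
    hasSum_principalMinor_of_tuples ?_⟩
  · simp only [det_apply', submatrix_apply]
    exact hasSum_sum fun π _ => (hs π).mul_left _
  · simp only [det_apply', submatrix_apply]
    exact hasSum_sum fun π _ => (hs' π).mul_left _

end Matrix

variable {H : Type u} [NormedAddCommGroup H] [InnerProductSpace ℂ H]

/-- In an orthonormal basis `b`, `K` is the product of two matrices that are Hilbert–Schmidt by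
Parseval. Their product in the other order is `⟪g m, f n⟫`, which does not involve `b`; hence the
same trace in every basis. -/
theorem hasExteriorTrace_of_factorization {K : H →L[ℂ] H} {κ : Type*} {f g : κ → H}
    (hf : Summable fun n => ‖f n‖ ^ 2) (hg : Summable fun n => ‖g n‖ ^ 2)
    (hK : ∀ a, HasSum (fun n => ⟪g n, a⟫_ℂ • f n) (K a)) {k : ℕ} {t : ℂ}
    (ht : HasSum (fun S : {S : Finset κ // S.card = k} =>
      (Matrix.of fun m n => ⟪g m, f n⟫_ℂ).principalMinor S.1) t) :
    HasExteriorTrace K k t := by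
  intro α b
  have hb : ∀ x, HasSum (fun i => ‖⟪b i, x⟫_ℂ‖ ^ 2) (‖x‖ ^ 2) := by
    intro x
    have h1 := b.hasSum_inner_mul_inner x x
    rw [inner_self_eq_norm_sq_to_K] at h1
    have h2 : ∀ i, ⟪x, b i⟫_ℂ * ⟪b i, x⟫_ℂ = ((‖⟪b i, x⟫_ℂ‖ ^ 2 : ℝ) : ℂ) := fun i => by
      rw [← inner_conj_symm x (b i), mul_comm, Complex.mul_conj']
      push_cast
      rfl
    simp only [h2] at h1
    exact Complex.hasSum_ofReal.1 (by simpa using h1)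
  have hs : ∀ {h : κ → H}, (Summable fun n => ‖h n‖ ^ 2) →
      Summable fun p : κ × α => ‖⟪b p.2, h p.1⟫_ℂ‖ ^ 2 := by
    intro h hh
    rw [summable_prod_of_nonneg fun p => by positivity]
    exact ⟨fun n => (hb (h n)).summable, hh.congr fun n => (hb (h n)).tsum_eq.symm⟩
  let A : Matrix α κ ℂ := .of fun i n => ⟪b i, f n⟫_ℂ
  let B : Matrix κ α ℂ := .of fun n i => ⟪g n, b i⟫_ℂ
  let M : Matrix α α ℂ := .of fun i j => ⟪b i, K (b j)⟫_ℂ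
  have hA : Summable fun p : α × κ => ‖A p.1 p.2‖ ^ 2 := (hs hf).prod_symm
  have hB : Summable fun p : κ × α => ‖B p.1 p.2‖ ^ 2 :=
    (hs hg).congr fun p => by simp only [B, Matrix.of_apply, norm_inner_symm]
  have hM : ∀ i j, HasSum (fun n => A i n * B n j) (M i j) := by
    intro i j
    have := (hK (b j)).mapL (innerSL ℂ (b i))
    refine this.congr_fun fun n => ?_
    simp [A, B, mul_comm]
  obtain ⟨s, h1, h2⟩ := Matrix.exists_hasSum_principalMinor hA hB hM
    (G := .of fun m n => ⟪g m, f n⟫_ℂ) (fun m n => b.hasSum_inner_mul_inner _ _) k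
  rw [ht.unique h2]
  exact h1

theorem hasFredholmDet_of_factorization {K : H →L[ℂ] H} {κ : Type*} {f g : κ → H}
    (hf : Summable fun n => ‖f n‖ ^ 2) (hg : Summable fun n => ‖g n‖ ^ 2)
    (hK : ∀ a, HasSum (fun n => ⟪g n, a⟫_ℂ • f n) (K a)) {d : ℂ}
    (hd : HasSum (fun S : Finset κ => (-1) ^ S.card *
      (Matrix.of fun m n => ⟪g m, f n⟫_ℂ).principalMinor S) d) :
    HasFredholmDet K d := by
  let G : Matrix κ κ ℂ := .of fun m n => ⟪g m, f n⟫_ℂ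
  let e : (Σ k : ℕ, {S : Finset κ // S.card = k}) ≃ Finset κ := Equiv.sigmaFiberEquiv Finset.card
  have h1 : ∀ k, Summable fun S : {S : Finset κ // S.card = k} => G.principalMinor S.1 := by
    intro k
    -- On sets of fixed cardinality the sign is constant, and multiplying by it once more removes
    -- it.
    refine ((hd.summable.subtype {S | S.card = k}).mul_left ((-1) ^ k)).congr fun S => ?_
    have : S.1.card = k := S.2
    simp only [Function.comp_apply, this]
    rw [← mul_assoc, ← mul_pow]
    simp [G]
  refine ⟨fun k => ∑' S : {S : Finset κ // S.card = k}, G.principalMinor S.1, fun k =>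
    hasExteriorTrace_of_factorization hf hg hK (h1 k).hasSum, ?_⟩
  refine (e.hasSum_iff.2 hd).sigma fun k => ?_
  refine ((h1 k).hasSum.mul_left ((-1) ^ k)).congr_fun fun S => ?_
  have : S.1.card = k := S.2
  simp [e, Equiv.sigmaFiberEquiv, this, G]

theorem isTraceClass_of_hasSum {K : H →L[ℂ] H} {κ : Type*} [Countable κ] {f g : κ → H}
    (hs : Summable fun n => ‖f n‖ * ‖g n‖)
    (hK : ∀ a, HasSum (fun n => ⟪g n, a⟫_ℂ • f n) (K a)) : IsTraceClass K := by
  classical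
  obtain ⟨e, he⟩ := exists_injective_nat κ
  refine ⟨Function.extend e f 0, Function.extend e g 0, ?_, fun a => ?_⟩
  · rw [← he.summable_iff]
    · exact hs.congr fun n => by simp [he.extend_apply]
    · intro n hn
      simp [Function.extend_apply' _ _ _ hn]
  · rw [← he.hasSum_iff]
    · exact (hK a).congr_fun fun n => by simp [he.extend_apply]
    · intro n hn
      simp [Function.extend_apply' _ _ _ hn]

end OperatorDet

/-! ### Closed paths and periodic sequences of oriented edges -/

/-- The shift on sequences. -/
def seqShift {α : Type*} (f : ℕ → α) : ℕ → α := fun i => f (i + 1)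

theorem seqShift_iterate_apply {α : Type*} (f : ℕ → α) (j i : ℕ) : seqShift^[j] f i = f (i + j) := by
  induction j generalizing i with
  | zero => rfl
  | succ j ih =>
    rw [Function.iterate_succ_apply']
    change seqShift^[j] f (i + 1) = _
    rw [ih]
    congr 1
    omega

theorem isPeriodicPt_seqShift_iff {α : Type*} {f : ℕ → α} {n : ℕ} :
    Function.IsPeriodicPt seqShift n f ↔ ∀ i, f (i + n) = f i := by
  simp only [← seqShift_iterate_apply]
  exact funext_iff

namespace SimpleGraph

variable {V : Type u} {G : SimpleGraph V}

/-- The oriented edge `e` can follow `d` in a path without backtracking. -/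
def Dart.NonBacktracking (d e : G.Dart) : Prop := d.snd = e.fst ∧ d.fst ≠ e.snd

namespace ClosedPath

/-- The periodic sequence `f` runs through the oriented edges of the closed path `p`. -/
structure Codes (p : G.ClosedPath) (f : ℕ → G.Dart) : Prop where
  darts_eq : p.2.darts = (List.range p.2.length).map f
  periodic : ∀ i, f (i + p.2.length) = f i

theorem length_shift (p : G.ClosedPath) : (shift p).2.length = p.2.length := by
  obtain ⟨x, p⟩ := p
  cases p with
  | nil => rfl
  | cons h q => simp [shift]

theorem length_shift_iterate (p : G.ClosedPath) (j : ℕ) :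
    (shift^[j] p).2.length = p.2.length := by
  induction j with
  | zero => rfl
  | succ j ih => rw [Function.iterate_succ_apply', length_shift, ih]

theorem exists_codes {p : G.ClosedPath} (hp : 0 < p.2.length) : ∃ f, Codes p f := by
  have h : ∀ i, i % p.2.length < p.2.darts.length := fun i => by
    rw [Walk.length_darts]
    exact Nat.mod_lt _ hp
  refine ⟨fun i => p.2.darts[i % p.2.length]'(h i), ?_, fun i => by simp⟩
  refine List.ext_getElem (by simp) fun i h1 h2 => ?_
  have : i % p.2.length = i := Nat.mod_eq_of_lt (by simpa using h1)
  simp [this]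

theorem Codes.getElem {p : G.ClosedPath} {f : ℕ → G.Dart} (h : Codes p f) {i : ℕ}
    (hi : i < p.2.darts.length) : p.2.darts[i] = f i := by
  simp [h.darts_eq]

theorem Codes.seq_unique {p : G.ClosedPath} {f g : ℕ → G.Dart} (hp : 0 < p.2.length)
    (hf : Codes p f) (hg : Codes p g) : f = g := by
  have key : ∀ {f : ℕ → G.Dart}, Codes p f → ∀ i, f i = f (i % p.2.length) := by
    intro f hf i
    conv_lhs => rw [← Nat.mod_add_div i p.2.length]
    generalize i / p.2.length = k
    induction k with
    | zero => rfl
    | succ k ih => rw [mul_add, mul_one, ← add_assoc, hf.periodic, ih]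
  funext i
  rw [key hf, key hg]
  have h : i % p.2.length < p.2.darts.length := by
    rw [Walk.length_darts]
    exact Nat.mod_lt _ hp
  rw [← hf.getElem h, ← hg.getElem h]

/-- Positive length is essential: trivial paths at different vertices have the same empty list of
edges. -/
theorem ext_darts {p q : G.ClosedPath} (hp : 0 < p.2.length) (h : p.2.darts = q.2.darts) :
    p = q := by
  obtain ⟨x, p⟩ := p
  obtain ⟨y, q⟩ := q
  obtain rfl : x = y := by
    cases p with
    | nil => simp at hp
    | cons h1 p =>
      cases q with
      | nil => simp at h
      | cons h2 q =>
        simp only [Walk.darts_cons, List.cons.injEq, Dart.mk.injEq, Prod.mk.injEq] at h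
        exact h.1.1
  rw [Walk.darts_injective (show p.darts = q.darts from h)]

theorem Codes.path_unique {p q : G.ClosedPath} {f : ℕ → G.Dart} (hp : Codes p f) (hq : Codes q f)
    (hl : p.2.length = q.2.length) (h0 : 0 < p.2.length) : p = q :=
  ext_darts h0 (by rw [hp.darts_eq, hq.darts_eq, hl])

theorem Codes.shift {p : G.ClosedPath} {f : ℕ → G.Dart} (h : Codes p f) :
    Codes (ClosedPath.shift p) (seqShift f) := by
  refine ⟨?_, fun i => ?_⟩
  · obtain ⟨x, p⟩ := p
    cases p with
    | nil => simp [ClosedPath.shift]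
    | cons a q =>
      have h1 := h.darts_eq
      have h2 := h.periodic 0
      simp only [Walk.darts_cons, Walk.length_cons, List.range_succ_eq_map, List.map_cons,
        List.map_map, List.cons.injEq] at h1 h2
      simp only [ClosedPath.shift, Walk.darts_concat, Walk.length_concat, List.range_succ,
        List.map_append, List.map_cons, List.map_nil, List.concat_eq_append]
      rw [h1.2, h1.1, ← h2, zero_add]
      rfl
  · rw [length_shift]
    change f (i + p.2.length + 1) = f (i + 1)
    rw [add_right_comm, h.periodic]

theorem Codes.shift_iterate {p : G.ClosedPath} {f : ℕ → G.Dart} (h : Codes p f) (j : ℕ) :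
    Codes (ClosedPath.shift^[j] p) (seqShift^[j] f) := by
  induction j with
  | zero => exact h
  | succ j ih =>
    rw [Function.iterate_succ_apply', Function.iterate_succ_apply']
    exact ih.shift

theorem Codes.isPeriodicPt {p : G.ClosedPath} {f : ℕ → G.Dart} (h : Codes p f) :
    Function.IsPeriodicPt seqShift p.2.length f :=
  isPeriodicPt_seqShift_iff.2 h.periodic

theorem shift_iterate_length (p : G.ClosedPath) : ClosedPath.shift^[p.2.length] p = p := by
  rcases Nat.eq_zero_or_pos p.2.length with h | h
  · rw [h]
    rfl
  · obtain ⟨f, hf⟩ := exists_codes h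
    have h1 := hf.shift_iterate p.2.length
    rw [hf.isPeriodicPt.eq] at h1
    exact h1.path_unique hf (length_shift_iterate p _) (by rwa [length_shift_iterate])

/-- The shift is periodic on each closed path, so its forward orbits are already the classes of the
generated equivalence relation. -/
theorem shiftSetoid_iff {p q : G.ClosedPath} :
    shiftSetoid G p q ↔ ∃ j, q = ClosedPath.shift^[j] p := by
  constructor
  · intro h
    change Relation.EqvGen _ p q at h
    induction h with
    | rel p q h => exact ⟨1, h⟩
    | refl p => exact ⟨0, rfl⟩
    | symm p q _ ih =>
      obtain ⟨j, rfl⟩ := ih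
      have h1 : ∀ k, ClosedPath.shift^[k * p.2.length] p = p := fun k =>
        (show Function.IsPeriodicPt ClosedPath.shift p.2.length p from
          shift_iterate_length p).const_mul k
      rcases Nat.eq_zero_or_pos p.2.length with h | h
      · obtain ⟨x, p⟩ := p
        cases p with
        | nil =>
          refine ⟨0, ?_⟩
          have : ClosedPath.shift (⟨x, .nil⟩ : G.ClosedPath) = ⟨x, .nil⟩ := rfl
          exact (Function.iterate_fixed this j).symm
        | cons a q => simp at h
      -- Completes the `j` shifts to a multiple of the length, which acts trivially.
      · refine ⟨j * p.2.length - j, ?_⟩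
        rw [← Function.iterate_add_apply, Nat.sub_add_cancel (Nat.le_mul_of_pos_right j h), h1]
    | trans p q r _ _ ih₁ ih₂ =>
      obtain ⟨j, rfl⟩ := ih₁
      obtain ⟨k, rfl⟩ := ih₂
      exact ⟨k + j, (Function.iterate_add_apply _ _ _ _).symm⟩
  · rintro ⟨j, rfl⟩
    induction j with
    | zero => exact (shiftSetoid G).refl' _
    | succ j ih =>
      refine (shiftSetoid G).trans' ih ?_
      rw [Function.iterate_succ_apply']
      exact Relation.EqvGen.rel _ _ rfl

theorem length_walkPower {x : V} (p : G.Walk x x) (k : ℕ) :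
    (walkPower p k).length = k * p.length := by
  induction k with
  | zero => simp [walkPower]
  | succ k ih => rw [walkPower, Walk.length_append, ih]; ring

/-- A path and its powers have the same periodic sequence. This translates being a proper power into
having a period smaller than the length. -/
theorem Codes.power {p : G.ClosedPath} {f : ℕ → G.Dart} (h : Codes p f) (k : ℕ) :
    Codes (p.power k) f := by
  have hlen : (p.power k).2.length = k * p.2.length := length_walkPower p.2 k
  have hper : ∀ j i, f (i + j * p.2.length) = f i := fun j =>
    isPeriodicPt_seqShift_iff.1 (h.isPeriodicPt.const_mul j)
  refine ⟨?_, fun i => by rw [hlen, hper]⟩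
  rw [hlen]
  change (walkPower p.2 k).darts = _
  clear hlen
  induction k with
  | zero => simp [walkPower]
  | succ k ih =>
    rw [walkPower, Walk.darts_append, ih, h.darts_eq, add_mul, one_mul, add_comm, List.range_add,
      List.map_append, List.map_map]
    congr 1
    refine List.map_congr_left fun i _ => ?_
    rw [Function.comp_apply, add_comm, h.periodic]

theorem exists_walk_of_chain {f : ℕ → G.Dart} (hf : ∀ i, (f i).snd = (f (i + 1)).fst) (n : ℕ) :
    ∃ p : G.Walk (f 0).fst (f n).fst, p.darts = (List.range n).map f := by
  induction n generalizing f with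
  | zero => exact ⟨.nil, rfl⟩
  | succ n ih =>
    obtain ⟨p, hp⟩ : ∃ p : G.Walk (f 1).fst (f (n + 1)).fst,
        p.darts = (List.range n).map (seqShift f) := ih (f := seqShift f) fun i => hf (i + 1)
    refine ⟨.cons (f 0).adj (p.copy (hf 0).symm rfl), ?_⟩
    rw [Walk.darts_cons, Walk.darts_copy, hp, List.range_succ_eq_map, List.map_cons, List.map_map]
    rfl

theorem exists_codes_of_chain {f : ℕ → G.Dart} (hf : ∀ i, (f i).snd = (f (i + 1)).fst) {n : ℕ}
    (hn : ∀ i, f (i + n) = f i) : ∃ p : G.ClosedPath, p.2.length = n ∧ Codes p f := by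
  obtain ⟨p, hp⟩ := exists_walk_of_chain hf n
  have h1 : (f n).fst = (f 0).fst := by rw [← hn 0, zero_add]
  have h2 : (p.copy rfl h1).darts = (List.range n).map f := by rw [Walk.darts_copy, hp]
  have h3 : (p.copy rfl h1).length = n := by rw [← Walk.length_darts, h2]; simp
  exact ⟨⟨_, p.copy rfl h1⟩, h3, by rw [h3]; exact h2, by rw [h3]; exact hn⟩

theorem Codes.fst_eq_getVert {p : G.ClosedPath} {f : ℕ → G.Dart} (h : Codes p f) {i : ℕ}
    (hi : i < p.2.length) : (f i).fst = p.2.getVert i ∧ (f i).snd = p.2.getVert (i + 1) := by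
  have hi' : i < p.2.darts.length := by rwa [Walk.length_darts]
  rw [← h.getElem hi', Walk.darts_getElem_eq_getVert]
  exact ⟨rfl, rfl⟩

/-- A closed path of length one would be a loop edge, and the graph is simple. -/
theorem Codes.two_le {p : G.ClosedPath} {f : ℕ → G.Dart} (h : Codes p f) (hp : 0 < p.2.length) :
    2 ≤ p.2.length := by
  by_contra hlt
  have h1 : p.2.length = 1 := by omega
  obtain ⟨h2, h3⟩ := h.fst_eq_getVert hp
  have h4 : p.2.getVert (0 + 1) = p.1 := by
    rw [zero_add, ← h1]
    exact p.2.getVert_length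
  rw [h4] at h3
  rw [Walk.getVert_zero] at h2
  exact (f 0).adj.ne (h2.trans h3.symm)

/-- Shifting `j` times moves the edges `j`, `j + 1` to the positions `0`, `1`, so the passage from
the end of the path to its beginning needs no separate treatment. -/
theorem Codes.chain {p : G.ClosedPath} {f : ℕ → G.Dart} (h : Codes p f) (hp : 0 < p.2.length)
    (j : ℕ) : (f j).snd = (f (j + 1)).fst := by
  have h1 := h.shift_iterate j
  have h2 : 0 < (ClosedPath.shift^[j] p).2.length := by rwa [length_shift_iterate]
  have h3 := (h1.fst_eq_getVert h2).2.trans (h1.fst_eq_getVert (h1.two_le h2)).1.symm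
  rw [seqShift_iterate_apply, seqShift_iterate_apply] at h3
  simpa [add_comm] using h3

theorem Codes.isReduced_iff {p : G.ClosedPath} {f : ℕ → G.Dart} (h : Codes p f) :
    p.IsReduced ↔ ∀ i, i + 2 ≤ p.2.length → (f i).fst ≠ (f (i + 1)).snd := by
  refine forall₂_congr fun i hi => ?_
  rw [(h.fst_eq_getVert (by omega)).1, (h.fst_eq_getVert (by omega)).2]

/-- Reducedness of every shift, rather than of `p` alone, excludes a backtracking where the path
closes up. -/
theorem Codes.nonBacktracking {p : G.ClosedPath} {f : ℕ → G.Dart} (h : Codes p f)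
    (hp : 0 < p.2.length) (hr : ∀ j, IsReduced (ClosedPath.shift^[j] p)) (j : ℕ) :
    (f j).NonBacktracking (f (j + 1)) := by
  refine ⟨h.chain hp j, ?_⟩
  have h1 := h.shift_iterate j
  have h2 : 0 < (ClosedPath.shift^[j] p).2.length := by rwa [length_shift_iterate]
  have h3 := h1.isReduced_iff.1 (hr j) 0 (h1.two_le h2)
  rw [seqShift_iterate_apply, seqShift_iterate_apply] at h3
  simpa [add_comm] using h3

end ClosedPath

namespace PrimeCycle

open ClosedPath

theorem mk_path (c : G.PrimeCycle) : Quotient.mk (shiftSetoid G) c.path = c.1 := Quotient.out_eq _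

theorem mk_shift_iterate (c : G.PrimeCycle) (j : ℕ) :
    Quotient.mk (shiftSetoid G) (shift^[j] c.path) = c.1 := by
  rw [← mk_path]
  exact Quotient.sound ((shiftSetoid G).symm' (shiftSetoid_iff.2 ⟨j, rfl⟩))

theorem length_pos (c : G.PrimeCycle) : 0 < c.path.2.length := (c.2 _ c.mk_path).1

/-- The periodic sequence of oriented edges of a prime cycle. -/
noncomputable def seq (c : G.PrimeCycle) : ℕ → G.Dart := (exists_codes c.length_pos).choose

theorem codes_seq (c : G.PrimeCycle) : Codes c.path c.seq := (exists_codes c.length_pos).choose_spec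

theorem nonBacktracking_seq (c : G.PrimeCycle) (i : ℕ) :
    (c.seq i).NonBacktracking (c.seq (i + 1)) :=
  c.codes_seq.nonBacktracking c.length_pos (fun j => (c.2 _ (c.mk_shift_iterate j)).2.1) i

theorem seq_mem_periodicPts (c : G.PrimeCycle) : c.seq ∈ Function.periodicPts seqShift :=
  ⟨_, c.length_pos, c.codes_seq.isPeriodicPt⟩

/-- The edges within one minimal period form a closed path of which the given one is a power;
primality forces the exponent `1`. -/
theorem minimalPeriod_seq (c : G.PrimeCycle) :
    Function.minimalPeriod seqShift c.seq = c.path.2.length := by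
  obtain ⟨k, hk⟩ := c.codes_seq.isPeriodicPt.minimalPeriod_dvd
  obtain ⟨q, hq, hq'⟩ := exists_codes_of_chain (f := c.seq) (fun i => (c.nonBacktracking_seq i).1)
    (isPeriodicPt_seqShift_iff.1 (Function.isPeriodicPt_minimalPeriod seqShift c.seq))
  have hlen : c.path.2.length = (q.power k).2.length := by
    rw [hk, ← hq, mul_comm]
    exact (length_walkPower q.2 k).symm
  have h1 := c.codes_seq.path_unique (hq'.power k) hlen c.length_pos
  have h2 := (c.2 _ c.mk_path).2.2 q k h1
  rw [hk, h2, mul_one]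

theorem eq_of_shift_seq_eq {c c' : G.PrimeCycle} {j j' : ℕ}
    (h : seqShift^[j] c.seq = seqShift^[j'] c'.seq) : c = c' := by
  have hl : c.path.2.length = c'.path.2.length := by
    rw [← minimalPeriod_seq, ← minimalPeriod_seq,
      ← Function.minimalPeriod_apply_iterate c.seq_mem_periodicPts j, h,
      Function.minimalPeriod_apply_iterate c'.seq_mem_periodicPts]
  have h1 := c.codes_seq.shift_iterate j
  rw [h] at h1
  have h2 := h1.path_unique (c'.codes_seq.shift_iterate j')
    (by rw [length_shift_iterate, length_shift_iterate, hl])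
    (by rw [length_shift_iterate]; exact c.length_pos)
  refine Subtype.ext ?_
  rw [← c.mk_shift_iterate j, h2, c'.mk_shift_iterate]

/-- The closed path that runs through one minimal period of `f` represents the prime cycle sought,
and every period of `f` is a multiple of the minimal one. -/
theorem exists_shift_seq_eq {f : ℕ → G.Dart} (hf : ∀ i, (f i).NonBacktracking (f (i + 1)))
    {n : ℕ} (hn : 0 < n) (hper : Function.IsPeriodicPt seqShift n f) :
    ∃ (c : G.PrimeCycle) (j k : ℕ), j < c.path.2.length ∧ f = seqShift^[j] c.seq ∧
      n = c.path.2.length * (k + 1) := by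
  set m := Function.minimalPeriod seqShift f with hm
  have hm0 : 0 < m := hper.minimalPeriod_pos hn
  have hmem : f ∈ Function.periodicPts seqShift := ⟨n, hn, hper⟩
  obtain ⟨p, hp, hpf⟩ := exists_codes_of_chain (f := f) (fun i => (hf i).1)
    (isPeriodicPt_seqShift_iff.1 (Function.isPeriodicPt_minimalPeriod seqShift f))
  rw [← hm] at hp
  have hprime : ∀ p' : G.ClosedPath, Quotient.mk (shiftSetoid G) p' = Quotient.mk _ p →
      0 < p'.2.length ∧ p'.IsReduced ∧ ∀ (q : G.ClosedPath) (k : ℕ), p' = q.power k → k = 1 := by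
    intro p' h
    obtain ⟨j, rfl⟩ := shiftSetoid_iff.1 ((shiftSetoid G).symm' (Quotient.exact h))
    have hc := hpf.shift_iterate j
    have hl : (shift^[j] p).2.length = m := by rw [length_shift_iterate, hp]
    refine ⟨by rwa [hl], hc.isReduced_iff.2 fun i _ => ?_, fun q k hq => ?_⟩
    · rw [seqShift_iterate_apply, seqShift_iterate_apply, add_right_comm]
      exact (hf _).2
    -- The length of a `k`-th root `q` would be a period, hence at least `m`; this excludes `k ≥ 2`.
    · have hl' : m = k * q.2.length := by
        rw [← hl, hq]
        exact length_walkPower q.2 k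
      have hq0 : 0 < q.2.length := Nat.pos_of_ne_zero fun h0 => by simp [h0] at hl'; omega
      obtain ⟨g, hg⟩ := exists_codes hq0
      have h1 := hg.power k
      rw [← hq] at h1
      have h2 := h1.seq_unique (by rwa [hl]) hc
      have h3 := hg.isPeriodicPt.minimalPeriod_dvd
      rw [h2, Function.minimalPeriod_apply_iterate hmem, ← hm] at h3
      have h4 := Nat.le_of_dvd hq0 h3
      have hk0 : k ≠ 0 := fun h0 => by simp [h0] at hl'; omega
      by_contra hk1
      have h5 : 2 ≤ k := by omega
      nlinarith
  let c : G.PrimeCycle := ⟨Quotient.mk _ p, hprime⟩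
  obtain ⟨j, hj⟩ := shiftSetoid_iff.1 (Quotient.exact c.mk_path)
  have h1 := c.codes_seq.shift_iterate j
  rw [← hj] at h1
  have h2 : f = seqShift^[j] c.seq := hpf.seq_unique (by rwa [hp]) h1
  have h3 : c.path.2.length = m := by rw [← hp, hj, length_shift_iterate]
  obtain ⟨k, hk⟩ := hper.minimalPeriod_dvd
  rw [← hm] at hk
  have hk0 : k ≠ 0 := fun h0 => by simp [h0] at hk; omega
  refine ⟨c, j % c.path.2.length, k - 1, Nat.mod_lt _ c.length_pos, ?_, ?_⟩
  · rw [c.codes_seq.isPeriodicPt.iterate_mod_apply, h2]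
  · rw [h3, hk, Nat.sub_add_cancel (Nat.one_le_iff_ne_zero.2 hk0)]

end PrimeCycle

end SimpleGraph

/-! ### The Euler product of a matrix supported on non-backtracking pairs -/

theorem Fin.isPeriodicPt_cyclicSeq {α : Type*} {n : ℕ} (g : Fin (n + 1) → α) :
    Function.IsPeriodicPt seqShift (n + 1) (Fin.cyclicSeq g) := by
  refine isPeriodicPt_seqShift_iff.2 fun i => congrArg g (Fin.ext ?_)
  simp [Fin.ofNat]

theorem Fin.cyclicSeq_restrict {α : Type*} {n : ℕ} {f : ℕ → α}
    (hf : Function.IsPeriodicPt seqShift (n + 1) f) :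
    Fin.cyclicSeq (fun i : Fin (n + 1) => f i) = f := by
  funext i
  have h := congrFun (hf.iterate_mod_apply i) 0
  rw [seqShift_iterate_apply, seqShift_iterate_apply, zero_add, zero_add] at h
  exact h

namespace Matrix

variable {ι κ : Type*} [Fintype κ] [DecidableEq κ]

theorem trace_pathProd_shift (B : Matrix ι ι (Matrix κ κ ℂ)) {f : ℕ → ι} {n : ℕ}
    (hf : Function.IsPeriodicPt seqShift n f) :
    (pathProd B (seqShift f) n).trace = (pathProd B f n).trace := by
  cases n with
  | zero => rfl
  | succ n =>
    have h := isPeriodicPt_seqShift_iff.1 hf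
    have h1 : pathProd B f (n + 1) = pathProd B (seqShift f) n * B (f 1) (f 0) := by
      rw [add_comm, pathProd_add, pathProd, pathProd, mul_one]
      congr 2
      funext k
      rw [add_comm]
      rfl
    have h2 : pathProd B (seqShift f) (n + 1) = B (f 1) (f 0) * pathProd B (seqShift f) n := by
      rw [pathProd]
      congr 2
      · change f (n + 1 + 1) = _
        rw [add_comm, h 1]
      · exact (h 0 ▸ congrArg f (zero_add _).symm)
    rw [h1, h2, trace_mul_comm]

theorem trace_pathProd_shift_iterate (B : Matrix ι ι (Matrix κ κ ℂ)) {f : ℕ → ι} {n : ℕ}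
    (hf : Function.IsPeriodicPt seqShift n f) (j : ℕ) :
    (pathProd B (seqShift^[j] f) n).trace = (pathProd B f n).trace := by
  induction j with
  | zero => rfl
  | succ j ih =>
    rw [Function.iterate_succ_apply', trace_pathProd_shift B (hf.apply_iterate j), ih]

theorem pathProd_eq_zero {B : Matrix ι ι (Matrix κ κ ℂ)} {f : ℕ → ι} {n k : ℕ} (hk : k < n)
    (h : B (f (k + 1)) (f k) = 0) : pathProd B f n = 0 := by
  obtain ⟨m, rfl⟩ := Nat.exists_eq_add_of_lt hk
  rw [add_assoc, add_comm m 1, ← add_assoc, pathProd_add, pathProd, h, zero_mul, mul_zero]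

end Matrix

namespace SimpleGraph.PrimeCycle

open Matrix

variable {V : Type u} {G : SimpleGraph V} {κ : Type*} [Fintype κ] [DecidableEq κ]

/-- The tuple that runs `k + 1` times through a prime cycle, starting at its `j`-th edge. -/
noncomputable def tuple (x : Σ _ : (Σ c : G.PrimeCycle, Fin c.path.2.length), ℕ) :
    Σ n : ℕ, Fin (n + 1) → G.Dart :=
  ⟨x.1.1.path.2.length * (x.2 + 1) - 1, fun i => seqShift^[x.1.2] x.1.1.seq i⟩

theorem tuple_fst_add_one (x : Σ _ : (Σ c : G.PrimeCycle, Fin c.path.2.length), ℕ) :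
    (tuple x).1 + 1 = x.1.1.path.2.length * (x.2 + 1) :=
  Nat.sub_add_cancel (Nat.mul_pos x.1.1.length_pos (Nat.succ_pos _))

theorem cyclicSeq_tuple (x : Σ _ : (Σ c : G.PrimeCycle, Fin c.path.2.length), ℕ) :
    Fin.cyclicSeq (tuple x).2 = seqShift^[x.1.2] x.1.1.seq := by
  have h : Function.IsPeriodicPt seqShift ((tuple x).1 + 1) (seqShift^[x.1.2] x.1.1.seq) := by
    rw [tuple_fst_add_one]
    exact (x.1.1.codes_seq.isPeriodicPt.mul_const _).apply_iterate _
  exact Fin.cyclicSeq_restrict h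

/-- The periodic extension of the tuple determines the cycle, and also the starting index because
this is below the minimal period; the arity then determines the number of repetitions. -/
theorem tuple_injective : Function.Injective (tuple (G := G)) := by
  rintro ⟨⟨c, j⟩, k⟩ ⟨⟨c', j'⟩, k'⟩ h
  have h1 : seqShift^[j] c.seq = seqShift^[j'] c'.seq := by
    have := congrArg (fun p : Σ n : ℕ, Fin (n + 1) → G.Dart => Fin.cyclicSeq p.2) h
    simpa only [cyclicSeq_tuple] using this
  obtain rfl := eq_of_shift_seq_eq h1
  have h2 : (j : ℕ) = j' := by
    refine Function.iterate_injOn_Iio_minimalPeriod (f := seqShift) (x := c.seq) ?_ ?_ h1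
    · rw [minimalPeriod_seq]
      exact j.2
    · rw [minimalPeriod_seq]
      exact j'.2
  obtain rfl := Fin.ext h2
  have h3 := congrArg (fun p : Σ n : ℕ, Fin (n + 1) → G.Dart => p.1 + 1) h
  simp only [tuple_fst_add_one] at h3
  have h4 := Nat.eq_of_mul_eq_mul_left c.length_pos h3
  obtain rfl : k = k' := by omega
  rfl

theorem closedTerm_tuple (B : Matrix G.Dart G.Dart (Matrix κ κ ℂ))
    (x : Σ _ : (Σ c : G.PrimeCycle, Fin c.path.2.length), ℕ) :
    closedTerm B (tuple x) = (pathProd B x.1.1.seq x.1.1.path.2.length ^ (x.2 + 1)).trace /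
      (x.2 + 1 : ℂ) / x.1.1.path.2.length := by
  have h : ((tuple x).1 : ℂ) + 1 = x.1.1.path.2.length * (x.2 + 1) := by
    exact_mod_cast tuple_fst_add_one x
  rw [closedTerm, h, tuple_fst_add_one, cyclicSeq_tuple,
    trace_pathProd_shift_iterate B (x.1.1.codes_seq.isPeriodicPt.mul_const _),
    pathProd_mul B (fun k => by rw [add_comm]; exact x.1.1.codes_seq.periodic k), div_div,
    mul_comm (x.1.1.path.2.length : ℂ)]

theorem closedTerm_eq_zero {B : Matrix G.Dart G.Dart (Matrix κ κ ℂ)}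
    (h0 : ∀ d e : G.Dart, ¬ d.NonBacktracking e → B e d = 0) {p : Σ n : ℕ, Fin (n + 1) → G.Dart}
    (hp : p ∉ Set.range (tuple (G := G))) : closedTerm B p = 0 := by
  by_contra hne
  obtain ⟨n, g⟩ := p
  have hper := Fin.isPeriodicPt_cyclicSeq g
  have hNB : ∀ i, (Fin.cyclicSeq g i).NonBacktracking (Fin.cyclicSeq g (i + 1)) := by
    intro i
    by_contra hi
    refine hne ?_
    -- Moves the forbidden transition into the first period, where it is a factor of the product.
    have h2 : ∀ k, Fin.cyclicSeq g (i % (n + 1) + k) = Fin.cyclicSeq g (i + k) := fun k => by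
      have := congrFun (hper.iterate_mod_apply i) k
      rwa [seqShift_iterate_apply, seqShift_iterate_apply, add_comm k, add_comm k] at this
    have h3 : pathProd B (Fin.cyclicSeq g) (n + 1) = 0 := by
      refine pathProd_eq_zero (Nat.mod_lt i (Nat.succ_pos n)) ?_
      have h4 := h2 0
      rw [add_zero, add_zero] at h4
      rw [h2, h4]
      exact h0 _ _ hi
    rw [closedTerm, h3, trace_zero, zero_div]
  obtain ⟨c, j, k, hj, hf, hn⟩ := exists_shift_seq_eq hNB (Nat.succ_pos n) hper
  obtain rfl : n = c.path.2.length * (k + 1) - 1 := by omega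
  refine hp ⟨⟨⟨c, ⟨j, hj⟩⟩, k⟩, ?_⟩
  unfold tuple
  congr 1
  funext i
  rw [← hf, Fin.cyclicSeq_val]

/-- Here the sum over closed sequences is regrouped by prime cycle. Condition `h1` gives absolute
convergence and bounds the entries of the product along a prime cycle by `card κ * ∑ a i`; `h2` then
puts the eigenvalues of that product inside the unit disc, as the logarithm series requires. -/
theorem exists_hasSum_log {B : Matrix G.Dart G.Dart (Matrix κ κ ℂ)}
    (h0 : ∀ d e : G.Dart, ¬ d.NonBacktracking e → B e d = 0) {a : G.Dart → ℝ}
    (hB : ∀ i j k l, ‖B i j k l‖ ≤ a i) (ha : ∀ i, 0 ≤ a i) (hs : Summable a)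
    (h1 : Fintype.card κ * ∑' i, a i < 1)
    (h2 : Fintype.card κ * (Fintype.card κ * ∑' i, a i) < 1) :
    ∃ s : G.PrimeCycle → ℂ, HasSum s (∑' p, closedTerm B p) ∧
      ∀ c : G.PrimeCycle, (1 - pathProd B c.seq c.path.2.length).det = Complex.exp (-s c) := by
  have hroot : ∀ c : G.PrimeCycle,
      ∀ z ∈ (pathProd B c.seq c.path.2.length).charpoly.roots, ‖z‖ < 1 := by
    intro c z hz
    have h3 : ∀ k l, ‖pathProd B c.seq c.path.2.length k l‖ ≤ Fintype.card κ * ∑' i, a i := by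
      intro k l
      refine (norm_pathProd_apply_le hB ha _ _ _ _).trans ?_
      have h4 : ∀ i, 0 ≤ Fintype.card κ * a i := fun i => mul_nonneg (Nat.cast_nonneg _) (ha i)
      have h5 : ∀ i, Fintype.card κ * a i ≤ Fintype.card κ * ∑' i, a i := fun i =>
        mul_le_mul_of_nonneg_left (hs.le_tsum i fun j _ => ha j) (Nat.cast_nonneg _)
      obtain ⟨l, hl⟩ := Nat.exists_eq_succ_of_ne_zero c.length_pos.ne'
      rw [hl, Finset.prod_range_succ]
      calc _ ≤ 1 * (Fintype.card κ * ∑' i, a i) :=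
            mul_le_mul (Finset.prod_le_one (fun i _ => h4 _) fun i _ => (h5 _).trans h1.le)
              (h5 _) (h4 _) zero_le_one
        _ = _ := one_mul _
    refine lt_of_le_of_lt (norm_root_charpoly_le h3 hz) ?_
    simpa using h2
  choose s hs' hdet using fun c : G.PrimeCycle => hasSum_trace_pow_div (hroot c)
  refine ⟨s, ?_, hdet⟩
  have hsum := (summable_closedTerm hB ha hs h1).of_norm.hasSum
  rw [← tuple_injective.hasSum_iff fun p hp => closedTerm_eq_zero h0 hp] at hsum
  have h3 := hsum.sigma (g := fun x => s x.1 / x.1.path.2.length) fun x =>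
    ((hs' x.1).div_const _).congr_fun fun k => closedTerm_tuple B ⟨x, k⟩
  refine h3.sigma fun c => ?_
  have h4 := hasSum_fintype fun _ : Fin c.path.2.length => s c / c.path.2.length
  have h5 : (c.path.2.length : ℂ) ≠ 0 := by exact_mod_cast c.length_pos.ne'
  simpa [mul_div_cancel₀ _ h5] using h4

theorem hasProd_det_inv {B : Matrix G.Dart G.Dart (Matrix κ κ ℂ)}
    (h0 : ∀ d e : G.Dart, ¬ d.NonBacktracking e → B e d = 0) {a : G.Dart → ℝ}
    (hB : ∀ i j k l, ‖B i j k l‖ ≤ a i) (ha : ∀ i, 0 ≤ a i) (hs : Summable a)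
    (h1 : Fintype.card κ * ∑' i, a i < 1)
    (h2 : Fintype.card κ * (Fintype.card κ * ∑' i, a i) < 1) :
    (∀ c : G.PrimeCycle, (1 - pathProd B c.seq c.path.2.length).det ≠ 0) ∧
      (comp G.Dart G.Dart κ κ ℂ B).fredholmDet ≠ 0 ∧
      HasProd (fun c : G.PrimeCycle => (1 - pathProd B c.seq c.path.2.length).det⁻¹)
        (comp G.Dart G.Dart κ κ ℂ B).fredholmDet⁻¹ := by
  obtain ⟨s, hsum, hdet⟩ := exists_hasSum_log h0 hB ha hs h1 h2
  rw [fredholmDet_comp_eq_exp hB ha hs h1]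
  refine ⟨fun c => ?_, Complex.exp_ne_zero _, ?_⟩
  · rw [hdet]
    exact Complex.exp_ne_zero _
  · simp only [hdet, ← Complex.exp_neg, neg_neg]
    exact hsum.cexp

end SimpleGraph.PrimeCycle

/-! ### The non-backtracking matrix of a representation of the fundamental group -/

namespace WeightedGraph

open Matrix

variable {V : Type u} (X : WeightedGraph V) (x₀ : V)

/-- The path from the base point to `x` used in the definition of `loopClass`. -/
noncomputable def basePath (x : V) : X.graph.Walk x₀ x :=
  Classical.choice (X.connected.preconnected x₀ x)

/-- The class of the loop obtained by joining the end points of a path to the base point. -/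
noncomputable def pathClass {x y : V} (p : X.graph.Walk x y) : X.graph.FundGroup x₀ :=
  .mk ((X.basePath x₀ x).append (p.append (X.basePath x₀ y).reverse))

theorem loopClass_eq (p : X.graph.ClosedPath) : X.loopClass x₀ p = X.pathClass x₀ p.2 := rfl

theorem pathClass_nil (x : V) : X.pathClass x₀ (.nil : X.graph.Walk x x) = 1 :=
  SimpleGraph.FundGroup.mk_eq (.append_reverse _)

/-- The detour from `y` to the base point and back is null-homotopic; the factors appear reversed
because of the convention for the group law. -/
theorem pathClass_append {x y z : V} (p : X.graph.Walk x y) (q : X.graph.Walk y z) :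
    X.pathClass x₀ (p.append q) = X.pathClass x₀ q * X.pathClass x₀ p := by
  simp only [pathClass, SimpleGraph.FundGroup.mk_mul_mk]
  refine SimpleGraph.FundGroup.mk_eq ?_
  simp only [SimpleGraph.Walk.append_assoc]
  simp only [← SimpleGraph.Walk.append_assoc (X.basePath x₀ x)]
  refine .append_left _ ?_
  have := (SimpleGraph.WalkHomotopic.reverse_append (X.basePath x₀ y)).symm.append_right
    (q.append (X.basePath x₀ z).reverse)
  simpa only [SimpleGraph.Walk.append_assoc, SimpleGraph.Walk.nil_append] using
    SimpleGraph.WalkHomotopic.append_left p this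

theorem pathClass_cons {x y z : V} (h : X.graph.Adj x y) (q : X.graph.Walk y z) :
    X.pathClass x₀ (.cons h q) = X.pathClass x₀ q * X.pathClass x₀ h.toWalk :=
  X.pathClass_append x₀ h.toWalk q

variable {X x₀} {E : Type v} [NormedAddCommGroup E] [InnerProductSpace ℂ E] [FiniteDimensional ℂ E]

/-- The matrix of a unitary map in the standard orthonormal basis. -/
noncomputable def unitaryMatrix (U : E ≃ₗᵢ[ℂ] E) :
    Matrix (Fin (Module.finrank ℂ E)) (Fin (Module.finrank ℂ E)) ℂ :=
  LinearMap.toMatrix (stdOrthonormalBasis ℂ E).toBasis (stdOrthonormalBasis ℂ E).toBasis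
    (U.toLinearEquiv : E →ₗ[ℂ] E)

theorem unitaryMatrix_apply (U : E ≃ₗᵢ[ℂ] E) (i j : Fin (Module.finrank ℂ E)) :
    unitaryMatrix U i j = ⟪stdOrthonormalBasis ℂ E i, U (stdOrthonormalBasis ℂ E j)⟫_ℂ := by
  simp [unitaryMatrix, LinearMap.toMatrix_apply, OrthonormalBasis.repr_apply_apply]

theorem norm_unitaryMatrix_le (U : E ≃ₗᵢ[ℂ] E) (i j : Fin (Module.finrank ℂ E)) :
    ‖unitaryMatrix U i j‖ ≤ 1 := by
  rw [unitaryMatrix_apply]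
  refine (norm_inner_le_norm _ _).trans ?_
  simp

theorem unitaryMatrix_mul (U U' : E ≃ₗᵢ[ℂ] E) :
    unitaryMatrix (U * U') = unitaryMatrix U * unitaryMatrix U' :=
  LinearMap.toMatrix_comp _ _ _ _ _

theorem unitaryMatrix_one : unitaryMatrix (1 : E ≃ₗᵢ[ℂ] E) = 1 :=
  LinearMap.toMatrix_id _

variable (τ : X.graph.FundGroup x₀ →* (E ≃ₗᵢ[ℂ] E))

/-- The parallel transport along an oriented edge in the trivialisation given by the base paths. -/
noncomputable def edgeUnitary (e : X.graph.Dart) : E ≃ₗᵢ[ℂ] E := τ (X.pathClass x₀ e.adj.toWalk)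

open Classical in
/-- The weighted non-backtracking matrix, with blocks given by the parallel transports. -/
noncomputable def edgeMatrix (s : ℂ) : Matrix X.graph.Dart X.graph.Dart
    (Matrix (Fin (Module.finrank ℂ E)) (Fin (Module.finrank ℂ E)) ℂ) :=
  .of fun e' e => if e.NonBacktracking e' then (s * X.weight e' : ℂ) • unitaryMatrix (edgeUnitary τ e)
    else 0

theorem norm_edgeMatrix_le (s : ℂ) (e' e : X.graph.Dart) (i j : Fin (Module.finrank ℂ E)) :
    ‖edgeMatrix τ s e' e i j‖ ≤ ‖s‖ * X.weight e' := by
  have hw := (X.weight_pos e').le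
  rw [edgeMatrix, of_apply]
  split_ifs
  · rw [Matrix.smul_apply, norm_smul, norm_mul, Complex.norm_real, Real.norm_of_nonneg hw]
    exact mul_le_of_le_one_right (by positivity) (norm_unitaryMatrix_le _ _ _)
  · rw [Matrix.zero_apply, norm_zero]
    positivity

/-- A transition from `e` to `e'` carries the transport along `e` but the weight of `e'`. So the
transports are those of `p`, whereas the weights are shifted by one and include the edge following
`p`. -/
theorem pathProd_edgeMatrix (s : ℂ) {x y : V} (p : X.graph.Walk x y) {f : ℕ → X.graph.Dart}
    (hf : ∀ i, (f i).NonBacktracking (f (i + 1))) (hp : p.darts = (List.range p.length).map f) :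
    pathProd (edgeMatrix τ s) f p.length =
      (s ^ p.length * ∏ k ∈ Finset.range p.length, (X.weight (f (k + 1)) : ℂ)) •
        unitaryMatrix (τ (X.pathClass x₀ p)) := by
  induction p generalizing f with
  | nil => simp [pathProd, pathClass_nil, unitaryMatrix_one]
  | cons h q ih =>
    simp only [SimpleGraph.Walk.darts_cons, SimpleGraph.Walk.length_cons, List.range_succ_eq_map,
      List.map_cons, List.map_map, List.cons.injEq] at hp
    have h1 := ih (f := seqShift f) (fun i => hf (i + 1)) hp.2
    have h2 : (fun k => f (1 + k)) = seqShift f := funext fun k => congrArg f (add_comm _ _)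
    rw [SimpleGraph.Walk.length_cons, add_comm, pathProd_add, h2, h1, pathProd, pathProd, mul_one,
      edgeMatrix, of_apply, if_pos (hf 0), pathClass_cons, map_mul, unitaryMatrix_mul,
      smul_mul_smul_comm]
    have h3 : edgeUnitary τ (f 0) = τ (X.pathClass x₀ h.toWalk) := by rw [← hp.1]; rfl
    rw [h3, add_comm 1, Finset.prod_range_succ']
    congr 1
    simp only [seqShift, zero_add]
    ring

theorem eulerDet_eq_det (s : ℂ) (c : X.graph.PrimeCycle) :
    X.eulerDet τ s c.path = (1 - pathProd (edgeMatrix τ s) c.seq c.path.2.length).det := by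
  have h1 : (X.walkWeight c.path.2 : ℂ) =
      ∏ k ∈ Finset.range c.path.2.length, (X.weight (c.seq (k + 1)) : ℂ) := by
    have h2 : ∀ n : ℕ, (((List.range n).map c.seq).map X.weight).prod =
        ∏ k ∈ Finset.range n, X.weight (c.seq k) := by
      intro n
      induction n with
      | zero => rfl
      | succ n ih =>
        rw [List.range_succ, List.map_append, List.map_append, List.prod_append, ih,
          Finset.prod_range_succ]
        simp
    rw [walkWeight, c.codes_seq.darts_eq, h2]
    push_cast
    -- Periodicity absorbs the shift of the weights by one.
    obtain ⟨l, hl⟩ := Nat.exists_eq_succ_of_ne_zero c.length_pos.ne'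
    have h3 := c.codes_seq.periodic 0
    rw [hl, zero_add] at h3
    rw [hl, Finset.prod_range_succ', Finset.prod_range_succ, ← h3]
  rw [pathProd_edgeMatrix τ s c.path.2 c.nonBacktracking_seq c.codes_seq.darts_eq, eulerDet, ← h1,
    ← LinearMap.det_toMatrix (stdOrthonormalBasis ℂ E).toBasis, map_sub, map_smul,
    LinearMap.toMatrix_one, loopClass_eq, mul_comm]
  rfl

theorem hasProd_eulerDet {s : ℂ}
    (h1 : Module.finrank ℂ E * (‖s‖ * ∑' e, X.weight e) < 1)
    (h2 : Module.finrank ℂ E * (Module.finrank ℂ E * (‖s‖ * ∑' e, X.weight e)) < 1) :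
    (∀ c : X.graph.PrimeCycle, X.eulerDet τ s c.path ≠ 0) ∧
      (comp _ _ _ _ ℂ (edgeMatrix τ s)).fredholmDet ≠ 0 ∧
      HasProd (fun c : X.graph.PrimeCycle => (X.eulerDet τ s c.path)⁻¹)
        (comp _ _ _ _ ℂ (edgeMatrix τ s)).fredholmDet⁻¹ := by
  simp only [eulerDet_eq_det]
  refine SimpleGraph.PrimeCycle.hasProd_det_inv (a := fun e => ‖s‖ * X.weight e)
    (fun d e h => ?_) (norm_edgeMatrix_le τ s)
    (fun e => mul_nonneg (norm_nonneg _) (X.weight_pos e).le) (X.summable_weight.mul_left _) ?_ ?_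
  · rw [edgeMatrix, of_apply, if_neg h]
  · rwa [Fintype.card_fin, tsum_mul_left]
  · rwa [Fintype.card_fin, tsum_mul_left]

end WeightedGraph

/-! ### The determinant of the weighted flip -/

namespace WeightedGraph

open Matrix Filter Topology

variable {V : Type u} {X : WeightedGraph V} {x₀ : V}
variable {E : Type v} [NormedAddCommGroup E] [InnerProductSpace ℂ E] [FiniteDimensional ℂ E]
variable (τ : X.graph.FundGroup x₀ →* (E ≃ₗᵢ[ℂ] E))

omit [FiniteDimensional ℂ E] in
theorem edgeUnitary_symm_mul (e : X.graph.Dart) :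
    edgeUnitary τ e.symm * edgeUnitary τ e = 1 := by
  rw [edgeUnitary, edgeUnitary, ← map_mul, ← map_one τ]
  congr 1
  refine (X.pathClass_append x₀ e.adj.toWalk e.symm.adj.toWalk).symm.trans ?_
  rw [← X.pathClass_nil x₀ e.fst]
  refine SimpleGraph.FundGroup.mk_eq (.append_left _ (.append_right ?_ _))
  exact .backtrack e.adj .nil

open Classical in
/-- The matrix of the weighted flip of oriented edges, multiplied by `-s`. -/
noncomputable def flipMatrix (s : ℂ) : Matrix X.graph.Dart X.graph.Dart
    (Matrix (Fin (Module.finrank ℂ E)) (Fin (Module.finrank ℂ E)) ℂ) :=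
  .of fun e' e => if e' = e.symm then (-(s * X.weight e') : ℂ) • unitaryMatrix (edgeUnitary τ e)
    else 0

theorem norm_flipMatrix_le (s : ℂ) (e' e : X.graph.Dart) (i j : Fin (Module.finrank ℂ E)) :
    ‖flipMatrix τ s e' e i j‖ ≤ ‖s‖ * X.weight e' := by
  have hw := (X.weight_pos e').le
  rw [flipMatrix, of_apply]
  split_ifs
  · rw [Matrix.smul_apply, norm_smul, norm_neg, norm_mul, Complex.norm_real,
      Real.norm_of_nonneg hw]
    exact mul_le_of_le_one_right (by positivity) (norm_unitaryMatrix_le _ _ _)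
  · rw [Matrix.zero_apply, norm_zero]
    positivity

theorem summable_dart_prod (C : ℝ) (d : ℕ) :
    Summable fun p : X.graph.Dart × Fin d => C * X.weight p.1 := by
  refine Summable.mul_left C ?_
  rw [summable_prod_of_nonneg fun p => (X.weight_pos p.1).le]
  refine ⟨fun e => (hasSum_fintype _).summable, ?_⟩
  simpa using X.summable_weight.mul_left (d : ℝ)

theorem differentiable_fredholmDet_edgeMatrix :
    Differentiable ℂ fun s => (comp _ _ _ _ ℂ (edgeMatrix τ s)).fredholmDet := by
  have h : ∀ s, comp _ _ _ _ ℂ (edgeMatrix τ s) = s • comp _ _ _ _ ℂ (edgeMatrix τ 1) := by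
    intro s
    ext p q
    change edgeMatrix τ s p.1 q.1 p.2 q.2 = s * edgeMatrix τ 1 p.1 q.1 p.2 q.2
    rw [edgeMatrix, edgeMatrix, of_apply, of_apply]
    split_ifs
    · rw [one_mul, mul_smul, Matrix.smul_apply, smul_eq_mul]
    · simp
  rw [funext fun s => congrArg fredholmDet (h s)]
  exact differentiable_fredholmDet_smul (summable_dart_prod _ _)
    fun p q => norm_edgeMatrix_le τ 1 p.1 q.1 p.2 q.2

theorem differentiable_fredholmDet_flipMatrix :
    Differentiable ℂ fun s => (comp _ _ _ _ ℂ (flipMatrix τ s)).fredholmDet := by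
  have h : ∀ s, comp _ _ _ _ ℂ (flipMatrix τ s) = s • comp _ _ _ _ ℂ (flipMatrix τ 1) := by
    intro s
    ext p q
    change flipMatrix τ s p.1 q.1 p.2 q.2 = s * flipMatrix τ 1 p.1 q.1 p.2 q.2
    rw [flipMatrix, flipMatrix, of_apply, of_apply]
    split_ifs
    · rw [one_mul, ← mul_neg, mul_smul, Matrix.smul_apply, smul_eq_mul]
    · simp
  rw [funext fun s => congrArg fredholmDet (h s)]
  exact differentiable_fredholmDet_smul (summable_dart_prod _ _)
    fun p q => norm_flipMatrix_le τ 1 p.1 q.1 p.2 q.2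

theorem exists_dart (e : X.graph.edgeSet) : ∃ d : X.graph.Dart, d.edge = e := by
  obtain ⟨e, he⟩ := e
  induction e using Sym2.ind with
  | h x y => exact ⟨⟨(x, y), he⟩, rfl⟩

/-- An orientation of an edge. -/
noncomputable def orient (e : X.graph.edgeSet) : X.graph.Dart := (exists_dart e).choose

theorem orient_edge (e : X.graph.edgeSet) : (orient e).edge = e := (exists_dart e).choose_spec

theorem edgeWeight_eq (e : X.graph.edgeSet) :
    X.edgeWeight e = X.weight (orient e) * X.weight (orient e).symm := by
  rw [← X.edgeWeight_dart]
  congr 1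
  exact Subtype.ext (orient_edge e).symm

theorem orient_injective : Function.Injective (orient (X := X)) := fun e e' h =>
  Subtype.ext (by rw [← orient_edge e, ← orient_edge e', h])

theorem orient_ne_symm (e e' : X.graph.edgeSet) : orient e ≠ (orient e').symm := by
  intro h
  have h1 : e = e' := Subtype.ext (by
    rw [← orient_edge e, ← orient_edge e', h, SimpleGraph.Dart.edge_symm])
  rw [h1] at h
  exact (orient e').symm_ne h.symm

/-- The two orientations of the edges in a finite set. -/
noncomputable def orientations (A : Finset X.graph.edgeSet) (d : ℕ) :
    (A × Fin d) ⊕ (A × Fin d) ↪ X.graph.Dart × Fin d where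
  toFun := Sum.elim (fun p => (orient p.1.1, p.2)) fun p => ((orient p.1.1).symm, p.2)
  inj' := by
    rintro (⟨e, i⟩ | ⟨e, i⟩) (⟨e', i'⟩ | ⟨e', i'⟩) h <;>
      simp only [Sum.elim_inl, Sum.elim_inr, Prod.mk.injEq] at h
    · rw [Subtype.ext (orient_injective h.1), h.2]
    · exact absurd h.1 (orient_ne_symm _ _)
    · exact absurd h.1.symm (orient_ne_symm _ _)
    · rw [Subtype.ext (orient_injective (SimpleGraph.Dart.symm_involutive.injective h.1)), h.2]

theorem orientations_inl (A : Finset X.graph.edgeSet) (d : ℕ) (e : A) (i : Fin d) :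
    orientations A d (.inl (e, i)) = (orient e.1, i) := rfl

theorem orientations_inr (A : Finset X.graph.edgeSet) (d : ℕ) (e : A) (i : Fin d) :
    orientations A d (.inr (e, i)) = ((orient e.1).symm, i) := rfl

-- Listing one orientation of each edge before the opposite ones gives blocks `1, b; c, 1` with
-- determinant `det (1 - cb)`. The two transports along an edge cancel in `cb`, leaving the scalar
-- `s² W(e)` for each edge.
open Classical in
theorem det_flipMatrix_orientations (s : ℂ) (A : Finset X.graph.edgeSet) :
    (1 - (comp _ _ _ _ ℂ (flipMatrix τ s)).submatrix (orientations A _) (orientations A _)).det =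
      ∏ e ∈ A, (1 - s ^ 2 * (X.edgeWeight e : ℂ)) ^ Module.finrank ℂ E := by
  let b : A → Matrix (Fin (Module.finrank ℂ E)) (Fin (Module.finrank ℂ E)) ℂ := fun e =>
    (s * X.weight (orient e.1)) • unitaryMatrix (edgeUnitary τ (orient e.1).symm)
  let c : A → Matrix (Fin (Module.finrank ℂ E)) (Fin (Module.finrank ℂ E)) ℂ := fun e =>
    (s * X.weight (orient e.1).symm) • unitaryMatrix (edgeUnitary τ (orient e.1))
  have h1 : 1 - (comp _ _ _ _ ℂ (flipMatrix τ s)).submatrix (orientations A _)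
      (orientations A _) = fromBlocks 1 (comp _ _ _ _ ℂ (diagonal b)) (comp _ _ _ _ ℂ (diagonal c))
        1 := by
    ext (⟨e, i⟩ | ⟨e, i⟩) (⟨e', i'⟩ | ⟨e', i'⟩)
    · have : orient e.1 ≠ (orient e'.1).symm := orient_ne_symm _ _
      simp [orientations_inl, flipMatrix, this, Matrix.one_apply]
    · have : orient e.1 = orient e'.1 ↔ e = e' :=
        ⟨fun h => Subtype.ext (orient_injective h), fun h => h ▸ rfl⟩
      by_cases h : e = e'
      · subst h
        simp [orientations_inl, orientations_inr, flipMatrix, b]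
      · simp [orientations_inl, orientations_inr, flipMatrix, this, h]
    · by_cases h : e = e'
      · subst h
        simp [orientations_inl, orientations_inr, flipMatrix, c]
      · have : (orient e.1).symm ≠ (orient e'.1).symm := fun h' =>
          h (Subtype.ext (orient_injective (SimpleGraph.Dart.symm_involutive.injective h')))
        simp [orientations_inl, orientations_inr, flipMatrix, this, h]
    · have : (orient e.1).symm ≠ orient e'.1 := (orient_ne_symm _ _).symm
      simp [orientations_inr, flipMatrix, this, Matrix.one_apply]
  have h2 : comp _ _ _ _ ℂ (diagonal c) * comp _ _ _ _ ℂ (diagonal b) =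
      comp _ _ _ _ ℂ (diagonal fun e => c e * b e) := by
    rw [← diagonal_mul_diagonal]
    exact (map_mul (compRingEquiv A (Fin (Module.finrank ℂ E)) ℂ) _ _).symm
  have h3 : ∀ e, c e * b e = (s ^ 2 * (X.edgeWeight e : ℂ)) • 1 := by
    intro e
    have := edgeUnitary_symm_mul τ (orient e.1).symm
    rw [SimpleGraph.Dart.symm_symm] at this
    simp only [c, b]
    rw [smul_mul_smul_comm, ← unitaryMatrix_mul, this, unitaryMatrix_one, edgeWeight_eq]
    congr 1
    push_cast
    ring
  have h4 : (1 : Matrix (A × Fin (Module.finrank ℂ E)) (A × Fin (Module.finrank ℂ E)) ℂ) -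
      comp _ _ _ _ ℂ (diagonal fun e => c e * b e) =
      diagonal fun p => 1 - s ^ 2 * (X.edgeWeight p.1 : ℂ) := by
    ext ⟨e, i⟩ ⟨e', i'⟩
    simp only [h3]
    by_cases h : e = e'
    · subst h
      by_cases h' : i = i'
      · subst h'
        simp
      · simp [h']
    · simp [h, diagonal_apply_ne]
  rw [h1, det_fromBlocks_one₁₁, h2, h4, det_diagonal, Fintype.prod_prod_type]
  simp only [Finset.prod_const, Finset.card_univ, Fintype.card_fin]
  exact Finset.prod_coe_sort A fun e => (1 - s ^ 2 * (X.edgeWeight e : ℂ)) ^ Module.finrank ℂ E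

/-- Truncating to both orientations of the edges in a finite set `A` gives exactly the partial
product over `A`, so convergence of the truncated determinants is convergence of the product. -/
theorem hasProd_fredholmDet_flipMatrix (s : ℂ) :
    HasProd (fun e : X.graph.edgeSet => (1 - s ^ 2 * (X.edgeWeight e : ℂ)) ^ Module.finrank ℂ E)
      (comp _ _ _ _ ℂ (flipMatrix τ s)).fredholmDet := by
  classical
  let d := Module.finrank ℂ E
  let T : Finset X.graph.edgeSet → Matrix (X.graph.Dart × Fin d) (X.graph.Dart × Fin d) ℂ :=
    fun A => .of fun p q => if ⟨p.1.edge, p.1.edge_mem⟩ ∈ A then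
      comp _ _ _ _ ℂ (flipMatrix τ s) p q else 0
  have hT : Tendsto (fun A => (T A).fredholmDet) atTop
      (𝓝 (comp _ _ _ _ ℂ (flipMatrix τ s)).fredholmDet) := by
    refine tendsto_fredholmDet (summable_dart_prod ‖s‖ d) (fun A p q => ?_) (fun p q => ?_)
    · simp only [T, of_apply]
      split_ifs
      · exact norm_flipMatrix_le τ s p.1 q.1 p.2 q.2
      · rw [norm_zero]
        exact mul_nonneg (norm_nonneg _) (X.weight_pos _).le
    · refine tendsto_const_nhds.congr' ?_
      filter_upwards [eventually_ge_atTop {⟨p.1.edge, p.1.edge_mem⟩}] with A hA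
      simp only [T, of_apply]
      rw [if_pos (Finset.singleton_subset_iff.1 hA)]
  refine hT.congr fun A => ?_
  rw [← det_flipMatrix_orientations, fredholmDet_eq_det (orientations A d)]
  · congr 2
    ext p q
    have hmem : ⟨(orientations A d p).1.edge, (orientations A d p).1.edge_mem⟩ ∈ A := by
      have h : ∀ (e : X.graph.Dart) (a : X.graph.edgeSet), a ∈ A → e.edge = a →
          ⟨e.edge, e.edge_mem⟩ ∈ A := fun e a ha h => by
        convert ha
      rcases p with ⟨a, i⟩ | ⟨a, i⟩
      · exact h _ a a.2 (orient_edge a.1)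
      · exact h _ a a.2 ((SimpleGraph.Dart.edge_symm _).trans (orient_edge a.1))
    simp only [T, submatrix_apply, of_apply]
    rw [if_pos hmem]
  · rintro ⟨e, i⟩ hp q
    simp only [T, of_apply]
    rw [if_neg]
    intro hA
    refine hp ?_
    have h1 : (orient ⟨e.edge, e.edge_mem⟩).edge = e.edge := orient_edge _
    rcases (SimpleGraph.dart_edge_eq_iff _ _).1 h1 with h2 | h2
    · exact ⟨.inl (⟨_, hA⟩, i), Prod.ext h2 rfl⟩
    · refine ⟨.inr (⟨_, hA⟩, i), Prod.ext ?_ rfl⟩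
      change (orient ⟨e.edge, e.edge_mem⟩).symm = e
      rw [h2, SimpleGraph.Dart.symm_symm]

end WeightedGraph

/-! ### Invertibility of `1 + uJ` -/

namespace WeightedGraph

open Filter Topology

variable {V : Type u} (X : WeightedGraph V) (L : HermitianLocalSystem.{u, v} X.graph)

theorem opSigma_apply (a : C₀ X L) (e : X.graph.Dart) :
    opSigma X L a e = (X.weight e : ℂ) • a e.fst := rfl

theorem opTau_apply (f : C₁ X L) (y : V) :
    opTau X L f y = ∑ x : X.graph.neighborSet y,
      L.transport (SimpleGraph.Adj.symm x.2) (f ⟨(x.1, y), SimpleGraph.Adj.symm x.2⟩) := rfl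

theorem opJ_opJ_apply (f : C₁ X L) (e : X.graph.Dart) :
    opJ X L (opJ X L f) e = (X.weight e * X.weight e.symm : ℂ) • f e := by
  have h : ∀ {x y : V} (h : X.graph.Adj x y) (a : L.fiber x) (c d : ℂ),
      c • L.transport h.symm (d • L.transport h a) = (c * d) • a := by
    intro x y h a c d
    rw [map_smul, smul_smul, L.transport_symm h, LinearIsometryEquiv.symm_apply_apply]
  exact h e.adj (f e) _ _

/-- The products `w(e) w(e⁻¹)` tend to zero along the cofinite filter, so these inverses tend to
`1`. Possible zero denominators are harmless for the bound, since there the inverse is `0`. -/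
theorem exists_norm_inv_le (s : ℂ) :
    ∃ C : ℝ, 0 ≤ C ∧ ∀ e : X.graph.Dart,
      ‖(1 - s ^ 2 * (X.weight e * X.weight e.symm : ℂ))⁻¹‖ ≤ C := by
  have hs : Summable fun e : X.graph.Dart => (X.weight e * X.weight e.symm : ℂ) := by
    refine Summable.of_norm_bounded (X.summable_weight.mul_right (∑' e, X.weight e)) fun e => ?_
    rw [norm_mul, Complex.norm_real, Complex.norm_real, Real.norm_of_nonneg (X.weight_pos _).le,
      Real.norm_of_nonneg (X.weight_pos _).le]
    exact mul_le_mul_of_nonneg_left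
      (X.summable_weight.le_tsum _ fun e _ => (X.weight_pos e).le) (X.weight_pos _).le
  have h1 : Tendsto (fun e : X.graph.Dart =>
      ‖(1 - s ^ 2 * (X.weight e * X.weight e.symm : ℂ))⁻¹‖) cofinite (𝓝 1) := by
    have h2 := ((hs.tendsto_cofinite_zero.const_mul (s ^ 2)).const_sub 1).inv₀ (by simp)
    simpa using h2.norm
  obtain ⟨C, hC⟩ := h1.bddAbove_range_of_cofinite
  exact ⟨max C 0, le_max_right _ _, fun e => (hC ⟨e, rfl⟩).trans (le_max_left _ _)⟩

/-- `J²` is diagonal, so `(1 - sJ)(1 + sJ)` is diagonal with nonzero entries whose inverses are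
bounded; commuting factors of an invertible operator are invertible. -/
theorem isUnit_one_add_smul_opJ {s : ℂ}
    (hs : ∀ e, s ^ 2 * (X.edgeWeight e : ℂ) ≠ 1) : IsUnit (1 + s • opJ X L) := by
  have hne : ∀ e : X.graph.Dart, 1 - s ^ 2 * (X.weight e * X.weight e.symm : ℂ) ≠ 0 := by
    intro e h
    refine hs ⟨e.edge, e.edge_mem⟩ ?_
    rw [X.edgeWeight_dart]
    push_cast
    exact (sub_eq_zero.1 h).symm
  obtain ⟨C, hC0, hC⟩ := X.exists_norm_inv_le s
  let D : C₁ X L →L[ℂ] C₁ X L := l2Operator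
    { toFun := fun f e => (1 - s ^ 2 * (X.weight e * X.weight e.symm : ℂ))⁻¹ • f e
      map_add' := fun f g => by
        ext e
        simp only [Pi.add_apply, smul_add]
      map_smul' := fun a f => by
        ext e
        simp only [Pi.smul_apply, RingHom.id_apply]
        exact smul_comm _ _ _ }
    ⟨C, hC0, fun f t => by
      have h1 : ∑ e ∈ t, ‖f e‖ ^ 2 ≤ ‖f‖ ^ 2 := by
        simpa using lp.sum_rpow_le_norm_rpow (p := 2) (by simp) f t
      refine le_trans ?_ (mul_le_mul_of_nonneg_left h1 (sq_nonneg C))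
      rw [Finset.mul_sum]
      refine Finset.sum_le_sum fun e _ => ?_
      change ‖(1 - s ^ 2 * (X.weight e * X.weight e.symm : ℂ))⁻¹ • f e‖ ^ 2 ≤ _
      rw [norm_smul, mul_pow]
      gcongr
      exact hC e⟩
  have hD : ∀ (f : C₁ X L) e, D f e =
      (1 - s ^ 2 * (X.weight e * X.weight e.symm : ℂ))⁻¹ • f e := fun _ _ => rfl
  have hJ : ∀ (f : C₁ X L) (e : X.graph.Dart),
      ((1 - s • opJ X L) * (1 + s • opJ X L)) f e =
        (1 - s ^ 2 * (X.weight e * X.weight e.symm : ℂ)) • f e := by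
    intro f e
    have h1 : (1 - s • opJ X L) * (1 + s • opJ X L) = 1 - s ^ 2 • (opJ X L * opJ X L) := by
      simp only [sub_mul, mul_add, one_mul, mul_one, smul_mul_smul_comm, pow_two]
      abel
    rw [h1]
    change f e - s ^ 2 • opJ X L (opJ X L f) e = _
    rw [opJ_opJ_apply, smul_smul, sub_smul, one_smul]
  have hcomm : (1 - s • opJ X L) * (1 + s • opJ X L) = (1 + s • opJ X L) * (1 - s • opJ X L) := by
    generalize s • opJ X L = y
    noncomm_ring
  have h1 : D * ((1 - s • opJ X L) * (1 + s • opJ X L)) = 1 := by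
    ext f e
    change D (((1 - s • opJ X L) * (1 + s • opJ X L)) f) e = f e
    rw [hD, hJ, smul_smul, inv_mul_cancel₀ (hne e), one_smul]
  have h2 : ((1 - s • opJ X L) * (1 + s • opJ X L)) * D = 1 := by
    ext f e
    change ((1 - s • opJ X L) * (1 + s • opJ X L)) (D f) e = f e
    rw [hJ, hD, smul_smul, mul_inv_cancel₀ (hne e), one_smul]
  rw [isUnit_iff_exists_and_exists]
  refine ⟨⟨(1 - s • opJ X L) * D, ?_⟩, ⟨D * (1 - s • opJ X L), ?_⟩⟩
  · rw [← mul_assoc, ← hcomm, h2]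
  · rw [mul_assoc, h1]

end WeightedGraph

/-! ### Trivialisation of a local system -/

namespace HermitianLocalSystem

variable {V : Type u} {G : SimpleGraph V} (L : HermitianLocalSystem.{u, v} G)

theorem transportAlong_append {x y z : V} (p : G.Walk x y) (q : G.Walk y z) (a : L.fiber x) :
    L.transportAlong (p.append q) a = L.transportAlong q (L.transportAlong p a) := by
  induction p with
  | nil => rfl
  | cons h p ih => exact ih q (L.transport h a)

theorem transportAlong_reverse {x y : V} (p : G.Walk x y) (a : L.fiber x) :
    L.transportAlong p.reverse (L.transportAlong p a) = a := by
  induction p with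
  | nil => rfl
  | cons h p ih =>
    rw [SimpleGraph.Walk.reverse_cons, transportAlong_append]
    have h1 := ih (L.transport h a)
    change L.transport h.symm (L.transportAlong p.reverse (L.transportAlong p (L.transport h a))) = a
    rw [h1, L.transport_symm h, LinearIsometryEquiv.symm_apply_apply]

end HermitianLocalSystem

namespace WeightedGraph

open Matrix

variable {V : Type u} {X : WeightedGraph V} {x₀ : V} {L : HermitianLocalSystem.{u, v} X.graph}
variable {E : Type v} [NormedAddCommGroup E] [InnerProductSpace ℂ E]
variable {τ : X.graph.FundGroup x₀ →* (E ≃ₗᵢ[ℂ] E)}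

/-- The frame of the fiber at `x` obtained by parallel transport along the base path. -/
noncomputable def frame (φ : E ≃ₗᵢ[ℂ] L.fiber x₀) (x : V) : E ≃ₗᵢ[ℂ] L.fiber x :=
  φ.trans (L.transportAlong (X.basePath x₀ x))

/-- Apply the hypothesis to the loop that joins the edge to the base point, then transport along the
last base path to undo its reversal. -/
theorem transport_frame {φ : E ≃ₗᵢ[ℂ] L.fiber x₀}
    (hφ : ∀ (p : X.graph.Walk x₀ x₀) (a : E), L.transportAlong p (φ a) = φ (τ (.mk p) a))
    (e : X.graph.Dart) (a : E) :
    L.transport e.adj (frame φ e.fst a) = frame φ e.snd (edgeUnitary τ e a) := by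
  have h1 := hφ ((X.basePath x₀ e.fst).append
    (e.adj.toWalk.append (X.basePath x₀ e.snd).reverse)) a
  rw [L.transportAlong_append, L.transportAlong_append] at h1
  have h2 := congrArg (L.transportAlong (X.basePath x₀ e.snd)) h1
  have h3 := L.transportAlong_reverse (X.basePath x₀ e.snd).reverse
    (L.transportAlong e.adj.toWalk (L.transportAlong (X.basePath x₀ e.fst) (φ a)))
  rw [SimpleGraph.Walk.reverse_reverse] at h3
  exact h3.symm.trans h2

variable [FiniteDimensional ℂ E]

/-- The orthonormal basis of the fiber at `x` given by the frame. -/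
noncomputable def fiberBasis (φ : E ≃ₗᵢ[ℂ] L.fiber x₀) (x : V) :
    OrthonormalBasis (Fin (Module.finrank ℂ E)) ℂ (L.fiber x) :=
  (stdOrthonormalBasis ℂ E).map (frame φ x)

theorem transport_fiberBasis {φ : E ≃ₗᵢ[ℂ] L.fiber x₀}
    (hφ : ∀ (p : X.graph.Walk x₀ x₀) (a : E), L.transportAlong p (φ a) = φ (τ (.mk p) a))
    (e : X.graph.Dart) (j : Fin (Module.finrank ℂ E)) :
    L.transport e.adj (fiberBasis φ e.fst j) =
      ∑ i, unitaryMatrix (edgeUnitary τ e) i j • fiberBasis φ e.snd i := by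
  simp only [fiberBasis, OrthonormalBasis.map_apply, unitaryMatrix_apply]
  rw [transport_frame hφ]
  simp only [← map_smul]
  rw [← map_sum, OrthonormalBasis.sum_repr']

theorem inner_transport_fiberBasis {φ : E ≃ₗᵢ[ℂ] L.fiber x₀}
    (hφ : ∀ (p : X.graph.Walk x₀ x₀) (a : E), L.transportAlong p (φ a) = φ (τ (.mk p) a))
    (e : X.graph.Dart) (i j : Fin (Module.finrank ℂ E)) :
    ⟪fiberBasis φ e.snd i, L.transport e.adj (fiberBasis φ e.fst j)⟫_ℂ =
      unitaryMatrix (edgeUnitary τ e) i j := by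
  rw [transport_fiberBasis hφ, (fiberBasis φ e.snd).orthonormal.inner_right_fintype]

/-! ### The operators in coordinates -/

theorem lp_single_sum_smul {ι κ : Type*} [DecidableEq ι] {A : ι → Type*} [∀ i, NormedAddCommGroup (A i)]
    [∀ i, InnerProductSpace ℂ (A i)] (i : ι) (s : Finset κ) (c : κ → ℂ) (a : κ → A i) :
    (lp.single 2 i (∑ k ∈ s, c k • a k) : lp A 2) = ∑ k ∈ s, c k • lp.single 2 i (a k) := by
  have := map_sum (lp.lsingle (𝕜 := ℂ) (E := A) 2 i) (fun k => c k • a k) s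
  simp only [map_smul] at this
  exact this

open Classical in
/-- A vector of the orthonormal basis of `C₀`. -/
noncomputable def vertexVec (φ : E ≃ₗᵢ[ℂ] L.fiber x₀) (x : V) (i : Fin (Module.finrank ℂ E)) :
    C₀ X L := lp.single 2 x (fiberBasis φ x i)

open Classical in
/-- A vector of the orthonormal basis of `C₁`. -/
noncomputable def dartVec (φ : E ≃ₗᵢ[ℂ] L.fiber x₀) (e : X.graph.Dart)
    (i : Fin (Module.finrank ℂ E)) : C₁ X L :=
  lp.single (E := fun e : X.graph.Dart => L.fiber e.fst) 2 e (fiberBasis φ e.fst i)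

variable (φ : E ≃ₗᵢ[ℂ] L.fiber x₀)

theorem norm_vertexVec (x : V) (i : Fin (Module.finrank ℂ E)) : ‖vertexVec (X := X) φ x i‖ = 1 := by
  classical
  rw [vertexVec, lp.norm_single (by simp), OrthonormalBasis.norm_eq_one]

theorem norm_dartVec (e : X.graph.Dart) (i : Fin (Module.finrank ℂ E)) : ‖dartVec φ e i‖ = 1 := by
  classical
  rw [dartVec, lp.norm_single (by simp), OrthonormalBasis.norm_eq_one]

theorem inner_vertexVec (x : V) (i : Fin (Module.finrank ℂ E)) (a : C₀ X L) :
    ⟪vertexVec φ x i, a⟫_ℂ = ⟪fiberBasis φ x i, a x⟫_ℂ := by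
  classical exact lp.inner_single_left _ _ _

theorem opJ_dartVec {φ : E ≃ₗᵢ[ℂ] L.fiber x₀}
    (hφ : ∀ (p : X.graph.Walk x₀ x₀) (a : E), L.transportAlong p (φ a) = φ (τ (.mk p) a))
    (e : X.graph.Dart) (j : Fin (Module.finrank ℂ E)) :
    opJ X L (dartVec φ e j) = ∑ i, (X.weight e.symm * unitaryMatrix (edgeUnitary τ e) i j) •
      dartVec φ e.symm i := by
  classical
  have h1 : ∑ i, (X.weight e.symm * unitaryMatrix (edgeUnitary τ e) i j : ℂ) • dartVec φ e.symm i =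
      lp.single (E := fun e : X.graph.Dart => L.fiber e.fst) 2 e.symm
        ((X.weight e.symm : ℂ) • L.transport e.adj (fiberBasis φ e.fst j)) := by
    have h2 : (X.weight e.symm : ℂ) • L.transport e.adj (fiberBasis φ e.fst j) =
        ∑ i, (X.weight e.symm * unitaryMatrix (edgeUnitary τ e) i j : ℂ) •
          fiberBasis φ e.symm.fst i := by
      rw [transport_fiberBasis hφ, Finset.smul_sum]
      exact Finset.sum_congr rfl fun i _ => smul_smul _ _ _
    rw [h2]
    exact (lp_single_sum_smul (A := fun e : X.graph.Dart => L.fiber e.fst) e.symm _ _ _).symm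
  rw [h1]
  ext e'
  by_cases h : e' = e.symm
  · subst h
    have h2 : dartVec φ e j e = fiberBasis φ e.fst j := lp.single_apply_self _ _ _
    exact (congrArg (fun z => (X.weight e.symm : ℂ) • L.transport e.adj z) h2).trans
      (lp.single_apply_self (E := fun e : X.graph.Dart => L.fiber e.fst) 2 e.symm _).symm
  · have h' : e'.symm ≠ e := fun h' => h (by rw [← h', SimpleGraph.Dart.symm_symm])
    have h2 : dartVec φ e j e'.symm = 0 := lp.single_apply_ne _ _ _ h'
    have h3 : (X.weight e' : ℂ) • L.transport e'.symm.adj (dartVec φ e j e'.symm) = 0 := by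
      rw [h2, map_zero, smul_zero]
    exact h3.trans (lp.single_apply_ne (E := fun e : X.graph.Dart => L.fiber e.fst) 2 e.symm _ h).symm

theorem inner_vertexVec_opTau_dartVec {φ : E ≃ₗᵢ[ℂ] L.fiber x₀}
    (hφ : ∀ (p : X.graph.Walk x₀ x₀) (a : E), L.transportAlong p (φ a) = φ (τ (.mk p) a))
    (x : V) (e : X.graph.Dart) (i j : Fin (Module.finrank ℂ E)) [Decidable (e.snd = x)] :
    ⟪vertexVec φ x i, opTau X L (dartVec φ e j)⟫_ℂ =
      if e.snd = x then unitaryMatrix (edgeUnitary τ e) i j else 0 := by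
  classical
  rw [inner_vertexVec, opTau_apply, inner_sum]
  split_ifs with h
  · subst h
    rw [Finset.sum_eq_single ⟨e.fst, e.adj.symm⟩]
    · refine Eq.trans ?_ (inner_transport_fiberBasis hφ e i j)
      congr 2
      exact lp.single_apply_self _ _ _
    · intro y _ hy
      have h1 : (⟨(y.1, e.snd), SimpleGraph.Adj.symm y.2⟩ : X.graph.Dart) ≠ e := by
        intro h1
        exact hy (Subtype.ext (congrArg (fun d : X.graph.Dart => d.fst) h1))
      rw [dartVec, lp.single_apply_ne _ _ _ h1, map_zero, inner_zero_right]
    · exact fun h => absurd (Finset.mem_univ _) h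
  · refine Finset.sum_eq_zero fun y _ => ?_
    have h1 : (⟨(y.1, x), SimpleGraph.Adj.symm y.2⟩ : X.graph.Dart) ≠ e := by
      intro h1
      exact h (congrArg (fun d : X.graph.Dart => d.snd) h1).symm
    rw [dartVec, lp.single_apply_ne _ _ _ h1, map_zero, inner_zero_right]

/-- This expansion of `σ` into operators of rank one converges absolutely because the weights are
summable; it is the source of the trace class property. -/
theorem hasSum_opSigma (a : C₀ X L) :
    HasSum (fun p : X.graph.Dart × Fin (Module.finrank ℂ E) =>
      (X.weight p.1 * ⟪vertexVec φ p.1.fst p.2, a⟫_ℂ) • dartVec φ p.1 p.2) (opSigma X L a) := by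
  classical
  have hs : Summable fun p : X.graph.Dart × Fin (Module.finrank ℂ E) =>
      (X.weight p.1 * ⟪vertexVec φ p.1.fst p.2, a⟫_ℂ) • dartVec φ p.1 p.2 := by
    refine Summable.of_norm_bounded (summable_dart_prod ‖a‖ _) fun p => ?_
    rw [norm_smul, norm_dartVec, mul_one, norm_mul, Complex.norm_real,
      Real.norm_of_nonneg (X.weight_pos _).le, mul_comm]
    refine mul_le_mul_of_nonneg_right ?_ (X.weight_pos _).le
    simpa [norm_vertexVec] using norm_inner_le_norm (𝕜 := ℂ) (vertexVec φ p.1.fst p.2) a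
  have h1 := hs.hasSum.prod_fiberwise fun e => hasSum_fintype _
  have h2 := lp.hasSum_single (E := fun e : X.graph.Dart => L.fiber e.fst) (p := 2) (by simp)
    (opSigma X L a)
  have h3 : ∀ e : X.graph.Dart,
      lp.single (E := fun e : X.graph.Dart => L.fiber e.fst) 2 e (opSigma X L a e) =
      ∑ i, ((X.weight e : ℂ) * ⟪vertexVec φ e.fst i, a⟫_ℂ) • dartVec φ e i := by
    intro e
    have h4 : opSigma X L a e = ∑ i, ((X.weight e : ℂ) * ⟪vertexVec φ e.fst i, a⟫_ℂ) •
        fiberBasis φ e.fst i := by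
      rw [opSigma_apply]
      conv_lhs => rw [← (fiberBasis φ e.fst).sum_repr' (a e.fst), Finset.smul_sum]
      exact Finset.sum_congr rfl fun i _ => by rw [smul_smul, inner_vertexVec]
    rw [h4]
    exact lp_single_sum_smul (A := fun e : X.graph.Dart => L.fiber e.fst) e _ _ _
  rw [h2.unique (h1.congr_fun h3)]
  exact hs.hasSum

end WeightedGraph

/-! ### Comparison of the edge determinant with the operator determinant -/

namespace Matrix

/-- Both minors equal `(∏ x m)²` times that of `c`. It relates the matrix with `√w` on both sides to
the one with `w` on the rows. -/
theorem principalMinor_symmetrize {ι : Type*} (x : ι → ℂ) (c : ι → ι → ℂ) (S : Finset ι) :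
    (Matrix.of fun m n => x m * (x n * c m n)).principalMinor S =
      (Matrix.of fun m n => x m * (x m * c m n)).principalMinor S := by
  classical
  let A : Matrix S S ℂ := .of fun m n => c m n
  let y : S → ℂ := fun m => x m
  exact ((det_mul_column y (.of fun m n => y n * A m n)).trans
    (congrArg _ ((det_mul_row y A).trans (det_mul_column y A).symm))).trans
      (det_mul_column y (.of fun m n => y m * A m n)).symm

end Matrix

namespace WeightedGraph

open Matrix

variable {V : Type u} {X : WeightedGraph V} {x₀ : V} {L : HermitianLocalSystem.{u, v} X.graph}
variable {E : Type v} [NormedAddCommGroup E] [InnerProductSpace ℂ E] [FiniteDimensional ℂ E]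
variable {τ : X.graph.FundGroup x₀ →* (E ≃ₗᵢ[ℂ] E)}

theorem countable_dart (X : WeightedGraph V) : Countable X.graph.Dart := by
  have h := X.summable_weight.countable_support
  rw [Function.support_eq_univ fun e => (X.weight_pos e).ne'] at h
  exact Set.countable_univ_iff.1 h

/-- The matrix coefficients of `s 𝗍 R`, for an operator `R` on `C₁`. -/
noncomputable def coeff (φ : E ≃ₗᵢ[ℂ] L.fiber x₀) (s : ℂ) (R : C₁ X L →L[ℂ] C₁ X L)
    (m n : X.graph.Dart × Fin (Module.finrank ℂ E)) : ℂ :=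
  ⟪vertexVec φ m.1.fst m.2, (s • (opTau X L ∘L R)) (dartVec φ n.1 n.2)⟫_ℂ

theorem norm_coeff_le (φ : E ≃ₗᵢ[ℂ] L.fiber x₀) (s : ℂ) (R : C₁ X L →L[ℂ] C₁ X L)
    (m n : X.graph.Dart × Fin (Module.finrank ℂ E)) :
    ‖coeff φ s R m n‖ ≤ ‖s • (opTau X L ∘L R)‖ := by
  have h1 := norm_inner_le_norm (𝕜 := ℂ) (vertexVec φ m.1.fst m.2)
    ((s • (opTau X L ∘L R)) (dartVec φ n.1 n.2))
  have h2 := (s • (opTau X L ∘L R)).le_opNorm (dartVec φ n.1 n.2)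
  rw [norm_dartVec, mul_one] at h2
  rw [norm_vertexVec, one_mul] at h1
  exact h1.trans h2

theorem sqrt_weight_mul_self (X : WeightedGraph V) (e : X.graph.Dart) :
    (√(X.weight e) : ℂ) * √(X.weight e) = X.weight e := by
  rw [← Complex.ofReal_mul, Real.mul_self_sqrt (X.weight_pos e).le]

theorem smul_opJ_dartVec {φ : E ≃ₗᵢ[ℂ] L.fiber x₀}
    (hφ : ∀ (p : X.graph.Walk x₀ x₀) (a : E), L.transportAlong p (φ a) = φ (τ (.mk p) a))
    (s : ℂ) (n : X.graph.Dart × Fin (Module.finrank ℂ E)) :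
    HasSum (fun k => comp _ _ _ _ ℂ (flipMatrix τ s) k n • dartVec φ k.1 k.2)
      (-(s • opJ X L (dartVec φ n.1 n.2))) := by
  classical
  have h1 : -(s • opJ X L (dartVec φ n.1 n.2)) =
      ∑ k ∈ ({n.1.symm} : Finset X.graph.Dart) ×ˢ (Finset.univ : Finset (Fin (Module.finrank ℂ E))),
        comp _ _ _ _ ℂ (flipMatrix τ s) k n • dartVec φ k.1 k.2 := by
    rw [opJ_dartVec hφ, Finset.sum_product, Finset.sum_singleton, Finset.smul_sum,
      ← Finset.sum_neg_distrib]
    refine Finset.sum_congr rfl fun i _ => ?_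
    have : comp _ _ _ _ ℂ (flipMatrix τ s) (n.1.symm, i) n =
        -(s * (X.weight n.1.symm * unitaryMatrix (edgeUnitary τ n.1) i n.2)) := by
      change flipMatrix τ s n.1.symm n.1 i n.2 = _
      rw [flipMatrix, of_apply, if_pos rfl, Matrix.smul_apply, smul_eq_mul]
      ring
    rw [this, neg_smul, smul_smul]
  rw [h1]
  refine hasSum_sum_of_ne_finset_zero fun k hk => ?_
  have h2 : k.1 ≠ n.1.symm := fun h => hk (Finset.mem_product.2
    ⟨Finset.mem_singleton.2 h, Finset.mem_univ _⟩)
  have : comp _ _ _ _ ℂ (flipMatrix τ s) k n = 0 := by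
    change flipMatrix τ s k.1 n.1 k.2 n.2 = _
    rw [flipMatrix, of_apply, if_neg h2, Matrix.zero_apply]
  rw [this, zero_smul]

/-- The matrix form of `1 - s(σ𝗍 - J) = (1 - s σ𝗍R)(1 + sJ)`. The first matrix on the right is that
of `s σ𝗍R`, the second that of `-sJ`, and `P` is their product. -/
theorem fredholmDet_edgeMatrix_eq_mul {φ : E ≃ₗᵢ[ℂ] L.fiber x₀}
    (hφ : ∀ (p : X.graph.Walk x₀ x₀) (a : E), L.transportAlong p (φ a) = φ (τ (.mk p) a))
    {s : ℂ} {R : C₁ X L →L[ℂ] C₁ X L} (hR : R * (1 + s • opJ X L) = 1) :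
    (comp _ _ _ _ ℂ (edgeMatrix τ s)).fredholmDet =
      (Matrix.of fun m n => (X.weight m.1 : ℂ) * coeff φ s R m n).fredholmDet *
        (comp _ _ _ _ ℂ (flipMatrix τ s)).fredholmDet := by
  classical
  let T : C₁ X L →L[ℂ] C₀ X L := s • (opTau X L ∘L R)
  let P : Matrix (X.graph.Dart × Fin (Module.finrank ℂ E)) (X.graph.Dart × Fin (Module.finrank ℂ E))
    ℂ := .of fun m n => (X.weight m.1 : ℂ) * ⟪vertexVec φ m.1.fst m.2,
      T (-(s • opJ X L (dartVec φ n.1 n.2)))⟫_ℂ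
  rw [← fredholmDet_mul (P := P) (summable_dart_prod ‖T‖ _) (summable_dart_prod ‖s‖ _)]
  · congr 1
    ext m n
    have h1 : T (dartVec φ n.1 n.2) - T (-(s • opJ X L (dartVec φ n.1 n.2))) =
        s • opTau X L (dartVec φ n.1 n.2) := by
      rw [← map_sub, sub_neg_eq_add]
      change s • opTau X L ((R * (1 + s • opJ X L)) (dartVec φ n.1 n.2)) = _
      rw [hR]
      rfl
    have h2 : (X.weight m.1 : ℂ) * coeff φ s R m n - P m n =
        X.weight m.1 * (s * ⟪vertexVec φ m.1.fst m.2, opTau X L (dartVec φ n.1 n.2)⟫_ℂ) := by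
      rw [← inner_smul_right, ← h1, inner_sub_right, mul_sub]
      rfl
    change edgeMatrix τ s m.1 n.1 m.2 n.2 = (X.weight m.1 : ℂ) * coeff φ s R m n +
      flipMatrix τ s m.1 n.1 m.2 n.2 - P m n
    rw [add_sub_right_comm, h2, inner_vertexVec_opTau_dartVec hφ, edgeMatrix, flipMatrix, of_apply,
      of_apply]
    -- `σ𝗍` leads from an edge to all edges leaving its target, including the reversed edge; the
    -- flip cancels exactly this last transition.
    by_cases h3 : n.1.snd = m.1.fst
    · by_cases h4 : m.1 = n.1.symm
      · have h5 : ¬ n.1.NonBacktracking m.1 := fun h => h.2 (by rw [h4]; rfl)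
        rw [if_pos h3, if_pos h4, if_neg h5, Matrix.smul_apply, Matrix.zero_apply, smul_eq_mul]
        ring
      · have h5 : n.1.NonBacktracking m.1 := ⟨h3, fun h => h4 (by
          ext
          · exact h3.symm
          · exact h.symm)⟩
        rw [if_pos h3, if_neg h4, if_pos h5, Matrix.smul_apply, Matrix.zero_apply, smul_eq_mul]
        ring
    · have h4 : m.1 ≠ n.1.symm := fun h => h3 (by rw [h]; rfl)
      have h5 : ¬ n.1.NonBacktracking m.1 := fun h => h3 h.1
      rw [if_neg h3, if_neg h4, if_neg h5, Matrix.zero_apply]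
      ring
  · intro m n
    rw [of_apply, norm_mul, Complex.norm_real, Real.norm_of_nonneg (X.weight_pos _).le, mul_comm]
    exact mul_le_mul_of_nonneg_right (norm_coeff_le φ s R m n) (X.weight_pos _).le
  · exact fun m n => norm_flipMatrix_le τ s m.1 n.1 m.2 n.2
  · intro m n
    have h1 := (((smul_opJ_dartVec hφ s n).mapL T).mapL
      (innerSL ℂ (vertexVec φ m.1.fst m.2))).mul_left (X.weight m.1 : ℂ)
    refine h1.congr_fun fun k => ?_
    rw [of_apply, map_smul, map_smul, smul_eq_mul, innerSL_apply_apply]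
    change _ = _ * (_ * coeff φ s R m k)
    ring

theorem hasSum_opK (φ : E ≃ₗᵢ[ℂ] L.fiber x₀) (s : ℂ) (a : C₀ X L) :
    HasSum (fun p : X.graph.Dart × Fin (Module.finrank ℂ E) =>
      ⟪(√(X.weight p.1) : ℂ) • vertexVec φ p.1.fst p.2, a⟫_ℂ •
        ((√(X.weight p.1) : ℂ) • (s • (opTau X L ∘L Ring.inverse (1 + s • opJ X L)))
          (dartVec φ p.1 p.2))) (opK X L s a) := by
  refine ((hasSum_opSigma φ a).mapL
    (s • (opTau X L ∘L Ring.inverse (1 + s • opJ X L)))).congr_fun fun p => ?_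
  rw [inner_smul_left, Complex.conj_ofReal, smul_smul, map_smul, mul_right_comm,
    sqrt_weight_mul_self]

/-- With `√w` given to each side of the expansion of `s 𝗍Rσ`, both families of vectors are square
summable. The matrix of their inner products has the same principal minors as that of `s σ𝗍R`, the
first factor in `fredholmDet_edgeMatrix_eq_mul`. -/
theorem fredholmDet_opK {φ : E ≃ₗᵢ[ℂ] L.fiber x₀}
    (hφ : ∀ (p : X.graph.Walk x₀ x₀) (a : E), L.transportAlong p (φ a) = φ (τ (.mk p) a))
    {s : ℂ} (hs : IsUnit (1 + s • opJ X L)) :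
    IsTraceClass (opK X L s) ∧ ∃ d : ℂ, HasFredholmDet (opK X L s) d ∧
      (comp _ _ _ _ ℂ (edgeMatrix τ s)).fredholmDet =
        d * (comp _ _ _ _ ℂ (flipMatrix τ s)).fredholmDet := by
  set R := Ring.inverse (1 + s • opJ X L) with hRdef
  set T : C₁ X L →L[ℂ] C₀ X L := s • (opTau X L ∘L R) with hT
  let g : X.graph.Dart × Fin (Module.finrank ℂ E) → C₀ X L := fun p =>
    (√(X.weight p.1) : ℂ) • vertexVec φ p.1.fst p.2
  let f : X.graph.Dart × Fin (Module.finrank ℂ E) → C₀ X L := fun p =>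
    (√(X.weight p.1) : ℂ) • T (dartVec φ p.1 p.2)
  have hsq : ∀ e, ‖(√(X.weight e) : ℂ)‖ = √(X.weight e) := fun e => by
    rw [Complex.norm_real, Real.norm_of_nonneg (Real.sqrt_nonneg _)]
  have hg : ∀ p, ‖g p‖ = √(X.weight p.1) := fun p => by
    rw [norm_smul, norm_vertexVec, mul_one, hsq]
  have hf : ∀ p, ‖f p‖ ≤ √(X.weight p.1) * ‖T‖ := fun p => by
    rw [norm_smul, hsq]
    have h2 := T.le_opNorm (dartVec φ p.1 p.2)
    rw [norm_dartVec, mul_one] at h2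
    exact mul_le_mul_of_nonneg_left h2 (Real.sqrt_nonneg _)
  have := X.countable_dart
  refine ⟨isTraceClass_of_hasSum (f := f) (g := g) ?_ (hasSum_opK φ s), _,
    hasFredholmDet_of_factorization (f := f) (g := g) ?_ ?_ (hasSum_opK φ s) ?_,
    fredholmDet_edgeMatrix_eq_mul hφ (Ring.inverse_mul_cancel _ hs)⟩
  · refine Summable.of_nonneg_of_le (fun p => by positivity) (fun p => ?_)
      (summable_dart_prod ‖T‖ _)
    rw [hg]
    refine (mul_le_mul_of_nonneg_right (hf p) (Real.sqrt_nonneg _)).trans_eq ?_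
    rw [mul_right_comm, Real.mul_self_sqrt (X.weight_pos _).le, mul_comm]
  · refine Summable.of_nonneg_of_le (fun p => by positivity) (fun p => ?_)
      (summable_dart_prod (‖T‖ ^ 2) _)
    refine (pow_le_pow_left₀ (norm_nonneg _) (hf p) 2).trans_eq ?_
    rw [mul_pow, Real.sq_sqrt (X.weight_pos _).le, mul_comm]
  · refine (summable_dart_prod 1 _).congr fun p => ?_
    rw [hg, Real.sq_sqrt (X.weight_pos _).le, one_mul]
  · have h1 : (Matrix.of fun m n => ⟪g m, f n⟫_ℂ) =
        .of fun m n : X.graph.Dart × Fin (Module.finrank ℂ E) =>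
          (√(X.weight m.1) : ℂ) * ((√(X.weight n.1) : ℂ) * coeff φ s R m n) := by
      ext m n
      rw [of_apply, of_apply, inner_smul_left, inner_smul_right, Complex.conj_ofReal]
      rfl
    have h2 : (Matrix.of fun m n => (X.weight m.1 : ℂ) * coeff φ s R m n) =
        .of fun m n : X.graph.Dart × Fin (Module.finrank ℂ E) =>
          (√(X.weight m.1) : ℂ) * ((√(X.weight m.1) : ℂ) * coeff φ s R m n) := by
      ext m n
      rw [of_apply, of_apply, ← mul_assoc, sqrt_weight_mul_self]
    rw [h1, h2]
    simp only [principalMinor_symmetrize (fun m : X.graph.Dart × Fin (Module.finrank ℂ E) =>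
      (√(X.weight m.1) : ℂ)) (coeff φ s R)]
    rw [← h2]
    refine hasSum_fredholmDet (summable_dart_prod ‖T‖ _) fun m n => ?_
    rw [of_apply, norm_mul, Complex.norm_real, Real.norm_of_nonneg (X.weight_pos _).le, mul_comm]
    exact mul_le_mul_of_nonneg_right (norm_coeff_le φ s R m n) (X.weight_pos _).le

end WeightedGraph

/-! ### The main theorem -/

theorem mainTheorem4 {V : Type u} (X : WeightedGraph V) (x₀ : V)
    {E : Type v} [NormedAddCommGroup E] [InnerProductSpace ℂ E] [FiniteDimensional ℂ E]
    (τ : X.graph.FundGroup x₀ →* (E ≃ₗᵢ[ℂ] E)) :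
    ∃ F P : ℂ → ℂ, Differentiable ℂ F ∧ Differentiable ℂ P ∧
      (∃ r : ℝ, 0 < r ∧ ∀ u : ℂ, ‖u‖ < r →
        (∀ c : X.graph.PrimeCycle, X.eulerDet τ u c.path ≠ 0) ∧ F u ≠ 0 ∧
        HasProd (fun c : X.graph.PrimeCycle => (X.eulerDet τ u c.path)⁻¹) (F u)⁻¹) ∧
      (∀ u : ℂ, HasProd (fun e : X.graph.edgeSet =>
        (1 - u ^ 2 * (X.edgeWeight e : ℂ)) ^ Module.finrank ℂ E) (P u)) ∧
      ∀ L : HermitianLocalSystem.{u, v} X.graph, L.IsGivenBy τ →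
        ∀ u : ℂ, (∀ e, u ^ 2 * (X.edgeWeight e : ℂ) ≠ 1) →
          IsUnit (1 + u • X.opJ L) ∧ IsTraceClass (X.opK L u) ∧
          ∃ d : ℂ, HasFredholmDet (X.opK L u) d ∧ F u = d * P u := by
  -- `F` and `P` are the Fredholm determinants of the edge matrix and of the flip matrix; neither
  -- depends on the choice of a local system.
  refine ⟨_, _, WeightedGraph.differentiable_fredholmDet_edgeMatrix τ,
    WeightedGraph.differentiable_fredholmDet_flipMatrix τ, ?_,
    WeightedGraph.hasProd_fredholmDet_flipMatrix τ, ?_⟩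
  · let W := ∑' e, X.weight e
    let d : ℝ := Module.finrank ℂ E
    have hW : 0 ≤ W := tsum_nonneg fun e => (X.weight_pos e).le
    have hd : 0 ≤ d := Nat.cast_nonneg _
    have hc : 0 < (d + 1) * ((d + 1) * (W + 1)) := by positivity
    -- Both `d ‖u‖ W` and `d² ‖u‖ W` must be below `1`. Adding `1` to `d` and `W` covers the zero
    -- space and the edgeless graph, and lets one radius serve both conditions.
    refine ⟨((d + 1) * ((d + 1) * (W + 1)))⁻¹, inv_pos.2 hc, fun u hu => ?_⟩
    have h1 : (d + 1) * ((d + 1) * (‖u‖ * (W + 1))) < 1 := by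
      have := mul_lt_mul_of_pos_right hu hc
      rw [inv_mul_cancel₀ hc.ne'] at this
      refine lt_of_eq_of_lt ?_ this
      ring
    have h0 : ‖u‖ * W ≤ ‖u‖ * (W + 1) :=
      mul_le_mul_of_nonneg_left (by linarith) (norm_nonneg _)
    have h0' : 0 ≤ ‖u‖ * W := mul_nonneg (norm_nonneg _) hW
    have h2 : d * (‖u‖ * W) ≤ (d + 1) * (‖u‖ * (W + 1)) :=
      mul_le_mul (by linarith) h0 h0' (by linarith)
    have h3 : 0 ≤ d * (‖u‖ * W) := mul_nonneg hd h0'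
    refine WeightedGraph.hasProd_eulerDet τ (lt_of_le_of_lt ?_ h1) (lt_of_le_of_lt ?_ h1)
    · exact h2.trans (le_mul_of_one_le_left (h3.trans h2) (by linarith))
    · exact mul_le_mul (by linarith) h2 h3 (by linarith)
  · rintro L ⟨φ, hφ⟩ u hu
    have h := WeightedGraph.isUnit_one_add_smul_opJ X L hu
    exact ⟨h, WeightedGraph.fredholmDet_opK hφ h⟩
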